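/- Let $\Sigma_I,\Sigma_B,\Sigma_O$ be finite alphabets. A DFA $\mathcal A$ (finite state set $Q$, one initial state, at most one transition for each state and letter) over a product alphabet $\Sigma\times\Sigma'$ describes the length-preserving relation $R(\mathcal A)\subseteq\Sigma^*\times\Sigma'^*$ that consists of all pairs $(u,v)$ with $|u|=|v|$ such that the word $(u_1,v_1)(u_2,v_2)\cdots$ over $\Sigma\times\Sigma'$ is accepted by $\mathcal A$; relations of this form are called automatic. For relations $R\subseteq\Sigma_I^*\times\Sigma_O^*$, $R_1\subseteq\Sigma_I^*\times\Sigma_B^*$ and $R_2\subseteq\Sigma_B^*\times\Sigma_O^*$ write $R_1\circ R_2=\{(i,o)\mid\exists b\;\,(i,b)\in R_1,\ (b,o)\in R_2\}$. The pair $(R_1,R_2)$ meets the TD condition for $R$ if $\mathrm{Img}(R_1)\subseteq\mathrm{Dom}(R_2)$ and $R_1\circ R_2=R$; it meets the PD condition for $R$ if $\mathrm{Img}(R_1)\subseteq\mathrm{Dom}(R_2)$, $\mathrm{Dom}(R_1\circ R_2)=\mathrm{Dom}(R)$ and $R_1\circ R_2\subseteq R$. An instance of TDP (respectively PDP) for automatic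 relations with a hint $\mathcal A_{R_2}$ consists of finite alphabets $\Sigma_I,\Sigma_B,\Sigma_O$, a DFA $\mathcal A_R$ over $\Sigma_I\times\Sigma_O$ that describes a relation $R$, and a DFA $\mathcal A_{R_2}$ over $\Sigma_B\times\Sigma_O$ that describes a relation $R_2$. The question is whether there is a DFA $\mathcal A_{R_1}$ over $\Sigma_I\times\Sigma_B$, describing a relation $R_1$, such that $(R_1,R_2)$ meets the TD condition (respectively the PD condition) for $R$. Instances are encoded as binary words by listing the alphabet sizes and the initial states, accepting states and transition tables of the two automata, each number in unary, so that the length of the code is polynomial in the size of the instance (the numbers of letters plus $|Q|+|\Sigma|+|\delta|$ for each automaton, where $|\Sigma|$ is the number of letters of its alphabet and $|\delta|$ its number of transitions). **Theorem.** TDP and PDP for automatic relations with a hint $\mathcal A_{R_2}$ are in $\mathrm{EXPSPACE}=\bigcup_{k}\mathrm{DSPACE}(2^{n^k})$. -/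

import Mathlib

namespace AutDecomp

/-! ## Exponential space

The machine model is Mathlib's `Turing.FinTM2`: deterministic machines with finitely many control
states and finitely many stacks. The input stack has a finite alphabet, and of the other stack
alphabets only finitely many symbols can ever be pushed, because program and state set are finite.
The input word is initially on the input stack, first letter on top. A stack is a one-sided tape without garbage beyond its end, so the
total height of the stacks is the number of occupied tape cells. -/

/-- The machine `M` decides the language `L` in space `s`: on every input word `w` it halts with
output `true` if `w ∈ L` and with output `false` otherwise, and no configuration that it passes
through on input `w` occupies more than `s |w|` cells (the input included). -/
def DecidesInSpace {A : Type} (M : Turing.TM2ComputableAux A Bool) (L : Language A)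
    (s : ℕ → ℕ) : Prop :=
  ∀ w : List A,
    (w ∈ L → Nonempty (Turing.TM2Outputs M.tm (w.map M.inputAlphabet.symm)
      (some [M.outputAlphabet.symm true]))) ∧
    (w ∉ L → Nonempty (Turing.TM2Outputs M.tm (w.map M.inputAlphabet.symm)
      (some [M.outputAlphabet.symm false]))) ∧
    ∀ c : M.tm.Cfg,
      Turing.TM2.Reaches M.tm.m (Turing.initList M.tm (w.map M.inputAlphabet.symm)) c →
        (∑ k ∈ @Finset.univ M.tm.K M.tm.kFin, (c.stk k).length) ≤ s w.length

/-- `EXPSPACE = ⋃ k, DSPACE(2 ^ (n ^ k))`. -/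
def EXPSPACE (A : Type) : Set (Language A) :=
  {L | ∃ (M : Turing.TM2ComputableAux A Bool) (k c : ℕ),
    DecidesInSpace M L (fun n => c * 2 ^ (n ^ k))}

/-! ## Automata and automatic relations -/

/-- A deterministic finite automaton over the alphabet `A`, with at most one transition for each
state and letter. The states are named `0, …, states - 1`. -/
structure PDFA (A : Type) where
  states : ℕ
  start : Fin states
  step : Fin states → A → Option (Fin states)
  accept : Finset (Fin states)

namespace PDFA

/-- The words that have an accepting run. -/
def lang {A : Type} (M : PDFA A) : Language A :=
  {w | ∃ q : Fin M.states, w.foldlM M.step M.start = some q ∧ q ∈ M.accept}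

/-- The (length-preserving) relation between words described by an automaton over a product
alphabet. -/
def rel {A B : Type} (M : PDFA (A × B)) : SetRel (List A) (List B) :=
  {p | p.1.length = p.2.length ∧ p.1.zip p.2 ∈ M.lang}

/-- The size `|Q| + |Σ| + |δ|` of an automaton. -/
def size {A : Type} [Fintype A] (M : PDFA A) : ℕ :=
  M.states + Fintype.card A +
    (Finset.univ.filter fun p : Fin M.states × A => (M.step p.1 p.2).isSome).card

end PDFA

/-! ## The decomposition conditions -/

/-- The TD condition. -/
def TDCondition {I B O : Type} (R : SetRel I O) (R₁ : SetRel I B) (R₂ : SetRel B O) : Prop :=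
  R₁.cod ⊆ R₂.dom ∧ R₁.comp R₂ = R

/-- The PD condition. -/
def PDCondition {I B O : Type} (R : SetRel I O) (R₁ : SetRel I B) (R₂ : SetRel B O) : Prop :=
  R₁.cod ⊆ R₂.dom ∧ (R₁.comp R₂).dom = R.dom ∧ R₁.comp R₂ ⊆ R

/-! ## The decision problems with a hint for the second relation -/

/-- An instance: finite alphabets for inputs, intermediate words and outputs (with `nI`, `nB`, `nO`
letters), an automaton for the relation `R`, and an automaton for the hint `R₂`. -/
structure HintInstance where
  nI : ℕ
  nB : ℕ
  nO : ℕ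
  autR : PDFA (Fin nI × Fin nO)
  autR₂ : PDFA (Fin nB × Fin nO)

namespace HintInstance

/-- `TDP` with hint `R₂`: there is an automatic `R₁` such that `(R₁, R₂)` meets the TD condition. -/
def TDP (x : HintInstance) : Prop :=
  ∃ autR₁ : PDFA (Fin x.nI × Fin x.nB), TDCondition x.autR.rel autR₁.rel x.autR₂.rel

/-- `PDP` with hint `R₂`: there is an automatic `R₁` such that `(R₁, R₂)` meets the PD condition. -/
def PDP (x : HintInstance) : Prop :=
  ∃ autR₁ : PDFA (Fin x.nI × Fin x.nB), PDCondition x.autR.rel autR₁.rel x.autR₂.rel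

/-- The size of an instance. -/
def size (x : HintInstance) : ℕ :=
  x.nI + x.nB + x.nO + x.autR.size + x.autR₂.size

end HintInstance

/-! ## Instances as words

An instance is written as a list of numbers (alphabet sizes, then for each automaton its number of
states, its initial state, the characteristic vector of the accepting states, and its transition
table row by row), and every number `n` is written as `n` ones followed by a zero. -/

/-- Table entry of a transition: `0` if undefined, `p + 1` if it leads to the state `p`. -/
def codeTarget {n : ℕ} : Option (Fin n) → ℕ
  | none => 0
  | some p => p + 1

/-- An automaton over a product alphabet as a list of numbers. -/
def PDFA.code {a b : ℕ} (M : PDFA (Fin a × Fin b)) : List ℕ :=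
  [M.states, (M.start : ℕ)] ++
    ((List.finRange M.states).map fun q => if q ∈ M.accept then 1 else 0) ++
    ((List.finRange M.states).flatMap fun q =>
      (List.finRange a).flatMap fun x =>
        (List.finRange b).map fun y => codeTarget (M.step q (x, y)))

/-- A list of numbers as a binary word. -/
def unary (l : List ℕ) : List Bool :=
  l.flatMap fun n => List.replicate n true ++ [false]

/-- The word that encodes an instance. -/
def HintInstance.encode (x : HintInstance) : List Bool :=
  unary ([x.nI, x.nB, x.nO] ++ x.autR.code ++ x.autR₂.code)

/-- The language of the encodings of the instances with property `P`. -/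
def problemLanguage (P : HintInstance → Prop) : Language Bool :=
  {w | ∃ x : HintInstance, P x ∧ x.encode = w}

/-! The encoding is faithful: different instances have different codes, and the length of the code
is bounded by a polynomial in the size of the instance. -/

theorem replicate_true_inj {m n : ℕ} {u v : List Bool}
    (h : List.replicate m true ++ false :: u = List.replicate n true ++ false :: v) :
    m = n ∧ u = v := by
  induction m generalizing n with
  | zero => cases n <;> simp_all [List.replicate_succ]
  | succ m ih =>
    cases n with
    | zero => simp [List.replicate_succ] at h
    | succ n =>
      simp only [List.replicate_succ, List.cons_append, List.cons.injEq, true_and] at h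
      have := ih h
      exact ⟨by rw [this.1], this.2⟩

theorem unary_cons (n : ℕ) (l : List ℕ) :
    unary (n :: l) = List.replicate n true ++ false :: unary l := by
  simp [unary]

theorem unary_injective : Function.Injective unary := by
  intro l
  induction l with
  | nil => intro l' h; cases l' <;> simp_all [unary]
  | cons m l ih =>
    intro l' h
    cases l' with
    | nil => simp [unary] at h
    | cons n l' =>
      rw [unary_cons, unary_cons] at h
      obtain ⟨h1, h2⟩ := replicate_true_inj h
      rw [h1, ih h2]

theorem codeTarget_injective {n : ℕ} : Function.Injective (codeTarget (n := n)) := by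
  intro p q h
  cases p <;> cases q <;> simp_all [codeTarget, Fin.ext_iff]

theorem flatMap_inj_of_length {α β : Type} {l : List α} {f g : α → List β}
    (hl : ∀ x ∈ l, (f x).length = (g x).length) (h : l.flatMap f = l.flatMap g) :
    ∀ x ∈ l, f x = g x := by
  induction l with
  | nil => simp
  | cons y l ih =>
    rw [List.flatMap_cons, List.flatMap_cons] at h
    obtain ⟨h1, h2⟩ := List.append_inj h (hl y (by simp))
    intro x hx
    rcases List.mem_cons.1 hx with rfl | hx
    · exact h1
    · exact ih (fun z hz => hl z (by simp [hz])) h2 x hx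

theorem PDFA.code_append_inj {a b : ℕ} {M N : PDFA (Fin a × Fin b)} {u v : List ℕ}
    (h : M.code ++ u = N.code ++ v) : M = N ∧ u = v := by
  obtain ⟨m, s, d, F⟩ := M
  obtain ⟨n, t, e, G⟩ := N
  have hmn : m = n := by simp [PDFA.code] at h; exact h.1
  subst hmn
  obtain ⟨h1, h2⟩ := List.append_inj h (by simp [PDFA.code])
  refine ⟨?_, h2⟩
  simp only [PDFA.code] at h1
  obtain ⟨h3, h4⟩ := List.append_inj h1 (by simp)
  obtain ⟨h5, h6⟩ := List.append_inj h3 (by simp)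
  have hs : s = t := by simpa [Fin.ext_iff] using h5
  have hF : F = G := by
    ext q
    have := (List.map_inj_left.1 h6) q (List.mem_finRange q)
    by_cases h7 : q ∈ F <;> by_cases h8 : q ∈ G <;> simp_all
  have hd : d = e := by
    funext q p
    obtain ⟨x, y⟩ := p
    have h7 := flatMap_inj_of_length (by simp) h4 q (List.mem_finRange q)
    have h8 := flatMap_inj_of_length (by simp) h7 x (List.mem_finRange x)
    exact codeTarget_injective ((List.map_inj_left.1 h8) y (List.mem_finRange y))
  rw [hs, hF, hd]

theorem HintInstance.encode_injective : Function.Injective HintInstance.encode := by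
  intro x y h
  obtain ⟨a, b, c, A, B⟩ := x
  obtain ⟨a', b', c', A', B'⟩ := y
  have h := unary_injective h
  simp only [List.cons_append, List.nil_append, List.cons.injEq] at h
  obtain ⟨rfl, rfl, rfl, h⟩ := h
  obtain ⟨hA, h⟩ := PDFA.code_append_inj h
  rw [← List.append_nil B.code, ← List.append_nil B'.code] at h
  obtain ⟨hB, -⟩ := PDFA.code_append_inj h
  rw [hA, hB]

theorem unary_length_le (l : List ℕ) (n : ℕ) (h : ∀ x ∈ l, x ≤ n) :
    (unary l).length ≤ l.length * (n + 1) := by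
  induction l with
  | nil => simp [unary]
  | cons m l ih =>
    have h1 := ih (fun x hx => h x (by simp [hx]))
    have h2 := h m (by simp)
    rw [unary_cons]
    simp only [List.length_append, List.length_replicate, List.length_cons]
    nlinarith

theorem PDFA.le_of_mem_code {a b : ℕ} (M : PDFA (Fin a × Fin b)) :
    ∀ n ∈ M.code, n ≤ M.states := by
  intro n hn
  have hs := M.start.isLt
  simp only [PDFA.code, List.mem_append, List.mem_cons, List.mem_map, List.mem_flatMap,
    List.not_mem_nil, or_false] at hn
  rcases hn with ((rfl | rfl) | ⟨q, -, rfl⟩) | ⟨q, -, x, -, y, -, rfl⟩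
  · exact le_rfl
  · exact hs.le
  · split_ifs <;> omega
  · cases h : M.step q (x, y) with
    | none => simp [codeTarget]
    | some p => simp [codeTarget]

theorem PDFA.code_length {a b : ℕ} (M : PDFA (Fin a × Fin b)) :
    M.code.length = 2 + M.states + M.states * (a * b) := by
  simp only [PDFA.code, List.length_append, List.length_cons, List.length_nil, List.length_map,
    List.length_finRange, List.length_flatMap, List.map_const', List.sum_replicate, smul_eq_mul]

theorem HintInstance.encode_length_le (x : HintInstance) :
    x.encode.length ≤ 9 * (x.size + 1) ^ 3 := by
  have hR : x.autR.states + x.nI * x.nO ≤ x.autR.size := by simp [PDFA.size]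
  have hR₂ : x.autR₂.states + x.nB * x.nO ≤ x.autR₂.size := by simp [PDFA.size]
  have hs : x.size = x.nI + x.nB + x.nO + x.autR.size + x.autR₂.size := rfl
  refine (unary_length_le _ x.size ?_).trans ?_
  · intro n hn
    simp only [List.mem_append, List.mem_cons, List.not_mem_nil, or_false] at hn
    rcases hn with ((rfl | rfl | rfl) | hn) | hn
    · omega
    · omega
    · omega
    · have := x.autR.le_of_mem_code n hn
      omega
    · have := x.autR₂.le_of_mem_code n hn
      omega
  · simp only [List.length_append, PDFA.code_length, List.length_cons, List.length_nil]
    have h1 : x.autR.states * (x.nI * x.nO) ≤ x.size * x.size :=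
      Nat.mul_le_mul (by omega) (by omega)
    have h2 : x.autR₂.states * (x.nB * x.nO) ≤ x.size * x.size :=
      Nat.mul_le_mul (by omega) (by omega)
    have h3 : x.autR.states + x.autR₂.states ≤ x.size := by omega
    have h4 : 0 + 1 + 1 + 1 + (2 + x.autR.states + x.autR.states * (x.nI * x.nO)) +
        (2 + x.autR₂.states + x.autR₂.states * (x.nB * x.nO)) ≤ 9 * (x.size + 1) ^ 2 := by
      nlinarith
    calc _ ≤ 9 * (x.size + 1) ^ 2 * (x.size + 1) := Nat.mul_le_mul_right _ (by simpa using h4)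
      _ = _ := by ring

end AutDecomp

/-! There is a largest candidate for the first factor. It consists of the pairs `(i, b)` such that
`b` has an `R₂`-partner and every `R₂`-partner `o` of `b` satisfies `(i, o) ∈ R`. Every `R₁` with
`Img R₁ ⊆ Dom R₂` and `R₁ ∘ R₂ ⊆ R` is contained in it, and it has these two properties itself.
Since composition is monotone, TDP asks whether the composition of this factor with `R₂` covers `R`,
and PDP whether it covers the domain of `R` (`tdCondition_iff`, `pdCondition_iff`).

The largest factor is automatic by a powerset construction: for a word over pairs `(i, b)`, the set
of pairs of states of the two given automata that are reached with guessed outputs decides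
membership (`setAcc_setRun`). Its composition with `R₂` is therefore accepted by a nondeterministic
automaton whose states are pairs of such a set and a state of the second automaton, exponentially
many in all. A second powerset construction runs this automaton together with the automaton of `R`;
a word that is not covered is a path to a bad set (`bad_bigRun`). The proposition `f` distinguishes
the problems: if it holds, then the output letters are guessed in both components, so that only the
inputs of a word matter, as PDP requires.

With `T` states below, the second construction has `2 ^ T` sets, where `T` is exponential in the
input. Reachability is decided as in Savitch's theorem: `T` halvings suffice, and the recursion
keeps at most `T` frames of about `3 * T` bits, which is exponential space (`halvingReach_iff`,
`LSP.halvingReach`, `frameBase_pow_le`).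

For the machine model, sets, stacks and input words are coded as natural numbers. `LS` is the class
of functions computed by register programs whose registers stay polynomial in the largest argument,
that is, of linear length in binary. It is closed under composition, bounded recursion and, for
predicates, bounded quantification. A doubly exponential number `B` is supplied as an additional
argument, so that the whole decision procedure lies in this class (`LSP.accepts`). A stack machine
that stores every register in binary then needs exponential space (`exists_decidesInSpace`). -/

namespace AutDecomp

/-! ## Programs over registers and their simulation by a stack machine -/

/-- Structured register programs; `loop r p` means: while register `r` is nonzero, decrement it
and run `p`. -/
inductive Prog
  | skip
  | inc (r : ℕ)
  | seq (p q : Prog)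
  | loop (r : ℕ) (p : Prog)

/-- `Run B p s s'`: started in `s`, the program `p` terminates in `s'`, and no increment leads to a
value above `B`. -/
inductive Run (B : ℕ) : Prog → (ℕ → ℕ) → (ℕ → ℕ) → Prop
  | skip (s) : Run B .skip s s
  | inc {r : ℕ} {s : ℕ → ℕ} (h : s r + 1 ≤ B) :
      Run B (.inc r) s (Function.update s r (s r + 1))
  | seq {p q s s' s''} : Run B p s s' → Run B q s' s'' → Run B (.seq p q) s s''
  | loop_zero {r p} {s : ℕ → ℕ} (h : s r = 0) : Run B (.loop r p) s s
  | loop_succ {r p x s' s''} {s : ℕ → ℕ} (h : s r = x + 1) :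
      Run B p (Function.update s r x) s' → Run B (.loop r p) s' s'' → Run B (.loop r p) s s''

/-- Instructions of counter machines. `dec r t` jumps to `t` if register `r` is zero, otherwise
it decrements `r` and continues. -/
inductive Instr
  | inc (r : ℕ)
  | dec (r t : ℕ)
  | jmp (t : ℕ)

namespace Prog

/-- The number of instructions of the compiled program. -/
def size : Prog → ℕ
  | skip => 0
  | inc _ => 1
  | seq p q => p.size + q.size
  | loop _ p => p.size + 2

/-- Flattening of a program whose first instruction has address `b`. -/
def compile : Prog → ℕ → List Instr
  | skip, _ => []
  | inc r, _ => [.inc r]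
  | seq p q, b => compile p b ++ compile q (b + p.size)
  | loop r p, b => .dec r (b + p.size + 2) :: (compile p (b + 1) ++ [.jmp b])

/-- The largest register that occurs. -/
def maxReg : Prog → ℕ
  | skip => 0
  | inc r => r
  | seq p q => max p.maxReg q.maxReg
  | loop r p => max r p.maxReg

@[simp] theorem length_compile (p : Prog) (b : ℕ) : (p.compile b).length = p.size := by
  induction p generalizing b <;> simp_all [compile, size]

end Prog

/-! ### Binary counters, least significant bit first -/

/-- The value of a binary counter. -/
def bval : List Bool → ℕ
  | [] => 0
  | b :: l => b.toNat + 2 * bval l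

/-- Increment of a binary counter. -/
def binc : List Bool → List Bool
  | [] => [true]
  | false :: l => true :: l
  | true :: l => false :: binc l

/-- Decrement of a nonzero binary counter. -/
def bdec : List Bool → List Bool
  | [] => []
  | true :: l => false :: l
  | false :: l => true :: bdec l

theorem bval_binc (l : List Bool) : bval (binc l) = bval l + 1 := by
  induction l with
  | nil => rfl
  | cons b l ih =>
    cases b
    · simp [binc, bval]; omega
    · simp [binc, bval, ih]; omega

theorem length_binc_le (l : List Bool) : (binc l).length ≤ l.length + 1 := by
  induction l with
  | nil => simp [binc]
  | cons b l ih =>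
    cases b
    · simp [binc]
    · simp [binc]; omega

/-- A counter grows only if the carry runs through all digits, and then all digits are one, so that
the value is `2 ^ l.length - 1`. -/
theorem length_binc_eq (l : List Bool) :
    (binc l).length = l.length ∨ 2 ^ l.length ≤ bval l + 1 := by
  induction l with
  | nil => simp [bval]
  | cons b l ih =>
    cases b
    · simp [binc]
    · rcases ih with h | h
      · simp [binc, h]
      · right
        simp [bval, pow_succ]
        omega

/-- This turns the bound on register values into a bound on stack heights. Decrementing keeps
leading zeros, so the height is not a function of the value; the bound `N` on the length has to be
carried along as an invariant. -/
theorem length_binc_lt {l : List Bool} {N B : ℕ} (hl : l.length ≤ N) (hB : B < 2 ^ N)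
    (h : bval l + 1 ≤ B) : (binc l).length ≤ N := by
  rcases length_binc_eq l with h1 | h1
  · omega
  · have h2 : l.length < N := (Nat.pow_lt_pow_iff_right (by norm_num : 1 < 2)).1 (by omega)
    have := length_binc_le l
    omega

theorem bval_bdec {l : List Bool} {x : ℕ} (h : bval l = x + 1) : bval (bdec l) = x := by
  induction l generalizing x with
  | nil => simp [bval] at h
  | cons b l ih =>
    cases b
    · simp [bval] at h
      obtain ⟨y, hy⟩ : ∃ y, bval l = y + 1 := ⟨bval l - 1, by omega⟩
      simp [bdec, bval, ih hy]
      omega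
    · simp [bval] at h
      simp [bdec, bval]
      omega

theorem length_bdec (l : List Bool) : (bdec l).length = l.length := by
  induction l with
  | nil => rfl
  | cons b l ih => cases b <;> simp [bdec, ih]

/-! ### The stack machine -/

section Machine

open Turing TM2.Stmt

variable (m : ℕ) (out : ℕ) (code : List Instr)

/-- The stacks: one for each register, and one (`none`) for input, carries and output. -/
abbrev Stk : Type := Option (Fin (m + 1))

/-- The labels: loading, execution of an instruction (with the phase in which carries are
restored), and clearing of the registers. -/
abbrev Lab : Type := Bool ⊕ (Fin (code.length + 1) × Option Bool) ⊕ Fin (m + 2)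

variable {m code}

/-- The stack of a register. -/
def stkOf (m r : ℕ) : Stk m := some (Fin.ofNat (m + 1) r)

/-- The label of an address. -/
def labPC (m : ℕ) (code : List Instr) (i : ℕ) : Lab m code :=
  .inr (.inl (Fin.ofNat (code.length + 1) i, none))

/-- The label of the restoring phase of an address. -/
def labBack (m : ℕ) (code : List Instr) (i : ℕ) (b : Bool) : Lab m code :=
  .inr (.inl (Fin.ofNat (code.length + 1) i, some b))

/-- The label for clearing registers from number `j` on. -/
def labClear (m : ℕ) (code : List Instr) (j : ℕ) : Lab m code :=
  .inr (.inr (Fin.ofNat (m + 2) j))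

variable (m code)

/-- The statement at an address. -/
def stmtAt (i : ℕ) : Option Bool → TM2.Stmt (fun _ : Stk m => Bool) (Lab m code) (Option Bool)
  | none => match code[i]? with
    -- The ones at the bottom of the number are moved to the auxiliary stack. The carry stops at a
    -- zero or, if the number gets longer, at the end of the stack; in both cases a one is written
    -- and the removed digits come back as zeros.
    | some (.inc r) =>
      pop (stkOf m r) (fun _ o => o) <| branch (fun v => v == some true)
        (push none (fun _ => true) <| goto fun _ => labPC m code i)
        (push (stkOf m r) (fun _ => true) <| goto fun _ => labBack m code i false)
    -- Low zeros are moved to the auxiliary stack. If a one is found, it becomes zero and the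
    -- removed digits come back as ones. If the stack runs empty, the value was zero and the zeros
    -- are put back. The bit in the label records which case holds, and thus also where to jump.
    | some (.dec r _) =>
      pop (stkOf m r) (fun _ o => o) <| branch (fun v => v == some false)
        (push none (fun _ => false) <| goto fun _ => labPC m code i) <|
        branch (fun v => v == some true)
        (push (stkOf m r) (fun _ => false) <| goto fun _ => labBack m code i true)
        (goto fun _ => labBack m code i false)
    | some (.jmp t) => goto fun _ => labPC m code t
    -- An address past the code ends the simulation. An empty output register stands for the bit
    -- `false`.
    | none => pop (stkOf m out) (fun _ o => o) <| push none (fun v => v.getD false) <|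
        goto fun _ => labClear m code 0
  | some b => match code[i]? with
    | some (.inc r) =>
      pop none (fun _ o => o) <| branch (fun v => v.isSome)
        (push (stkOf m r) (fun _ => b) <| goto fun _ => labBack m code i b)
        (goto fun _ => labPC m code (i + 1))
    | some (.dec r t) =>
      pop none (fun _ o => o) <| branch (fun v => v.isSome)
        (push (stkOf m r) (fun _ => b) <| goto fun _ => labBack m code i b)
        (goto fun _ => labPC m code (if b then i + 1 else t))
    | _ => halt

/-- The program of the stack machine that runs `code` and outputs the lowest bit of register
`out`. -/
def machStmt : Lab m code → TM2.Stmt (fun _ : Stk m => Bool) (Lab m code) (Option Bool)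
  | .inl false => push (stkOf m 0) (fun _ => true) <| goto fun _ => .inl true
  | .inl true =>
    pop none (fun _ o => o) <| branch (fun v => v.isSome)
      (push (stkOf m 0) (fun v => v.getD false) <| goto fun _ => .inl true)
      (goto fun _ => labPC m code 0)
  | .inr (.inl (i, o)) => stmtAt m out code i o
  | .inr (.inr j) =>
    if (j : ℕ) < m + 1 then
      pop (stkOf m j) (fun _ o => o) <| branch (fun v => v.isSome)
        (goto fun _ => labClear m code j) (goto fun _ => labClear m code (j + 1))
    else load (fun _ => none) halt

/-- The stack machine as a bundled machine. -/
def mach : FinTM2 where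
  K := Stk m
  k₀ := none
  k₁ := none
  Γ := fun _ => Bool
  Λ := Lab m code
  main := .inl false
  σ := Option Bool
  initialState := none
  m := machStmt m out code

/-- Configurations of the machine. -/
abbrev MCfg : Type := TM2.Cfg (fun _ : Stk m => Bool) (Lab m code) (Option Bool)

/-! ### Configurations and computation paths of the stack machine -/

variable {m code}

/-- The stack contents from the contents of the register stacks and the auxiliary stack. -/
def stks (S : Fin (m + 1) → List Bool) (a : List Bool) : Stk m → List Bool
  | none => a
  | some j => S j

@[simp] theorem stks_none (S : Fin (m + 1) → List Bool) (a) : stks S a none = a := rfl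

@[simp] theorem stks_some (S : Fin (m + 1) → List Bool) (a) (j) : stks S a (some j) = S j := rfl

@[simp] theorem update_stks_none (S : Fin (m + 1) → List Bool) (a a' : List Bool) :
    Function.update (stks S a) none a' = stks S a' := by
  funext k; cases k <;> simp [Function.update, stks]

@[simp] theorem update_stks_some (S : Fin (m + 1) → List Bool) (a l : List Bool) (j) :
    Function.update (stks S a) (some j) l = stks (Function.update S j l) a := by
  funext k; cases k <;> simp [Function.update, stks]

/-- No stack is higher than `N`. -/
def Small (N : ℕ) (c : MCfg m code) : Prop := ∀ k, (c.stk k).length ≤ N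

theorem small_mk {N : ℕ} {l v} {S : Fin (m + 1) → List Bool} {a : List Bool}
    (hS : ∀ j, (S j).length ≤ N) (ha : a.length ≤ N) :
    Small N (⟨l, v, stks S a⟩ : MCfg m code) := by
  intro k
  cases k
  · exact ha
  · exact hS _

theorem small_update {N : ℕ} {l v} {S : Fin (m + 1) → List Bool} {a x : List Bool} {j}
    (hS : ∀ j, (S j).length ≤ N) (hx : x.length ≤ N) (ha : a.length ≤ N) :
    Small N (⟨l, v, stks (Function.update S j x) a⟩ : MCfg m code) := by
  apply small_mk _ ha
  intro k
  by_cases h : k = j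
  · subst h; simpa using hx
  · simpa [h] using hS k

variable (N : ℕ)

/-- Computation paths through small configurations. -/
def Path : MCfg m code → MCfg m code → Prop :=
  Relation.ReflTransGen fun a b => TM2.step (machStmt m out code) a = some b ∧ Small N b

variable {N out}

theorem Path.trans {a b c : MCfg m code} (h : Path out N a b) (h' : Path out N b c) :
    Path out N a c := Relation.ReflTransGen.trans h h'

theorem Path.head {a b c : MCfg m code} (h : TM2.step (machStmt m out code) a = some b)
    (hb : Small N b) (h' : Path out N b c) : Path out N a c :=
  Relation.ReflTransGen.head ⟨h, hb⟩ h'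

theorem step_pc {i : ℕ} (hi : i ≤ code.length) (o v S) :
    TM2.step (machStmt m out code)
      ⟨some (.inr (.inl (Fin.ofNat (code.length + 1) i, o))), v, S⟩ =
      some (TM2.stepAux (stmtAt m out code i o) v S) := by
  have h : (Fin.ofNat (code.length + 1) i : Fin _).val = i := by
    simp only [Fin.val_ofNat]; exact Nat.mod_eq_of_lt (by omega)
  simp only [TM2.step, machStmt, h]

/-- The digits on the auxiliary stack only serve as a count: whatever is popped there, the same bit
`b` is pushed onto the register. -/
theorem path_back {i : ℕ} (hi : i ≤ code.length) (b : Bool) {r t : ℕ}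
    (hc : (code[i]? = some (.inc r) ∧ t = i + 1) ∨
      ∃ t', code[i]? = some (.dec r t') ∧ t = if b then i + 1 else t')
    (S : Fin (m + 1) → List Bool) (a : List Bool) (v)
    (hS : ∀ j, (S j).length ≤ N) (ha : (S (Fin.ofNat (m + 1) r)).length + a.length ≤ N) :
    Path out N (⟨some (labBack m code i b), v, stks S a⟩ : MCfg m code)
      ⟨some (labPC m code t), none, stks (Function.update S (Fin.ofNat (m + 1) r)
        (List.replicate a.length b ++ S (Fin.ofNat (m + 1) r))) []⟩ := by
  induction a generalizing S v with
  | nil =>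
    refine Path.head (step_pc hi _ _ _) ?_ ?_
    · rcases hc with ⟨hc, -⟩ | ⟨t', hc, -⟩ <;> simp only [stmtAt, hc] <;>
        simpa using small_mk hS (by simp)
    · rcases hc with ⟨hc, ht⟩ | ⟨t', hc, ht⟩ <;> simp only [stmtAt, hc] <;> simp [ht] <;>
        exact Relation.ReflTransGen.refl
  | cons x a ih =>
    have key : TM2.stepAux (stmtAt m out code i (some b)) v (stks S (x :: a)) =
        ⟨some (labBack m code i b), some x, stks (Function.update S (Fin.ofNat (m + 1) r)
          (b :: S (Fin.ofNat (m + 1) r))) a⟩ := by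
      rcases hc with ⟨hc, -⟩ | ⟨t', hc, -⟩ <;> simp only [stmtAt, hc] <;> simp [stkOf]
    simp at ha
    refine Path.head (step_pc hi _ _ _) ?_ ?_
    · rw [key]
      exact small_update hS (by simp; omega) (by omega)
    · rw [key]
      have := ih (Function.update S (Fin.ofNat (m + 1) r) (b :: S (Fin.ofNat (m + 1) r)))
        (some x) ?_ ?_
      · simpa [List.replicate_succ', List.append_assoc] using this
      · intro k
        by_cases h : k = Fin.ofNat (m + 1) r
        · subst h; simp; omega
        · rw [Function.update_of_ne h]; exact hS k
      · simp; omega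

theorem length_update_le {S : Fin (m + 1) → List Bool} {j l}
    (hS : ∀ j, (S j).length ≤ N) (hl : l.length ≤ N) :
    ∀ k, (Function.update S j l k).length ≤ N := by
  intro k
  by_cases h : k = j
  · subst h; rwa [Function.update_self]
  · rw [Function.update_of_ne h]; exact hS k

theorem path_back_update {i : ℕ} (hi : i ≤ code.length) (b : Bool) {r t : ℕ}
    (hc : (code[i]? = some (.inc r) ∧ t = i + 1) ∨
      ∃ t', code[i]? = some (.dec r t') ∧ t = if b then i + 1 else t')
    (S : Fin (m + 1) → List Bool) (l a : List Bool) (v)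
    (hS : ∀ j, (S j).length ≤ N) (ha : l.length + a.length ≤ N) :
    Path out N (⟨some (labBack m code i b), v,
        stks (Function.update S (Fin.ofNat (m + 1) r) l) a⟩ : MCfg m code)
      ⟨some (labPC m code t), none, stks (Function.update S (Fin.ofNat (m + 1) r)
        (List.replicate a.length b ++ l)) []⟩ := by
  have := path_back (out := out) (N := N) hi b hc
    (Function.update S (Fin.ofNat (m + 1) r) l) a v (length_update_le hS (by omega))
    (by rw [Function.update_self]; exact ha)
  rwa [Function.update_self, Function.update_idem] at this

/-- The induction along the digits needs an arbitrary auxiliary stack `a`, which counts the carries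
made so far and is returned as zeros. The increment itself is the case `a = []`. -/
theorem path_inc {i r : ℕ} (hi : i < code.length) (hc : code[i]? = some (.inc r))
    (S : Fin (m + 1) → List Bool) (l a : List Bool) (v)
    (hl : S (Fin.ofNat (m + 1) r) = l)
    (hS : ∀ j, (S j).length ≤ N) (ha : l.length + 1 + a.length ≤ N) :
    Path out N (⟨some (labPC m code i), v, stks S a⟩ : MCfg m code)
      ⟨some (labPC m code (i + 1)), none, stks (Function.update S (Fin.ofNat (m + 1) r)
        (List.replicate a.length false ++ binc l)) []⟩ := by
  induction l generalizing S a v with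
  | nil =>
    have key : TM2.stepAux (stmtAt m out code i none) v (stks S a) =
        ⟨some (labBack m code i false), none,
          stks (Function.update S (Fin.ofNat (m + 1) r) [true]) a⟩ := by
      simp only [stmtAt, hc, stkOf, TM2.stepAux]
      simp only [stks_some, hl]
      simp
    refine Path.head (step_pc hi.le _ _ _) ?_ ?_ <;> rw [key]
    · exact small_update hS (by simp at *; omega) (by omega)
    · exact path_back_update hi.le false (Or.inl ⟨hc, rfl⟩) S [true] a _ hS
        (by simpa [add_comm] using ha)
  | cons x l ih =>
    simp only [List.length_cons] at ha
    cases x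
    · have key : TM2.stepAux (stmtAt m out code i none) v (stks S a) =
          ⟨some (labBack m code i false), some false,
            stks (Function.update S (Fin.ofNat (m + 1) r) (true :: l)) a⟩ := by
        simp only [stmtAt, hc, stkOf, TM2.stepAux]
        simp only [stks_some, hl]
        simp
      refine Path.head (step_pc hi.le _ _ _) ?_ ?_ <;> rw [key]
      · exact small_update hS (by simp; omega) (by omega)
      · exact path_back_update hi.le false (Or.inl ⟨hc, rfl⟩) S (true :: l) a _ hS
          (by simp; omega)
    · have key : TM2.stepAux (stmtAt m out code i none) v (stks S a) =
          ⟨some (labPC m code i), some true,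
            stks (Function.update S (Fin.ofNat (m + 1) r) l) (true :: a)⟩ := by
        simp only [stmtAt, hc, stkOf, TM2.stepAux]
        simp only [stks_some, hl]
        simp
      refine Path.head (step_pc hi.le _ _ _) ?_ ?_ <;> rw [key]
      · exact small_update hS (by omega) (by simp; omega)
      · have := ih (Function.update S (Fin.ofNat (m + 1) r) l) (true :: a) (some true)
          (by simp) (length_update_le hS (by omega)) (by simp; omega)
        rw [Function.update_idem] at this
        simpa [binc, List.replicate_succ', List.append_assoc] using this

/-- A value of zero does not mean an empty stack, since leading zeros are kept. All digits are
removed before the test succeeds, and all are put back. -/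
theorem path_dec_zero {i r t : ℕ} (hi : i < code.length) (hc : code[i]? = some (.dec r t))
    (S : Fin (m + 1) → List Bool) (l a : List Bool) (v)
    (hl : S (Fin.ofNat (m + 1) r) = l) (h0 : bval l = 0)
    (hS : ∀ j, (S j).length ≤ N) (ha : l.length + a.length ≤ N) :
    Path out N (⟨some (labPC m code i), v, stks S a⟩ : MCfg m code)
      ⟨some (labPC m code t), none, stks (Function.update S (Fin.ofNat (m + 1) r)
        (List.replicate a.length false ++ l)) []⟩ := by
  induction l generalizing S a v with
  | nil =>
    have key : TM2.stepAux (stmtAt m out code i none) v (stks S a) =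
        ⟨some (labBack m code i false), none,
          stks (Function.update S (Fin.ofNat (m + 1) r) []) a⟩ := by
      simp only [stmtAt, hc, stkOf, TM2.stepAux]
      simp only [stks_some, hl]
      simp
    refine Path.head (step_pc hi.le _ _ _) ?_ ?_ <;> rw [key]
    · exact small_update hS (by simp) (by omega)
    · exact path_back_update hi.le false (Or.inr ⟨t, hc, by simp⟩) S [] a _ hS ha
  | cons x l ih =>
    simp only [List.length_cons] at ha
    cases x
    · have key : TM2.stepAux (stmtAt m out code i none) v (stks S a) =
          ⟨some (labPC m code i), some false,
            stks (Function.update S (Fin.ofNat (m + 1) r) l) (false :: a)⟩ := by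
        simp only [stmtAt, hc, stkOf, TM2.stepAux]
        simp only [stks_some, hl]
        simp
      refine Path.head (step_pc hi.le _ _ _) ?_ ?_ <;> rw [key]
      · exact small_update hS (by omega) (by simp; omega)
      · have := ih (Function.update S (Fin.ofNat (m + 1) r) l) (false :: a) (some false)
          (by simp) (by simpa [bval] using h0) (length_update_le hS (by omega)) (by simp; omega)
        rw [Function.update_idem] at this
        simpa [List.replicate_succ', List.append_assoc] using this
    · simp [bval] at h0

/-- The zeros below the lowest one are exactly the digits that borrow; `a` counts them, and they
return as ones. -/
theorem path_dec_succ {i r t x : ℕ} (hi : i < code.length) (hc : code[i]? = some (.dec r t))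
    (S : Fin (m + 1) → List Bool) (l a : List Bool) (v)
    (hl : S (Fin.ofNat (m + 1) r) = l) (h0 : bval l = x + 1)
    (hS : ∀ j, (S j).length ≤ N) (ha : l.length + a.length ≤ N) :
    Path out N (⟨some (labPC m code i), v, stks S a⟩ : MCfg m code)
      ⟨some (labPC m code (i + 1)), none, stks (Function.update S (Fin.ofNat (m + 1) r)
        (List.replicate a.length true ++ bdec l)) []⟩ := by
  induction l generalizing S a v x with
  | nil => simp [bval] at h0
  | cons y l ih =>
    simp only [List.length_cons] at ha
    cases y
    · have key : TM2.stepAux (stmtAt m out code i none) v (stks S a) =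
          ⟨some (labPC m code i), some false,
            stks (Function.update S (Fin.ofNat (m + 1) r) l) (false :: a)⟩ := by
        simp only [stmtAt, hc, stkOf, TM2.stepAux]
        simp only [stks_some, hl]
        simp
      obtain ⟨y, hy⟩ : ∃ y, bval l = y + 1 := ⟨bval l - 1, by simp [bval] at h0; omega⟩
      refine Path.head (step_pc hi.le _ _ _) ?_ ?_ <;> rw [key]
      · exact small_update hS (by omega) (by simp; omega)
      · have := ih (Function.update S (Fin.ofNat (m + 1) r) l) (false :: a) (some false)
          (by simp) hy (length_update_le hS (by omega)) (by simp; omega)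
        rw [Function.update_idem] at this
        simpa [bdec, List.replicate_succ', List.append_assoc] using this
    · have key : TM2.stepAux (stmtAt m out code i none) v (stks S a) =
          ⟨some (labBack m code i true), some true,
            stks (Function.update S (Fin.ofNat (m + 1) r) (false :: l)) a⟩ := by
        simp only [stmtAt, hc, stkOf, TM2.stepAux]
        simp only [stks_some, hl]
        simp
      refine Path.head (step_pc hi.le _ _ _) ?_ ?_ <;> rw [key]
      · exact small_update hS (by simp; omega) (by omega)
      · exact path_back_update hi.le true (Or.inr ⟨t, hc, by simp⟩) S (false :: l) a _ hS
          (by simp; omega)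

/-- The register stacks hold the values of the registers, on at most `N` cells each. -/
def Holds (N : ℕ) (s : ℕ → ℕ) (S : Fin (m + 1) → List Bool) : Prop :=
  ∀ j, bval (S j) = s j ∧ (S j).length ≤ N

theorem Holds.update {s : ℕ → ℕ} {S : Fin (m + 1) → List Bool} (h : Holds N s S) {r : ℕ}
    (hr : r ≤ m) {l : List Bool} {x : ℕ} (hl : l.length ≤ N) (hx : bval l = x) :
    Holds N (Function.update s r x) (Function.update S (Fin.ofNat (m + 1) r) l) := by
  have hv : (Fin.ofNat (m + 1) r).val = r := by
    simp only [Fin.val_ofNat]; exact Nat.mod_eq_of_lt (by omega)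
  intro j
  by_cases hj : j = Fin.ofNat (m + 1) r
  · subst hj
    rw [Function.update_self, hv, Function.update_self]
    exact ⟨hx, hl⟩
  · have : (j : ℕ) ≠ r := fun h' => hj (Fin.ext (by rw [hv, h']))
    rw [Function.update_of_ne hj, Function.update_of_ne this]
    exact h j

theorem Holds.reg {s : ℕ → ℕ} {S : Fin (m + 1) → List Bool} (h : Holds N s S) {r : ℕ}
    (hr : r ≤ m) : bval (S (Fin.ofNat (m + 1) r)) = s r := by
  have hv : (Fin.ofNat (m + 1) r).val = r := by
    simp only [Fin.val_ofNat]; exact Nat.mod_eq_of_lt (by omega)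
  rw [(h _).1, hv]

/-- The machine simulates programs. -/
theorem Run.path {B : ℕ} (hB : B < 2 ^ N) {p : Prog} {s s' : ℕ → ℕ} (h : Run B p s s')
    {pre post : List Instr} (hcode : code = pre ++ p.compile pre.length ++ post)
    (hp : p.maxReg ≤ m) {S : Fin (m + 1) → List Bool} (hS : Holds N s S) :
    ∃ S', Holds N s' S' ∧
      Path out (N + 1) (⟨some (labPC m code pre.length), none, stks S []⟩ : MCfg m code)
        ⟨some (labPC m code (pre.length + p.size)), none, stks S' []⟩ := by
  induction h generalizing pre post S with
  | skip s => exact ⟨S, hS, Relation.ReflTransGen.refl⟩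
  | @inc r s h =>
    have hr : r ≤ m := hp
    have hc : code[pre.length]? = some (.inc r) := by simp [hcode, Prog.compile]
    have hi : pre.length < code.length := by simp [hcode, Prog.compile]
    refine ⟨_, hS.update hr (l := binc (S (Fin.ofNat (m + 1) r))) ?_ ?_, ?_⟩
    · exact length_binc_lt (hS _).2 hB (by rwa [hS.reg hr])
    · rw [bval_binc, hS.reg hr]
    -- The simulation runs with one cell of reserve: `path_inc` provides room for a new digit
    -- whether or not the carry reaches the end. This is the reason for `N + 1` in the path.
    · exact path_inc hi hc S _ [] none rfl (fun j => (hS j).2.trans (by omega))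
        (by have := (hS (Fin.ofNat (m + 1) r)).2; simp at *; omega)
  | @seq p q s s' s'' h1 h2 ih1 ih2 =>
    simp only [Prog.maxReg] at hp
    obtain ⟨S1, hS1, hP1⟩ := ih1 (pre := pre) (post := q.compile (pre.length + p.size) ++ post)
      (by simp [hcode, Prog.compile]) (by omega) hS
    obtain ⟨S2, hS2, hP2⟩ := ih2 (pre := pre ++ p.compile pre.length) (post := post)
      (by simp [hcode, Prog.compile]) (by omega) hS1
    refine ⟨S2, hS2, hP1.trans ?_⟩
    simpa [Prog.size, add_assoc] using hP2
  | @loop_zero r p s h =>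
    simp only [Prog.maxReg] at hp
    have hr : r ≤ m := by omega
    have hc : code[pre.length]? = some (.dec r (pre.length + p.size + 2)) := by
      simp [hcode, Prog.compile]
    have hi : pre.length < code.length := by simp [hcode, Prog.compile]
    refine ⟨S, hS, ?_⟩
    have := path_dec_zero (out := out) (N := N + 1) hi hc S _ [] none rfl
      (by rw [hS.reg hr, h]) (fun j => (hS j).2.trans (by omega))
      (by have := (hS (Fin.ofNat (m + 1) r)).2; simp at *; omega)
    simpa [Prog.size, add_assoc] using this
  | @loop_succ r p x s' s'' s h h1 h2 ih1 ih2 =>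
    simp only [Prog.maxReg] at hp
    have hr : r ≤ m := by omega
    have hc : code[pre.length]? = some (.dec r (pre.length + p.size + 2)) := by
      simp [hcode, Prog.compile]
    have hi : pre.length < code.length := by simp [hcode, Prog.compile]
    have hP0 := path_dec_succ (out := out) (N := N + 1) hi hc S _ [] none rfl
      (by rw [hS.reg hr, h]) (fun j => (hS j).2.trans (by omega))
      (by have := (hS (Fin.ofNat (m + 1) r)).2; simp at *; omega)
    obtain ⟨S1, hS1, hP1⟩ := ih1 (pre := pre ++ [.dec r (pre.length + p.size + 2)])
      (post := .jmp pre.length :: post) (by simp [hcode, Prog.compile]) (by omega)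
      (hS.update hr (l := bdec (S (Fin.ofNat (m + 1) r)))
        (by rw [length_bdec]; exact (hS _).2) (bval_bdec (by rw [hS.reg hr, h])))
    obtain ⟨S2, hS2, hP2⟩ := ih2 hcode (by simp [Prog.maxReg]; omega) hS1
    have hj : code[pre.length + 1 + p.size]? = some (.jmp pre.length) := by
      simp [hcode, Prog.compile, add_assoc]
      rw [List.getElem?_append_right (by simp)]
      simp [List.getElem?_cons, show 1 + p.size - 1 = p.size by omega]
    have hj' : pre.length + 1 + p.size ≤ code.length := by
      simp [hcode, Prog.compile]; omega
    refine ⟨S2, hS2, hP0.trans (Path.trans (by simpa using hP1) ?_)⟩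
    refine Path.head (step_pc hj' none none _) ?_ ?_
    · simp only [stmtAt, hj, TM2.stepAux]
      exact small_mk (fun j => (hS1 j).2.trans (by omega)) (by simp)
    · simp only [stmtAt, hj, TM2.stepAux]
      exact hP2

end Machine

end AutDecomp

namespace AutDecomp

/-! ### Loading the input, clearing the registers, and the space bound -/

section Machine

open Turing TM2.Stmt

variable {m out N : ℕ} {code : List Instr}

/-- The number with binary digits `1w`. -/
def wcode (w : List Bool) : ℕ := w.foldl (fun a b => b.toNat + 2 * a) 1

theorem bval_reverse_append (w l : List Bool) :
    bval (w.reverse ++ l) = w.foldl (fun a b => b.toNat + 2 * a) (bval l) := by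
  induction w generalizing l with
  | nil => rfl
  | cons b w ih => simp [ih, bval]

/-- Moving letters from stack to stack reverses the word, so the last letter becomes the least
significant digit. The part `l` already loaded is arbitrary for the sake of the induction. -/
theorem path_load (w l : List Bool) (v) (hl : w.length + l.length ≤ N) :
    Path out N (⟨some (.inl true), v,
        stks (Function.update (fun _ => []) (Fin.ofNat (m + 1) 0) l) w⟩ : MCfg m code)
      ⟨some (labPC m code 0), none,
        stks (Function.update (fun _ => []) (Fin.ofNat (m + 1) 0) (w.reverse ++ l)) []⟩ := by
  induction w generalizing l v with
  | nil =>
    refine Path.head (b := ⟨some (labPC m code 0), none,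
      stks (Function.update (fun _ => []) (Fin.ofNat (m + 1) 0) l) []⟩) ?_ ?_
      Relation.ReflTransGen.refl
    · simp [TM2.step, machStmt]
    · exact small_update (by simp) (by simpa using hl) (by simp)
  | cons b w ih =>
    simp only [List.length_cons] at hl
    refine Path.head (b := ⟨some (.inl true), some b,
      stks (Function.update (fun _ => []) (Fin.ofNat (m + 1) 0) (b :: l)) w⟩) ?_ ?_ ?_
    · simp [TM2.step, machStmt, stkOf]
    · exact small_update (by simp) (by simp; omega) (by omega)
    · have := ih (b :: l) (some b) (by simp; omega)
      simpa using this

theorem step_clear {j : ℕ} (hj : j ≤ m) (v S) :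
    TM2.step (machStmt m out code) ⟨some (labClear m code j), v, S⟩ =
      some (TM2.stepAux (pop (stkOf m j) (fun _ o => o) <| branch (fun v => v.isSome)
        (goto fun _ => labClear m code j) (goto fun _ => labClear m code (j + 1))) v S) := by
  have h : (Fin.ofNat (m + 2) j : Fin _).val = j := by
    simp only [Fin.val_ofNat]; exact Nat.mod_eq_of_lt (by omega)
  simp only [TM2.step, machStmt, labClear, h, if_pos (show j < m + 1 by omega)]

theorem path_clear_one {j : ℕ} (hj : j ≤ m) (l : List Bool) (S : Fin (m + 1) → List Bool)
    (hl : S (Fin.ofNat (m + 1) j) = l) (a v) (hS : ∀ j, (S j).length ≤ N) (ha : a.length ≤ N) :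
    Path out N (⟨some (labClear m code j), v, stks S a⟩ : MCfg m code)
      ⟨some (labClear m code (j + 1)), none,
        stks (Function.update S (Fin.ofNat (m + 1) j) []) a⟩ := by
  induction l generalizing S v with
  | nil =>
    refine Path.head (b := ⟨some (labClear m code (j + 1)), none,
      stks (Function.update S (Fin.ofNat (m + 1) j) []) a⟩) ?_ ?_ Relation.ReflTransGen.refl
    · rw [step_clear hj]
      simp only [stkOf, TM2.stepAux]
      simp only [stks_some, hl]
      simp
    · exact small_update hS (by simp) ha
  | cons b l ih =>
    have hN : l.length ≤ N := by
      have := hS (Fin.ofNat (m + 1) j)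
      rw [hl] at this
      simp at this; omega
    refine Path.head (b := ⟨some (labClear m code j), some b,
      stks (Function.update S (Fin.ofNat (m + 1) j) l) a⟩) ?_ ?_ ?_
    · rw [step_clear hj]
      simp only [stkOf, TM2.stepAux]
      simp only [stks_some, hl]
      simp
    · exact small_update hS hN ha
    · have := ih (Function.update S (Fin.ofNat (m + 1) j) l) (by simp) (some b)
        (length_update_le hS hN)
      rwa [Function.update_idem] at this

/-- The final configuration `haltList` requires all stacks except that of the output to be empty.
The induction is on the number `d` of registers that are still to be cleared. -/
theorem path_clear (d : ℕ) {j : ℕ} (hj : j + d = m + 1) (S : Fin (m + 1) → List Bool)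
    (h0 : ∀ i : Fin (m + 1), (i : ℕ) < j → S i = []) (a v)
    (hS : ∀ j, (S j).length ≤ N) (ha : a.length ≤ N) :
    ∃ v', Path out N (⟨some (labClear m code j), v, stks S a⟩ : MCfg m code)
      ⟨some (labClear m code (m + 1)), v', stks (fun _ => []) a⟩ := by
  induction d generalizing j S v with
  | zero =>
    have : S = fun _ => [] := by
      funext i
      exact h0 i (by omega)
    subst this
    obtain rfl : j = m + 1 := by omega
    exact ⟨v, Relation.ReflTransGen.refl⟩
  | succ d ih =>
    have hv : (Fin.ofNat (m + 1) j).val = j := by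
      simp only [Fin.val_ofNat]; exact Nat.mod_eq_of_lt (by omega)
    obtain ⟨v', hv'⟩ := ih (j := j + 1) (by omega)
      (Function.update S (Fin.ofNat (m + 1) j) []) (by
        intro i hi
        by_cases h : i = Fin.ofNat (m + 1) j
        · subst h; rw [Function.update_self]
        · rw [Function.update_of_ne h]
          refine h0 i ?_
          have : (i : ℕ) ≠ j := fun h' => h (Fin.ext (by rw [hv, h']))
          omega) none (length_update_le hS (by simp))
    exact ⟨v', (path_clear_one (by omega) _ S rfl a v hS ha).trans hv'⟩

/-- The machine is deterministic, so every configuration that is reachable at all lies on the one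
path to the halting configuration. -/
theorem Path.small_of_reaches {a b c : MCfg m code} (h : Path out N a b) (ha : Small N a)
    (hb : TM2.step (machStmt m out code) b = none)
    (hc : Relation.ReflTransGen (fun a b => b ∈ TM2.step (machStmt m out code) a) a c) :
    Small N c := by
  induction h using Relation.ReflTransGen.head_induction_on with
  | refl =>
    rcases Relation.ReflTransGen.cases_head hc with rfl | ⟨d, hd, -⟩
    · exact ha
    · rw [Option.mem_def, hb] at hd
      cases hd
  | head h1 h2 ih =>
    rcases Relation.ReflTransGen.cases_head hc with rfl | ⟨d, hd, hd'⟩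
    · exact ha
    · rw [Option.mem_def, h1.1] at hd
      cases hd
      exact ih h1.2 hd'

theorem Path.evalsTo {a b : MCfg m code} (h : Path out N a b) :
    ∃ n, (flip bind (TM2.step (machStmt m out code)))^[n] (some a) = some b := by
  induction h using Relation.ReflTransGen.head_induction_on with
  | refl => exact ⟨0, rfl⟩
  | head h1 h2 ih =>
    obtain ⟨n, hn⟩ := ih
    refine ⟨n + 1, ?_⟩
    rw [Function.iterate_succ_apply, ← hn]
    congr 1
    exact h1.1

theorem bval_head {l : List Bool} {b : Bool} (h : bval l = b.toNat) : l.head?.getD false = b := by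
  cases l with
  | nil => cases b <;> simp_all [bval]
  | cons x l => cases b <;> cases x <;> simp_all [bval]

/-- A register program that decides a language with register values below `2 ^ N` gives a machine
with space linear in `N`. -/
theorem exists_decidesInSpace (p : Prog) (out : ℕ) (L : Language Bool) (N : ℕ → ℕ)
    (hN : ∀ n, n + 1 ≤ N n)
    (h : ∀ w : List Bool, ∃ (b : Bool) (B : ℕ) (s' : ℕ → ℕ), B < 2 ^ N w.length ∧
      Run B p (Function.update 0 0 (wcode w)) s' ∧ s' out = b.toNat ∧ (w ∈ L ↔ b = true)) :
    ∃ (M : TM2ComputableAux Bool Bool) (c : ℕ), DecidesInSpace M L (fun n => c * (N n + 1)) := by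
  set m := max p.maxReg out with hm
  set code := p.compile 0 with hcode
  -- The constant is the number of stacks, because the height of each single stack is bounded by `N
  -- n + 1`.
  refine ⟨⟨mach m out code, Equiv.refl Bool, Equiv.refl Bool⟩, Fintype.card (Stk m), fun w => ?_⟩
  obtain ⟨b, B, s', hB, hrun, hs', hL⟩ := h w
  have hm1 : p.maxReg ≤ m := le_max_left _ _
  have hm2 : out ≤ m := le_max_right _ _
  set n := N w.length with hn
  have hwn : w.length + 1 ≤ n := hN _
  have hinit : initList (mach m out code) w =
      (⟨some (.inl false), none, stks (fun _ => []) w⟩ : MCfg m code) := by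
    unfold initList
    congr 1
    funext k
    cases k
    · rfl
    · simp [mach, stks]
  have hhalt : haltList (mach m out code) [b] =
      (⟨none, none, stks (fun _ => []) [b]⟩ : MCfg m code) := by
    unfold haltList
    congr 1
    funext k
    cases k
    · rfl
    · simp [mach, stks]
  have hsmall0 : Small (n + 1) (⟨some (.inl false), none, stks (fun _ => []) w⟩ : MCfg m code) :=
    small_mk (by simp) (by omega)
  have hpath : Path out (n + 1)
      (⟨some (.inl false), none, stks (fun _ => []) w⟩ : MCfg m code)
      ⟨none, none, stks (fun _ => []) [b]⟩ := by
    refine Path.head (b := ⟨some (.inl true), none,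
      stks (Function.update (fun _ => []) (Fin.ofNat (m + 1) 0) [true]) w⟩) ?_ ?_ ?_
    · simp [TM2.step, machStmt, stkOf]
    · exact small_update (by simp) (by simp) (by omega)
    refine (path_load w [true] none (by simp; omega)).trans ?_
    have hold0 : Holds (m := m) n (0 : ℕ → ℕ) (fun _ => []) := fun j => by simp [bval]
    obtain ⟨S', hS', hP⟩ := hrun.path (m := m) (out := out) (code := code) hB (pre := [])
      (post := []) (by simp [hcode]) hm1
      (hold0.update (Nat.zero_le _) (l := w.reverse ++ [true]) (by simp; omega)
        (by rw [bval_reverse_append]; simp [bval, wcode]))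
    refine Path.trans (by simpa using hP) ?_
    have hlen : code.length = p.size := by simp [hcode]
    have hnone : code[p.size]? = none := by simp [hlen]
    have hb : (S' (Fin.ofNat (m + 1) out)).head?.getD false = b :=
      bval_head (by rw [hS'.reg hm2, hs'])
    -- The address `p.size` lies just past the code, so this step extracts the output bit before the
    -- registers are cleared.
    have key : TM2.stepAux (stmtAt m out code p.size none) none (stks S' []) =
        ⟨some (labClear m code 0), (S' (Fin.ofNat (m + 1) out)).head?,
          stks (Function.update S' (Fin.ofNat (m + 1) out)
            (S' (Fin.ofNat (m + 1) out)).tail) [b]⟩ := by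
      simp only [stmtAt, hnone, TM2.stepAux, stkOf, stks_some, update_stks_some,
        update_stks_none, stks_none, hb]
    have hS1 : ∀ j, (Function.update S' (Fin.ofNat (m + 1) out)
        (S' (Fin.ofNat (m + 1) out)).tail j).length ≤ n + 1 :=
      length_update_le (fun j => (hS' j).2.trans (by omega))
        (by have := (hS' (Fin.ofNat (m + 1) out)).2; simp only [List.length_tail]; omega)
    have hst := step_pc (m := m) (out := out) (code := code) (i := p.size) hlen.ge none none
      (stks S' [])
    rw [key] at hst
    refine Path.head hst (small_mk hS1 (by simp)) ?_
    obtain ⟨v', hv'⟩ := path_clear (N := n + 1) (out := out) (code := code) (m + 1)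
      (j := 0) (by omega) _ (by simp) [b] (S' (Fin.ofNat (m + 1) out)).head? hS1 (by simp)
    refine hv'.trans (Path.head ?_ ?_ Relation.ReflTransGen.refl)
    · have h1 : (Fin.ofNat (m + 2) (m + 1) : Fin _).val = m + 1 := by
        simp only [Fin.val_ofNat]; exact Nat.mod_eq_of_lt (by omega)
      simp only [TM2.step, machStmt, labClear, h1, lt_irrefl, if_false, TM2.stepAux]
    · exact small_mk (by simp) (by simp)
  have hout : Nonempty (TM2Outputs (mach m out code) w (some [b])) := by
    obtain ⟨k, hk⟩ := hpath.evalsTo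
    refine ⟨⟨k, ?_⟩⟩
    change (flip bind (TM2.step (machStmt m out code)))^[k] (some (initList (mach m out code) w)) =
      some (haltList (mach m out code) [b])
    rw [hinit, hhalt]
    exact hk
  have hmap : w.map (Equiv.refl Bool).symm = w := by simp
  refine ⟨fun hw => ?_, fun hw => ?_, fun c hc => ?_⟩
  · rw [hL.1 hw] at hout
    exact (congrArg (fun l => Nonempty (TM2Outputs (mach m out code) l (some [true]))) hmap).mpr hout
  · rw [(Bool.not_eq_true _).mp (mt hL.2 hw)] at hout
    exact (congrArg (fun l => Nonempty (TM2Outputs (mach m out code) l (some [false]))) hmap).mpr hout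
  · have hc' : Small (m := m) (code := code) (n + 1) c := by
      refine hpath.small_of_reaches hsmall0 rfl ?_
      rw [← hinit]
      exact (congrArg (fun l => TM2.Reaches (machStmt m out code) (initList (mach m out code) l) c)
        hmap).mp hc
    refine (Finset.sum_le_card_nsmul _ _ (n + 1) fun k _ => hc' k).trans ?_
    rw [smul_eq_mul]
    rfl

end Machine

end AutDecomp

namespace AutDecomp

/-! ## Functions computed by register programs with bounded registers -/

/-- Only increments raise a register, and they are checked against `B`. This carries the hypothesis
on the initial registers in `Comp` from one part of a program to the next. -/
theorem Run.le {B : ℕ} {p : Prog} {s s' : ℕ → ℕ} (h : Run B p s s') (hs : ∀ r, s r ≤ B) :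
    ∀ r, s' r ≤ B := by
  have upd : ∀ {s : ℕ → ℕ} {r x}, (∀ r, s r ≤ B) → x ≤ B → ∀ k, Function.update s r x k ≤ B := by
    intro s r x hs hx k
    by_cases hk : k = r
    · subst hk; simpa using hx
    · rw [Function.update_of_ne hk]; exact hs k
  induction h with
  | skip => exact hs
  | inc h => exact upd hs h
  | seq _ _ ih1 ih2 => exact ih2 (ih1 hs)
  | loop_zero => exact hs
  | @loop_succ r p x s' s'' s h _ _ ih1 ih2 =>
    exact ih2 (ih1 (upd hs (by have := hs r; omega)))

theorem Run.clear (B r : ℕ) (s : ℕ → ℕ) :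
    Run B (.loop r .skip) s (Function.update s r 0) := by
  induction h : s r generalizing s with
  | zero =>
    have := Run.loop_zero (B := B) (p := .skip) h
    rwa [Function.update_eq_self_iff.2 h.symm]
  | succ x ih =>
    refine .loop_succ h (.skip _) ?_
    have := ih (Function.update s r x) (by simp)
    rwa [Function.update_idem] at this

/-- A loop consumes its register, so a value is copied by moving it to two places at once; one of
them later gives it back. -/
theorem Run.move₂ {B r a c : ℕ} (hra : r ≠ a) (hrc : r ≠ c) (hac : a ≠ c) (s : ℕ → ℕ)
    (h1 : s a + s r ≤ B) (h2 : s c + s r ≤ B) :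
    Run B (.loop r (.seq (.inc a) (.inc c))) s
      (Function.update (Function.update (Function.update s r 0) a (s a + s r)) c (s c + s r)) := by
  induction h : s r generalizing s with
  | zero =>
    have := Run.loop_zero (B := B) (p := .seq (.inc a) (.inc c)) h
    convert this using 1
    funext k
    simp only [Function.update_apply]
    split_ifs <;> simp_all
  | succ x ih =>
    refine .loop_succ h (.seq (.inc ?_) (.inc ?_)) ?_
    · simp [hra.symm]; omega
    · simp [Function.update_apply, hrc.symm, hac.symm]; omega
    · have := ih (Function.update (Function.update (Function.update s r x) a
        ((Function.update s r x) a + 1)) c ((Function.update (Function.update s r x) a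
        ((Function.update s r x) a + 1)) c + 1)) ?_ ?_ ?_
      · convert this using 1
        funext k
        simp only [Function.update_apply]
        split_ifs <;> (simp_all; try omega)
      all_goals
        simp [hra, hrc, hac, hra.symm, hrc.symm, hac.symm]
      all_goals omega

theorem Run.move {B r a : ℕ} (hra : r ≠ a) (s : ℕ → ℕ) (h1 : s a + s r ≤ B) :
    Run B (.loop r (.inc a)) s (Function.update (Function.update s r 0) a (s a + s r)) := by
  induction h : s r generalizing s with
  | zero =>
    have := Run.loop_zero (B := B) (p := .inc a) h
    convert this using 1
    funext k
    simp only [Function.update_apply]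
    split_ifs <;> simp_all
  | succ x ih =>
    refine .loop_succ h (.inc ?_) ?_
    · simp [hra.symm]; omega
    · have := ih (Function.update (Function.update s r x) a ((Function.update s r x) a + 1)) ?_ ?_
      · convert this using 1
        funext k
        simp only [Function.update_apply]
        split_ifs <;> (simp_all; try omega)
      all_goals simp [hra, hra.symm]
      all_goals omega

/-- `Comp f b`: the function `f` is computed by a register program, and on arguments `v` no
register exceeds `b v` unless it did so before. The program reads its arguments from the registers
`ins`, adds its result to `out`, and uses registers from `k` on as scratch memory. -/
def Comp {n : ℕ} (f b : (Fin n → ℕ) → ℕ) : Prop :=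
  ∃ P : (Fin n → ℕ) → ℕ → ℕ → Prog, ∀ (ins : Fin n → ℕ) (out k : ℕ) (s : ℕ → ℕ) (B : ℕ),
    (∀ i, ins i < k) → out < k → (∀ i, ins i ≠ out) → (∀ r, k ≤ r → s r = 0) → s out = 0 →
    (∀ r, s r ≤ B) → b (s ∘ ins) ≤ B →
    Run B (P ins out k) s (Function.update s out (f (s ∘ ins)))

/-- The bound `0` suffices because the result and the scratch register only take values up to that
of `ins i`, which is at most `B` from the start. -/
theorem Comp.var {n : ℕ} (i : Fin n) : Comp (fun v => v i) (fun _ => 0) := by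
  refine ⟨fun ins out k => .seq (.loop (ins i) (.seq (.inc out) (.inc k))) (.loop k (.inc (ins i))),
    fun ins out k s B h1 h2 h3 h4 h5 h6 _ => ?_⟩
  have hi := h1 i
  have hio := h3 i
  have hk := h4 k le_rfl
  have hB := h6 (ins i)
  refine .seq (Run.move₂ hio hi.ne h2.ne s (by omega) (by omega)) ?_
  have := Run.move (B := B) (r := k) (a := ins i) hi.ne' (Function.update (Function.update
    (Function.update s (ins i) 0) out (s out + s (ins i))) k (s k + s (ins i))) ?_
  · convert this using 1
    funext r
    simp only [Function.update_apply, Function.comp]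
    have := hi.ne
    split_ifs <;> simp_all
  · simp [hi.ne, hio, hk, hB]

theorem Comp.const {n : ℕ} (c : ℕ) : Comp (fun _ : Fin n → ℕ => c) (fun _ => c) := by
  induction c with
  | zero =>
    refine ⟨fun _ _ _ => .skip, fun ins out k s B h1 h2 h3 h4 h5 h6 _ => ?_⟩
    rw [Function.update_eq_self_iff.2 h5.symm]
    exact .skip s
  | succ c ih =>
    obtain ⟨P, hP⟩ := ih
    refine ⟨fun ins out k => .seq (P ins out k) (.inc out),
      fun ins out k s B h1 h2 h3 h4 h5 h6 h7 => ?_⟩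
    refine .seq (hP ins out k s B h1 h2 h3 h4 h5 h6 ((Nat.le_succ c).trans h7)) ?_
    have := Run.inc (B := B) (r := out) (s := Function.update s out c) (by simpa using h7)
    simpa using this

theorem Comp.succ_var {n : ℕ} (i : Fin n) : Comp (fun v => v i + 1) (fun v => v i + 1) := by
  obtain ⟨P, hP⟩ := Comp.var i
  refine ⟨fun ins out k => .seq (P ins out k) (.inc out),
    fun ins out k s B h1 h2 h3 h4 h5 h6 h7 => ?_⟩
  refine .seq (hP ins out k s B h1 h2 h3 h4 h5 h6 (Nat.zero_le _)) ?_
  have := Run.inc (B := B) (r := out) (s := Function.update s out ((s ∘ ins) i))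
    (by simpa using h7)
  simpa using this

theorem Comp.pred_var {n : ℕ} (i : Fin n) : Comp (fun v => v i - 1) (fun _ => 0) := by
  obtain ⟨P, hP⟩ := Comp.var i
  -- The outer loop runs at most once: its test removes one unit, and the inner loop moves all the
  -- rest to `out`, which leaves the register of the outer loop empty.
  refine ⟨fun ins out k => .seq (P ins k (k + 1)) (.loop k (.loop k (.inc out))),
    fun ins out k s B h1 h2 h3 h4 h5 h6 h7 => ?_⟩
  refine .seq (hP ins k (k + 1) s B (fun i => (h1 i).trans (Nat.lt_succ_self k))
    (Nat.lt_succ_self k) (fun i => (h1 i).ne) (fun r hr => h4 r (by omega)) (h4 k le_rfl) h6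
    (by omega)) ?_
  have hk := h4 k le_rfl
  have hB := h6 (ins i)
  cases hx : s (ins i) with
  | zero =>
    have := Run.loop_zero (B := B) (r := k) (p := .loop k (.inc out))
      (s := Function.update s k 0) (by simp)
    simp only [Function.comp, hx]
    convert this using 1
    funext r
    simp only [Function.update_apply]
    split_ifs <;> simp_all
  | succ x =>
    simp only [Function.comp, hx]
    refine .loop_succ (x := x) (by simp) ?_ (s' := Function.update s out x) ?_
    · have := Run.move (B := B) (r := k) (a := out) h2.ne' (Function.update s k x)
        (by simp [h2.ne]; omega)
      rw [Function.update_idem]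
      convert this using 1
      funext r
      simp only [Function.update_apply]
      have := h2.ne
      split_ifs <;> simp_all
    · refine .loop_zero ?_
      rw [Function.update_of_ne h2.ne', hk]

/-! ### Blocks of registers -/

/-- Registers `a, …, a + n - 1` set to `v`. -/
def setBlock {n : ℕ} (s : ℕ → ℕ) (a : ℕ) (v : Fin n → ℕ) : ℕ → ℕ := fun r =>
  if h : a ≤ r ∧ r < a + n then v ⟨r - a, by omega⟩ else s r

theorem setBlock_of_lt {n : ℕ} (s : ℕ → ℕ) (a : ℕ) (v : Fin n → ℕ) {r : ℕ} (h : r < a) :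
    setBlock s a v r = s r := by
  rw [setBlock, dif_neg (by omega)]

theorem setBlock_of_ge {n : ℕ} (s : ℕ → ℕ) (a : ℕ) (v : Fin n → ℕ) {r : ℕ} (h : a + n ≤ r) :
    setBlock s a v r = s r := by
  rw [setBlock, dif_neg (by omega)]

@[simp] theorem setBlock_self {n : ℕ} (s : ℕ → ℕ) (a : ℕ) (v : Fin n → ℕ) (j : Fin n) :
    setBlock s a v (a + j) = v j := by
  rw [setBlock, dif_pos ⟨by omega, by omega⟩]
  congr 1
  ext
  simp

theorem exists_clearBlock (n : ℕ) : ∃ P : ℕ → Prog, ∀ B a s,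
    Run B (P a) s (setBlock s a (fun _ : Fin n => 0)) := by
  induction n with
  | zero =>
    refine ⟨fun _ => .skip, fun B a s => ?_⟩
    convert Run.skip s using 1
    funext r
    rw [setBlock, dif_neg (by omega)]
  | succ n ih =>
    obtain ⟨P, hP⟩ := ih
    refine ⟨fun a => .seq (P a) (.loop (a + n) .skip), fun B a s => .seq (hP B a s) ?_⟩
    convert Run.clear B (a + n) _ using 1
    funext r
    simp only [setBlock, Function.update_apply]
    split_ifs <;> first | rfl | omega

/-- The inputs lie outside the block, so that results already written do not disturb the
computations that follow. -/
theorem exists_computeBlock {n m : ℕ} (G b : Fin m → (Fin n → ℕ) → ℕ)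
    (h : ∀ j, Comp (G j) (b j)) : ∃ P : (Fin n → ℕ) → ℕ → ℕ → Prog,
    ∀ (ins : Fin n → ℕ) (a k : ℕ) (s : ℕ → ℕ) (B : ℕ), (∀ i, ins i < k) → a + m ≤ k →
    (∀ i, ins i < a ∨ a + m ≤ ins i) → (∀ r, k ≤ r → s r = 0) →
    (∀ r, a ≤ r → r < a + m → s r = 0) → (∀ r, s r ≤ B) → (∀ j, b j (s ∘ ins) ≤ B) →
    Run B (P ins a k) s (setBlock s a (fun j => G j (s ∘ ins))) := by
  induction m with
  | zero =>
    refine ⟨fun _ _ _ => .skip, fun ins a k s B _ _ _ _ _ _ _ => ?_⟩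
    convert Run.skip s using 1
    funext r
    rw [setBlock, dif_neg (by omega)]
  | succ m ih =>
    obtain ⟨P, hP⟩ := ih (fun j => G j.castSucc) (fun j => b j.castSucc) (fun j => h _)
    obtain ⟨Q, hQ⟩ := h (Fin.last m)
    refine ⟨fun ins a k => .seq (P ins a k) (Q ins (a + m) k),
      fun ins a k s B h1 h2 h3 h4 h5 h6 h7 => ?_⟩
    have r1 := hP ins a k s B h1 (by omega) (fun i => by have := h3 i; omega) h4
      (fun r hr hr' => h5 r hr (by omega)) h6 (fun j => h7 _)
    have hins : setBlock s a (fun j : Fin m => G j.castSucc (s ∘ ins)) ∘ ins = s ∘ ins := by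
      funext i
      rcases h3 i with h | h
      · exact setBlock_of_lt _ _ _ h
      · exact setBlock_of_ge _ _ _ (by omega)
    have r2 := hQ ins (a + m) k _ B h1 (by omega) (fun i => by have := h3 i; omega)
      (fun r hr => by rw [setBlock_of_ge _ _ _ (by omega), h4 r hr])
      (by rw [setBlock_of_ge _ _ _ (by omega), h5 _ (by omega) (by omega)]) (r1.le h6)
      (by rw [hins]; exact h7 _)
    refine .seq r1 ?_
    convert r2 using 1
    rw [hins]
    funext r
    simp only [setBlock, Function.update_apply]
    by_cases hr : r = a + m
    · subst hr
      simp only [if_true]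
      rw [dif_pos (by omega)]
      congr 1
      ext
      simp
    · rw [if_neg hr]
      by_cases hr' : a ≤ r ∧ r < a + m
      · rw [dif_pos hr', dif_pos (by omega)]
        rfl
      · rw [dif_neg hr', dif_neg (by omega)]

theorem setBlock_clear {n : ℕ} {s : ℕ → ℕ} {a : ℕ} (v : Fin n → ℕ)
    (h : ∀ r, a ≤ r → r < a + n → s r = 0) :
    setBlock (setBlock s a v) a (fun _ : Fin n => 0) = s := by
  funext r
  simp only [setBlock]
  split_ifs with h'
  · exact (h r h'.1 h'.2).symm
  · rfl

theorem setBlock_update {n : ℕ} (s : ℕ → ℕ) (a : ℕ) (v : Fin n → ℕ) {o x : ℕ}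
    (h : o < a ∨ a + n ≤ o) :
    setBlock (Function.update s o x) a v = Function.update (setBlock s a v) o x := by
  funext r
  simp only [setBlock, Function.update_apply]
  split_ifs <;> first | rfl | omega

/-- The intermediate values occupy a block at the beginning of the scratch memory. The block has to
be cleared at the end, since `Comp` promises that nothing but the output register changes. -/
theorem Comp.comp {n m : ℕ} {f bf : (Fin m → ℕ) → ℕ} (hf : Comp f bf)
    {G bG : Fin m → (Fin n → ℕ) → ℕ} (hG : ∀ j, Comp (G j) (bG j)) {b : (Fin n → ℕ) → ℕ}
    (hb : ∀ v, bf (fun j => G j v) ≤ b v ∧ ∀ j, bG j v ≤ b v) :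
    Comp (fun v => f (fun j => G j v)) b := by
  obtain ⟨P, hP⟩ := hf
  obtain ⟨Q, hQ⟩ := exists_computeBlock G bG hG
  obtain ⟨C, hC⟩ := exists_clearBlock m
  refine ⟨fun ins out k => .seq (Q ins k (k + m)) (.seq (P (fun j => k + j) out (k + m)) (C k)),
    fun ins out k s B h1 h2 h3 h4 h5 h6 h7 => ?_⟩
  have r1 := hQ ins k (k + m) s B (fun i => by have := h1 i; omega) le_rfl (fun i => Or.inl (h1 i))
    (fun r hr => h4 r (by omega)) (fun r hr _ => h4 r hr) h6
    (fun j => ((hb _).2 j).trans h7)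
  have hins : setBlock s k (fun j => G j (s ∘ ins)) ∘ (fun j : Fin m => k + (j : ℕ)) =
      fun j => G j (s ∘ ins) := by
    funext j
    simp
  have r2 := hP (fun j => k + j) out (k + m) _ B (fun j => by omega) (by omega)
    (fun j => by omega) (fun r hr => by rw [setBlock_of_ge _ _ _ hr, h4 r (by omega)])
    (by rw [setBlock_of_lt _ _ _ h2, h5]) (r1.le h6) (by rw [hins]; exact (hb _).1.trans h7)
  refine .seq r1 (.seq r2 ?_)
  convert hC B k _ using 1
  rw [setBlock_update _ _ _ (Or.inl h2), setBlock_clear _ (fun r hr _ => h4 r hr), hins]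

/-- Computation by a loop: the state `I v` is transformed by `G` until its component `c` is zero;
the result is its component `o`. -/
theorem Comp.while {n m : ℕ} {I bI : Fin m → (Fin n → ℕ) → ℕ} (hI : ∀ j, Comp (I j) (bI j))
    {G bG : Fin m → (Fin m → ℕ) → ℕ} (hG : ∀ j, Comp (G j) (bG j)) (c o : Fin m)
    {f b : (Fin n → ℕ) → ℕ} (hbI : ∀ v j, bI j v ≤ b v)
    (h : ∀ v, ∃ t : ℕ, ((fun u j => G j u)^[t] (fun j => I j v)) c = 0 ∧
      ((fun u j => G j u)^[t] (fun j => I j v)) o = f v ∧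
      ∀ t' < t, ((fun u j => G j u)^[t'] (fun j => I j v)) c ≠ 0 ∧
        ∀ j, bG j ((fun u j => G j u)^[t'] (fun j => I j v)) ≤ b v) :
    Comp f b := by
  obtain ⟨PI, hPI⟩ := exists_computeBlock I bI hI
  obtain ⟨PG, hPG⟩ := exists_computeBlock G bG hG
  obtain ⟨PV, hPV⟩ := exists_computeBlock (fun (j : Fin m) (v : Fin m → ℕ) => v j) _
    (fun j => Comp.var j)
  obtain ⟨C, hC⟩ := exists_clearBlock m
  obtain ⟨Pc, hPc⟩ := Comp.var c
  obtain ⟨Po, hPo⟩ := Comp.var o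
  -- Layout of the scratch memory: the state in the `m` registers from `k` on, the loop register `k
  -- + m`, and the next state in the `m` registers from `k + m + 1` on. The loop register is a fresh
  -- copy of component `c` in each round; the body first clears what the loop test has left of the
  -- old copy.
  refine ⟨fun ins out k => .seq (PI ins k (k + m + 1 + m)) <|
    .seq (Pc (fun j => k + j) (k + m) (k + m + 1 + m)) <|
    .seq (.loop (k + m) <| .seq (.loop (k + m) .skip) <|
      .seq (PG (fun j => k + j) (k + m + 1) (k + m + 1 + m)) <|
      .seq (C k) <| .seq (PV (fun j => k + m + 1 + j) k (k + m + 1 + m)) <|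
      .seq (C (k + m + 1)) (Pc (fun j => k + j) (k + m) (k + m + 1 + m))) <|
    .seq (Po (fun j => k + j) out (k + m + 1 + m)) (C k),
    fun ins out k s B h1 h2 h3 h4 h5 h6 h7 => ?_⟩
  -- the copy of the control component into the loop register
  have copyc : ∀ u : Fin m → ℕ, (∀ r, setBlock s k u r ≤ B) →
      Run B (Pc (fun j => k + j) (k + m) (k + m + 1 + m)) (setBlock s k u)
        (Function.update (setBlock s k u) (k + m) (u c)) := by
    intro u hu
    have hins : setBlock s k u ∘ (fun j : Fin m => k + (j : ℕ)) = u := by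
      funext j
      simp
    have := hPc (fun j => k + j) (k + m) (k + m + 1 + m) (setBlock s k u) B (fun j => by omega)
      (by omega) (fun j => by omega)
      (fun r hr => by rw [setBlock_of_ge _ _ _ (by omega), h4 r (by omega)])
      (by rw [setBlock_of_ge _ _ _ le_rfl, h4 _ (by omega)]) hu (Nat.zero_le _)
    rwa [hins] at this
  have body : ∀ (u : Fin m → ℕ) (x : ℕ), (∀ r, Function.update (setBlock s k u) (k + m) x r ≤ B) →
      (∀ j, bG j u ≤ B) →
      Run B (.seq (.loop (k + m) .skip) <|
        .seq (PG (fun j => k + j) (k + m + 1) (k + m + 1 + m)) <|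
        .seq (C k) <| .seq (PV (fun j => k + m + 1 + j) k (k + m + 1 + m)) <|
        .seq (C (k + m + 1)) (Pc (fun j => k + j) (k + m) (k + m + 1 + m)))
        (Function.update (setBlock s k u) (k + m) x)
        (Function.update (setBlock s k (fun j => G j u)) (k + m) (G c u)) := by
    intro u x hu hbu
    have q0 := Run.clear B (k + m) (Function.update (setBlock s k u) (k + m) x)
    have e0 : Function.update (setBlock s k u) (k + m) 0 = setBlock s k u := by
      rw [Function.update_eq_self_iff, setBlock_of_ge _ _ _ le_rfl, h4 _ (by omega)]
    rw [Function.update_idem, e0] at q0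
    have hins : setBlock s k u ∘ (fun j : Fin m => k + (j : ℕ)) = u := by
      funext j
      simp
    have q1 := hPG (fun j => k + j) (k + m + 1) (k + m + 1 + m) (setBlock s k u) B
      (fun j => by omega) le_rfl (fun j => by omega)
      (fun r hr => by rw [setBlock_of_ge _ _ _ (by omega), h4 r (by omega)])
      (fun r hr _ => by rw [setBlock_of_ge _ _ _ (by omega), h4 r (by omega)])
      (q0.le hu) (by rwa [hins])
    rw [hins] at q1
    have q2 := hC B k (setBlock (setBlock s k u) (k + m + 1) (fun j => G j u))
    have e2 : setBlock (setBlock (setBlock s k u) (k + m + 1) (fun j => G j u)) k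
        (fun _ : Fin m => 0) = setBlock s (k + m + 1) (fun j => G j u) := by
      funext r
      simp only [setBlock]
      split_ifs with h8 <;> first | rfl | omega | exact (h4 _ h8.1).symm
    rw [e2] at q2
    have hins2 : setBlock s (k + m + 1) (fun j => G j u) ∘
        (fun j : Fin m => k + m + 1 + (j : ℕ)) = fun j => G j u := by
      funext j
      simp
    have q3 := hPV (fun j => k + m + 1 + j) k (k + m + 1 + m)
      (setBlock s (k + m + 1) (fun j => G j u)) B (fun j => by omega) (by omega)
      (fun j => by omega)
      (fun r hr => by rw [setBlock_of_ge _ _ _ (by omega), h4 r (by omega)])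
      (fun r hr _ => by rw [setBlock_of_lt _ _ _ (by omega), h4 r (by omega)])
      (q2.le (q1.le (q0.le hu))) (fun _ => Nat.zero_le _)
    rw [hins2] at q3
    have q4 := hC B (k + m + 1)
      (setBlock (setBlock s (k + m + 1) (fun j => G j u)) k (fun j => G j u))
    have e4 : setBlock (setBlock (setBlock s (k + m + 1) (fun j => G j u)) k (fun j => G j u))
        (k + m + 1) (fun _ : Fin m => 0) = setBlock s k (fun j => G j u) := by
      funext r
      simp only [setBlock]
      split_ifs with h8 <;> first | rfl | omega | exact (h4 _ (by omega)).symm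
    rw [e4] at q4
    have q5 := copyc _ (q4.le (q3.le (q2.le (q1.le (q0.le hu)))))
    exact .seq q0 (.seq q1 (.seq q2 (.seq q3 (.seq q4 q5))))
  have r1 := hPI ins k (k + m + 1 + m) s B (fun i => by have := h1 i; omega) (by omega)
    (fun i => Or.inl (h1 i)) (fun r hr => h4 r (by omega)) (fun r hr _ => h4 r hr) h6
    (fun j => (hbI _ j).trans h7)
  obtain ⟨t, ht0, hto, ht⟩ := h (s ∘ ins)
  have r2 := copyc _ (r1.le h6)
  have loop : ∀ d t', t' + d = t →
      (∀ r, Function.update (setBlock s k ((fun u j => G j u)^[t'] (fun j => I j (s ∘ ins))))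
        (k + m) ((fun u j => G j u)^[t'] (fun j => I j (s ∘ ins)) c) r ≤ B) →
      Run B (.loop (k + m) <| .seq (.loop (k + m) .skip) <|
        .seq (PG (fun j => k + j) (k + m + 1) (k + m + 1 + m)) <|
        .seq (C k) <| .seq (PV (fun j => k + m + 1 + j) k (k + m + 1 + m)) <|
        .seq (C (k + m + 1)) (Pc (fun j => k + j) (k + m) (k + m + 1 + m)))
        (Function.update (setBlock s k ((fun u j => G j u)^[t'] (fun j => I j (s ∘ ins))))
          (k + m) ((fun u j => G j u)^[t'] (fun j => I j (s ∘ ins)) c))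
        (setBlock s k ((fun u j => G j u)^[t] (fun j => I j (s ∘ ins)))) := by
    intro d
    induction d with
    | zero =>
      intro t' ht' hb'
      obtain rfl : t' = t := by omega
      have e0 : Function.update (setBlock s k
          ((fun u j => G j u)^[t'] (fun j => I j (s ∘ ins)))) (k + m) 0 =
          setBlock s k ((fun u j => G j u)^[t'] (fun j => I j (s ∘ ins))) := by
        rw [Function.update_eq_self_iff, setBlock_of_ge _ _ _ le_rfl, h4 _ (by omega)]
      rw [ht0, e0]
      exact .loop_zero (by rw [setBlock_of_ge _ _ _ le_rfl, h4 _ (by omega)])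
    | succ d ih =>
      intro t' ht' hb'
      obtain ⟨hne, hbt⟩ := ht t' (by omega)
      obtain ⟨x, hx⟩ := Nat.exists_eq_succ_of_ne_zero hne
      have hxB : x ≤ B := by
        have := hb' (k + m)
        rw [Function.update_self] at this
        omega
      have hb'' : ∀ r, Function.update (setBlock s k
          ((fun u j => G j u)^[t'] (fun j => I j (s ∘ ins)))) (k + m) x r ≤ B := by
        intro r
        have := hb' r
        rw [Function.update_apply] at this ⊢
        split_ifs at this ⊢ <;> omega
      have q := body _ x hb'' (fun j => (hbt j).trans h7)
      have ih' := ih (t' + 1) (by omega)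
      simp only [Function.iterate_succ_apply'] at ih'
      refine .loop_succ (x := x) (by simpa using hx) ?_ (ih' (q.le hb''))
      rw [Function.update_idem]
      exact q
  have r3 := loop t 0 (by omega) (r2.le (r1.le h6))
  generalize hU : (fun u j => G j u)^[t] (fun j => I j (s ∘ ins)) = U at *
  have hins : setBlock s k U ∘ (fun j : Fin m => k + (j : ℕ)) = U := by
    funext j
    simp
  have r4 := hPo (fun j => k + j) out (k + m + 1 + m) (setBlock s k U) B (fun j => by omega)
    (by omega) (fun j => by omega)
    (fun r hr => by rw [setBlock_of_ge _ _ _ (by omega), h4 r (by omega)])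
    (by rw [setBlock_of_lt _ _ _ h2, h5]) (r3.le (r2.le (r1.le h6))) (Nat.zero_le _)
  rw [hins] at r4
  change Run _ _ _ (Function.update _ _ (U o)) at r4
  rw [hto] at r4
  refine .seq r1 (.seq r2 (.seq r3 (.seq r4 ?_)))
  convert hC B k _ using 1
  rw [setBlock_update _ _ _ (Or.inl h2), setBlock_clear _ (fun r hr _ => h4 r hr)]

end AutDecomp

namespace AutDecomp

/-! ## Functions computed with polynomially bounded registers -/

/-- `LS f`: the function `f` is computed by a register program whose registers stay below a
polynomial in the largest argument, that is, in linear space. -/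
def LS {n : ℕ} (f : (Fin n → ℕ) → ℕ) : Prop :=
  ∃ (b : (Fin n → ℕ) → ℕ) (c : ℕ), Comp f b ∧
    ∀ (v : Fin n → ℕ) (N : ℕ), (∀ i, v i ≤ N) → f v ≤ (N + 2) ^ c ∧ b v ≤ (N + 2) ^ c

theorem pow_le_pow_of_le {N a c : ℕ} (h : a ≤ c) : (N + 2) ^ a ≤ (N + 2) ^ c :=
  Nat.pow_le_pow_right (by omega) h

theorem le_pow_self_add (N : ℕ) {c : ℕ} (hc : c ≠ 0) : N ≤ (N + 2) ^ c :=
  (Nat.le_self_pow hc N).trans (Nat.pow_le_pow_left (by omega) c)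

/-- Under composition a bound `(N + 2) ^ a` takes the role of `N`. Adding `2` to it is absorbed by
adding `2` to the exponent, so all polynomial bounds can have the form `(N + 2) ^ c`. -/
theorem pow_add_two_le (N a : ℕ) : (N + 2) ^ a + 2 ≤ (N + 2) ^ (a + 2) := by
  have h1 : 1 ≤ (N + 2) ^ a := Nat.one_le_pow _ _ (by omega)
  have h2 : 4 ≤ (N + 2) ^ 2 := Nat.pow_le_pow_left (show 2 ≤ N + 2 by omega) 2
  rw [pow_add]
  nlinarith

theorem pow_pow_add_two_le (N a c : ℕ) : ((N + 2) ^ a + 2) ^ c ≤ (N + 2) ^ ((a + 2) * c) := by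
  rw [pow_mul]
  exact Nat.pow_le_pow_left (pow_add_two_le N a) c

namespace LS

variable {n m : ℕ}

theorem var (i : Fin n) : LS (fun v => v i) :=
  ⟨_, 1, Comp.var i, fun v N h => ⟨by have := h i; simp; omega, Nat.zero_le _⟩⟩

theorem const (c : ℕ) : LS (fun _ : Fin n → ℕ => c) := by
  have h : ∀ N, c ≤ (N + 2) ^ c := fun N =>
    (Nat.lt_two_pow_self (n := c)).le.trans (Nat.pow_le_pow_left (by omega) c)
  exact ⟨_, c, Comp.const c, fun v N _ => ⟨h N, h N⟩⟩

theorem succ_var (i : Fin n) : LS (fun v => v i + 1) :=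
  ⟨_, 1, Comp.succ_var i, fun v N h => by have := h i; simp; omega⟩

theorem pred_var (i : Fin n) : LS (fun v => v i - 1) :=
  ⟨_, 1, Comp.pred_var i, fun v N h => by have := h i; simp; omega⟩

theorem comp {f : (Fin m → ℕ) → ℕ} (hf : LS f) {G : Fin m → (Fin n → ℕ) → ℕ}
    (hG : ∀ j, LS (G j)) : LS (fun v => f (fun j => G j v)) := by
  obtain ⟨bf, cf, hf, hcf⟩ := hf
  choose bG cG hG hcG using hG
  set c := Finset.univ.sup cG with hc
  have hle : ∀ j, cG j ≤ c := fun j => Finset.le_sup (Finset.mem_univ j)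
  have key : ∀ (v : Fin n → ℕ) (N : ℕ), (∀ i, v i ≤ N) → ∀ j, G j v ≤ (N + 2) ^ c ∧
      bG j v ≤ (N + 2) ^ c := fun v N h j =>
    ⟨(hcG j v N h).1.trans (pow_le_pow_of_le (hle j)),
      (hcG j v N h).2.trans (pow_le_pow_of_le (hle j))⟩
  refine ⟨fun v => max (bf fun j => G j v) (Finset.univ.sup fun j => bG j v),
    max ((c + 2) * cf) c, Comp.comp hf hG fun v => ⟨le_max_left _ _, fun j =>
      (Finset.le_sup (f := fun j => bG j v) (Finset.mem_univ j)).trans (le_max_right _ _)⟩, ?_⟩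
  intro v N h
  have h1 := hcf (fun j => G j v) ((N + 2) ^ c) (fun j => (key v N h j).1)
  have h2 := (pow_pow_add_two_le N c cf).trans
    (pow_le_pow_of_le (N := N) (le_max_left ((c + 2) * cf) c))
  refine ⟨h1.1.trans h2, max_le (h1.2.trans h2) (Finset.sup_le fun j _ => ?_)⟩
  exact (key v N h j).2.trans (pow_le_pow_of_le (le_max_right _ _))

/-- Only the size of the states enters; the number `t` of rounds may be arbitrarily large. This is
the place where space is bounded without a bound on time. -/
theorem loop {I : Fin m → (Fin n → ℕ) → ℕ} (hI : ∀ j, LS (I j))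
    {G : Fin m → (Fin m → ℕ) → ℕ} (hG : ∀ j, LS (G j)) (c o : Fin m)
    {f : (Fin n → ℕ) → ℕ} (d : ℕ)
    (h : ∀ v, ∃ t : ℕ, ((fun u j => G j u)^[t] (fun j => I j v)) c = 0 ∧
      ((fun u j => G j u)^[t] (fun j => I j v)) o = f v ∧
      ∀ t' ≤ t, (t' < t → ((fun u j => G j u)^[t'] (fun j => I j v)) c ≠ 0) ∧
        ∀ N, (∀ i, v i ≤ N) → ∀ j, ((fun u j => G j u)^[t'] (fun j => I j v)) j ≤ (N + 2) ^ d) :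
    LS f := by
  choose bI cI hI hcI using hI
  choose bG cG hG hcG using hG
  set ci := Finset.univ.sup cI with hci
  set cg := Finset.univ.sup cG with hcg
  have hiL : ∀ j, cI j ≤ ci := fun j => Finset.le_sup (Finset.mem_univ j)
  have hgL : ∀ j, cG j ≤ cg := fun j => Finset.le_sup (Finset.mem_univ j)
  have hsup : ∀ (v : Fin n → ℕ) i, v i ≤ Finset.univ.sup v := fun v i =>
    Finset.le_sup (Finset.mem_univ i)
  refine ⟨fun v => max ((Finset.univ.sup v + 2) ^ ci) ((Finset.univ.sup v + 2) ^ ((d + 2) * cg)),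
    max d (max ci ((d + 2) * cg)), Comp.while hI hG c o ?_ ?_, ?_⟩
  · intro v j
    exact ((hcI j v _ (hsup v)).2.trans (pow_le_pow_of_le (hiL j))).trans (le_max_left _ _)
  · intro v
    obtain ⟨t, h1, h2, h3⟩ := h v
    refine ⟨t, h1, h2, fun t' ht' => ⟨(h3 t' ht'.le).1 ht', fun j => ?_⟩⟩
    refine le_trans ?_ (le_max_right _ _)
    refine ((hcG j _ _ ((h3 t' ht'.le).2 _ (hsup v))).2).trans ?_
    exact (pow_pow_add_two_le _ _ _).trans
      (pow_le_pow_of_le (Nat.mul_le_mul_left _ (hgL j)))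
  · intro v N hv
    obtain ⟨t, h1, h2, h3⟩ := h v
    have hs : Finset.univ.sup v ≤ N := Finset.sup_le fun i _ => hv i
    refine ⟨?_, max_le ?_ ?_⟩
    · rw [← h2]
      exact ((h3 t le_rfl).2 N hv o).trans (pow_le_pow_of_le (le_max_left _ _))
    · exact (Nat.pow_le_pow_left (by omega) _).trans (pow_le_pow_of_le (by simp))
    · exact (Nat.pow_le_pow_left (by omega) _).trans (pow_le_pow_of_le (by simp))

theorem comp₁ {F : ℕ → ℕ} (hF : LS fun w : Fin 1 → ℕ => F (w 0)) {f : (Fin n → ℕ) → ℕ}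
    (hf : LS f) : LS fun v => F (f v) :=
  hF.comp (G := fun _ => f) fun _ => hf

theorem comp₂ {F : ℕ → ℕ → ℕ} (hF : LS fun w : Fin 2 → ℕ => F (w 0) (w 1))
    {f g : (Fin n → ℕ) → ℕ} (hf : LS f) (hg : LS g) : LS fun v => F (f v) (g v) :=
  hF.comp (G := ![f, g]) fun j => by fin_cases j <;> assumption

theorem comp₃ {F : ℕ → ℕ → ℕ → ℕ} (hF : LS fun w : Fin 3 → ℕ => F (w 0) (w 1) (w 2))
    {f g h : (Fin n → ℕ) → ℕ} (hf : LS f) (hg : LS g) (hh : LS h) :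
    LS fun v => F (f v) (g v) (h v) :=
  hF.comp (G := ![f, g, h]) fun j => by fin_cases j <;> assumption

theorem succ {f : (Fin n → ℕ) → ℕ} (hf : LS f) : LS fun v => f v + 1 :=
  comp₁ (F := fun x => x + 1) (succ_var 0) hf

theorem pred {f : (Fin n → ℕ) → ℕ} (hf : LS f) : LS fun v => f v - 1 :=
  comp₁ (F := fun x => x - 1) (pred_var 0) hf

/-- Bounded primitive recursion. -/
theorem prec {f : (Fin n → ℕ) → ℕ} {g : ℕ → ℕ → (Fin n → ℕ) → ℕ} (h : ℕ → (Fin n → ℕ) → ℕ)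
    (h0 : ∀ v, h 0 v = f v) (hs : ∀ i v, h (i + 1) v = g i (h i v) v) (hf : LS f)
    (hg : LS fun w : Fin (n + 2) → ℕ => g (w 0) (w 1) (fun i => w i.succ.succ)) (d : ℕ)
    (hd : ∀ k v N, k ≤ N → (∀ i, v i ≤ N) → h k v ≤ (N + 2) ^ d)
    {k : (Fin n → ℕ) → ℕ} (hk : LS k) : LS fun v => h (k v) v := by
  have base : LS fun w : Fin (n + 1) → ℕ => h (w 0) (fun i => w i.succ) := by
    -- The state of the loop: the number of rounds left, the recursion index, the current value, and
    -- the parameters.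
    let I : Fin (n + 3) → (Fin (n + 1) → ℕ) → ℕ :=
      Fin.cons (fun w => w 0) (Fin.cons (fun _ => 0) (Fin.cons (fun w => f fun i => w i.succ)
        (fun i w => w i.succ)))
    let G : Fin (n + 3) → (Fin (n + 3) → ℕ) → ℕ :=
      Fin.cons (fun w => w 0 - 1) (Fin.cons (fun w => w 1 + 1)
        (Fin.cons (fun w => g (w 1) (w 2) fun i => w i.succ.succ.succ)
        (fun i w => w i.succ.succ.succ)))
    have hI : ∀ j, LS (I j) := by
      intro j
      refine Fin.cases (var 0) (fun j => ?_) j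
      refine Fin.cases (const 0) (fun j => ?_) j
      refine Fin.cases ?_ (fun j => ?_) j
      · exact hf.comp (G := fun i w => w i.succ) fun i => var _
      · exact var _
    have hG : ∀ j, LS (G j) := by
      intro j
      refine Fin.cases (pred_var 0) (fun j => ?_) j
      refine Fin.cases (succ_var 1) (fun j => ?_) j
      refine Fin.cases ?_ (fun j => ?_) j
      · exact hg.comp (G := Fin.cons (fun w => w 1) (Fin.cons (fun w => w 2)
          (fun i w => w i.succ.succ.succ))) fun i =>
            Fin.cases (var _) (fun i => Fin.cases (var _) (fun i => var _) i) i
      · exact var _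
    have iter : ∀ (w : Fin (n + 1) → ℕ) t, ((fun u j => G j u)^[t] (fun j => I j w)) =
        Fin.cons (w 0 - t) (Fin.cons t (Fin.cons (h t fun i => w i.succ)
          (fun i => w i.succ))) := by
      intro w t
      induction t with
      | zero =>
        funext j
        refine Fin.cases rfl (fun j => ?_) j
        refine Fin.cases rfl (fun j => ?_) j
        refine Fin.cases ?_ (fun j => rfl) j
        exact (h0 _).symm
      | succ t ih =>
        rw [Function.iterate_succ_apply', ih]
        funext j
        refine Fin.cases ?_ (fun j => ?_) j
        · simp [G]; omega
        refine Fin.cases rfl (fun j => ?_) j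
        refine Fin.cases ?_ (fun j => rfl) j
        exact (hs _ _).symm
    -- The exponent is `d + 1` because the counters and the parameters are bounded by `N` only, and
    -- `d` may be zero.
    refine LS.loop hI hG 0 2 (d + 1) fun w => ⟨w 0, ?_, ?_, fun t' ht' => ⟨fun ht => ?_, ?_⟩⟩
    · rw [iter]; simp
    · rw [iter]; rfl
    · rw [iter]; simp; omega
    · intro N hN j
      rw [iter]
      have hN' : N ≤ (N + 2) ^ (d + 1) := le_pow_self_add N (by omega)
      have h0' := hN 0
      refine Fin.cases ?_ (fun j => ?_) j
      · simp; omega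
      refine Fin.cases ?_ (fun j => ?_) j
      · simp; omega
      refine Fin.cases ?_ (fun j => ?_) j
      · exact (hd _ _ N (by omega) fun i => hN _).trans (pow_le_pow_of_le (by omega))
      · exact (hN _).trans hN'
  exact base.comp (G := Fin.cons k (fun i v => v i)) fun i =>
    Fin.cases hk (fun i => var i) i

/-! ### Arithmetic -/

theorem add {f g : (Fin n → ℕ) → ℕ} (hf : LS f) (hg : LS g) : LS fun v => f v + g v := by
  refine comp₂ (F := fun x y => x + y) ?_ hf hg
  refine prec (fun i (w : Fin 2 → ℕ) => w 0 + i) (g := fun _ r _ => r + 1) (fun _ => rfl)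
    (fun _ _ => rfl) (var 0) (succ_var 1) 2 ?_ (var 1)
  intro k v N hk hv
  have := hv 0
  simp only [pow_two]
  nlinarith

theorem sub {f g : (Fin n → ℕ) → ℕ} (hf : LS f) (hg : LS g) : LS fun v => f v - g v := by
  refine comp₂ (F := fun x y => x - y) ?_ hf hg
  refine prec (fun i (w : Fin 2 → ℕ) => w 0 - i) (g := fun _ r _ => r - 1) (fun _ => rfl)
    (fun _ _ => rfl) (var 0) (pred_var 1) 1 ?_ (var 1)
  intro k v N hk hv
  have := hv 0
  simp
  omega

theorem mul {f g : (Fin n → ℕ) → ℕ} (hf : LS f) (hg : LS g) : LS fun v => f v * g v := by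
  refine comp₂ (F := fun x y => x * y) ?_ hf hg
  refine prec (fun i (w : Fin 2 → ℕ) => w 0 * i) (g := fun _ r w => r + w 0) (fun _ => rfl)
    (fun _ _ => rfl) (const 0) (add (var 1) (var _)) 2 ?_ (var 1)
  intro k v N hk hv
  have := hv 0
  simp only [pow_two]
  nlinarith

theorem congr {f g : (Fin n → ℕ) → ℕ} (hf : LS f) (h : ∀ v, g v = f v) : LS g := by
  obtain rfl : g = f := funext h
  exact hf

end LS

/-- The characteristic number of a proposition. -/
noncomputable def ind (p : Prop) : ℕ := @ite _ p (Classical.propDecidable p) 1 0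

theorem ind_true {p : Prop} (h : p) : ind p = 1 := by simp [ind, h]

theorem ind_false {p : Prop} (h : ¬ p) : ind p = 0 := by simp [ind, h]

@[simp] theorem ind_eq_one {p : Prop} : ind p = 1 ↔ p := by by_cases h : p <;> simp [ind, h]

@[simp] theorem ind_eq_zero {p : Prop} : ind p = 0 ↔ ¬ p := by by_cases h : p <;> simp [ind, h]

theorem ind_le_one (p : Prop) : ind p ≤ 1 := by by_cases h : p <;> simp [ind, h]

/-- Predicates decided in linear space. -/
def LSP {n : ℕ} (p : (Fin n → ℕ) → Prop) : Prop := LS fun v => ind (p v)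

/-! ### Predicates: connectives, counting and bounded quantifiers -/

namespace LSP

variable {n m : ℕ} {p q : (Fin n → ℕ) → Prop} {f g : (Fin n → ℕ) → ℕ}

theorem congr (hp : LSP p) (h : ∀ v, q v ↔ p v) : LSP q := by
  obtain rfl : q = p := funext fun v => propext (h v)
  exact hp

theorem not (hp : LSP p) : LSP fun v => ¬ p v :=
  LS.congr (LS.sub (LS.const 1) hp) fun v => by by_cases h : p v <;> simp [ind, h]

theorem and (hp : LSP p) (hq : LSP q) : LSP fun v => p v ∧ q v :=
  LS.congr (LS.mul hp hq) fun v => by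
    by_cases h : p v <;> by_cases h' : q v <;> simp [ind, h, h']

theorem or (hp : LSP p) (hq : LSP q) : LSP fun v => p v ∨ q v :=
  (hp.not.and hq.not).not.congr fun v => by tauto

theorem imp (hp : LSP p) (hq : LSP q) : LSP fun v => p v → q v :=
  (hp.not.or hq).congr fun v => by tauto

theorem iff (hp : LSP p) (hq : LSP q) : LSP fun v => p v ↔ q v :=
  ((hp.imp hq).and (hq.imp hp)).congr fun v => by tauto

theorem const (P : Prop) : LSP fun _ : Fin n → ℕ => P := LS.const (ind P)

theorem lt (hf : LS f) (hg : LS g) : LSP fun v => f v < g v :=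
  LS.congr (LS.sub (LS.const 1) (LS.sub (LS.const 1) (LS.sub hg hf))) fun v => by
    by_cases h : f v < g v <;> simp [ind, h] <;> omega

theorem le (hf : LS f) (hg : LS g) : LSP fun v => f v ≤ g v :=
  (lt hg hf).not.congr fun v => by omega

theorem eq (hf : LS f) (hg : LS g) : LSP fun v => f v = g v :=
  ((le hf hg).and (le hg hf)).congr fun v => by omega

theorem ne (hf : LS f) (hg : LS g) : LSP fun v => f v ≠ g v := (eq hf hg).not

theorem comp {p : (Fin m → ℕ) → Prop} (hp : LSP p) {G : Fin m → (Fin n → ℕ) → ℕ}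
    (hG : ∀ j, LS (G j)) : LSP (fun v => p (fun j => G j v)) := LS.comp hp hG

/-- Counting is the basic form of search: bounded quantifiers, division and the decoding of words
are all derived from it. -/
theorem count {p : ℕ → (Fin n → ℕ) → Prop} [∀ v, DecidablePred fun i => p i v]
    (hp : LSP fun w : Fin (n + 1) → ℕ => p (w 0) (fun i => w i.succ)) {k : (Fin n → ℕ) → ℕ}
    (hk : LS k) : LS fun v => Nat.count (fun i => p i v) (k v) := by
  refine LS.prec (fun i v => Nat.count (fun i => p i v) i) (g := fun i r v => r + ind (p i v))
    (fun _ => rfl) (fun i v => ?_) (LS.const 0) ?_ 1 ?_ hk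
  · rw [Nat.count_succ]
    by_cases h : p i v <;> simp [h, ind]
  · refine LS.add (LS.var 1) ?_
    exact LS.comp hp (G := Fin.cons (fun w => w 0) (fun i w => w i.succ.succ)) fun i =>
      Fin.cases (LS.var _) (fun i => LS.var _) i
  · intro i v N hi _
    have := Nat.count_le (p := fun i => p i v) (n := i)
    simp
    omega

theorem exists_lt {p : ℕ → (Fin n → ℕ) → Prop} {k : (Fin n → ℕ) → ℕ} (hk : LS k)
    (hp : LSP fun w : Fin (n + 1) → ℕ => p (w 0) (fun i => w i.succ)) :
    LSP fun v => ∃ i < k v, p i v := by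
  classical
  refine (ne (count hp hk) (LS.const 0)).congr fun v => ?_
  rw [Nat.count_ne_iff_exists]

theorem forall_lt {p : ℕ → (Fin n → ℕ) → Prop} {k : (Fin n → ℕ) → ℕ} (hk : LS k)
    (hp : LSP fun w : Fin (n + 1) → ℕ => p (w 0) (fun i => w i.succ)) :
    LSP fun v => ∀ i < k v, p i v :=
  (exists_lt (p := fun i v => ¬ p i v) hk hp.not).not.congr fun v => by simp

end LSP

/-! ### Division and powers with a cut-off -/

namespace LS

variable {n : ℕ} {f g h : (Fin n → ℕ) → ℕ}

theorem ite {p : (Fin n → ℕ) → Prop} [∀ v, Decidable (p v)] (hp : LSP p) (hf : LS f) (hg : LS g) :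
    LS fun v => if p v then f v else g v :=
  LS.congr (add (mul hp hf) (mul hp.not hg)) fun v => by
    by_cases h : p v <;> simp [ind, h]

/-- For a positive divisor `y`, the quotient of `x` is the number of `q` with `(q + 1) * y ≤ x`, and
it suffices to look at `q < x`. The divisor zero, with quotient zero by convention, is treated
separately. -/
theorem div (hf : LS f) (hg : LS g) : LS fun v => f v / g v := by
  refine comp₂ (F := fun x y => x / y) ?_ hf hg
  refine congr (f := fun w => if 0 < w 1 then Nat.count (fun q => (q + 1) * w 1 ≤ w 0) (w 0)
      else 0) (ite (p := fun w : Fin 2 → ℕ => 0 < w 1)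
    (f := fun w => Nat.count (fun q => (q + 1) * w 1 ≤ w 0) (w 0)) (g := fun _ => 0)
    (LSP.lt (const 0) (var 1)) (LSP.count (p := fun q w => (q + 1) * w 1 ≤ w 0) ?_ (var 0))
    (const 0)) fun w => ?_
  · exact LSP.le (mul (succ (var _)) (var _)) (var _)
  · split_ifs with h
    · have h1 : w 0 / w 1 ≤ w 0 := Nat.div_le_self _ _
      obtain ⟨d, hd⟩ := Nat.exists_eq_add_of_le h1
      conv_rhs => arg 2; rw [hd]
      rw [Nat.count_add, Nat.count_iff_forall.2, Nat.count_iff_forall_not.2]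
      · rfl
      · intro q _ hq
        have := (Nat.le_div_iff_mul_le h).2 hq
        omega
      · intro q hq
        exact (Nat.le_div_iff_mul_le h).1 hq
    · have : w 1 = 0 := by omega
      simp [this]

theorem mod (hf : LS f) (hg : LS g) : LS fun v => f v % g v :=
  congr (sub hf (mul hg (div hf hg))) fun v => by
    have := Nat.div_add_mod (f v) (g v)
    omega

theorem min (hf : LS f) (hg : LS g) : LS fun v => min (f v) (g v) := by
  refine congr (sub hf (sub hf hg)) fun v => ?_
  omega

/-- Halving is repeated instead of dividing by the power, because `2 ^ g v` is not polynomially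
bounded. -/
theorem div_two_pow (hf : LS f) (hg : LS g) : LS fun v => f v / 2 ^ g v := by
  refine comp₂ (F := fun x y => x / 2 ^ y) ?_ hf hg
  refine prec (fun i (w : Fin 2 → ℕ) => w 0 / 2 ^ i) (g := fun _ r _ => r / 2) (fun _ => by simp)
    (fun i w => by rw [pow_succ, Nat.div_div_eq_div_mul]) (var 0) (div (var 1) (const 2)) 1 ?_
    (var 1)
  intro k v N _ hv
  have := hv 0
  have := Nat.div_le_self (v 0) (2 ^ k)
  simp
  omega

/-- Powers cut off at a given number. -/
theorem min_pow (hf : LS f) (hg : LS g) (hh : LS h) :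
    LS fun v => Min.min (f v ^ g v) (h v) := by
  refine comp₃ (F := fun x y z => Min.min (x ^ y) z) ?_ hf hg hh
  refine prec (fun i (w : Fin 3 → ℕ) => Min.min (w 0 ^ i) (w 2))
    (g := fun _ r w => Min.min (r * w 0) (w 2)) (f := fun w => Min.min 1 (w 2)) (fun w => by simp)
    (fun i w => ?_) (min (const 1) (var 2)) (min (mul (var 1) (var _)) (var _)) 1 ?_ (var 1)
  · rw [pow_succ]
    -- Cutting off in each step is harmless: once the power exceeds the limit it stays there under
    -- multiplication by a positive base, and for base zero both sides are zero.
    rcases le_total (w 0 ^ i) (w 2) with h | h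
    · rw [min_eq_left h]
    · rw [min_eq_right h]
      rcases Nat.eq_zero_or_pos (w 0) with h0 | h0
      · simp [h0]
      · rw [min_eq_right (Nat.le_mul_of_pos_right _ h0),
          min_eq_right (h.trans (Nat.le_mul_of_pos_right _ h0))]
  · intro k v N _ hv
    have := hv 2
    simp
    omega

end LS

theorem LSP.testBit {n : ℕ} {f g : (Fin n → ℕ) → ℕ} (hf : LS f) (hg : LS g) :
    LSP fun v => (f v).testBit (g v) = true :=
  (LSP.eq (LS.mod (LS.div_two_pow hf hg) (LS.const 2)) (LS.const 1)).congr fun v => by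
    rw [Nat.testBit_eq_decide_div_mod_eq, decide_eq_true_iff]

end AutDecomp

namespace AutDecomp

/-! ## Reachability by repeated halving -/

/-- Reachability in at most `2 ^ k` steps by a path whose midpoints are below `D`. -/
def HalvingReach (e : ℕ → ℕ → Prop) (D : ℕ) : ℕ → ℕ → ℕ → Prop
  | 0, u, v => u = v ∨ e u v
  | k + 1, u, v => ∃ w < D, HalvingReach e D k u w ∧ HalvingReach e D k w v

/-- A frame of the recursion: endpoints, midpoint, and the half that is being treated. -/
def frame (D u v w s : ℕ) : ℕ := ((u * D + v) * D + w) * 2 + s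

/-- A number larger than every frame. -/
def frameBase (D : ℕ) : ℕ := D * D * D * 2

theorem mul_add_lt_mul {a A b D : ℕ} (ha : a < A) (hb : b < D) : a * D + b < A * D := by
  have : (a + 1) * D ≤ A * D := Nat.mul_le_mul_right D ha
  rw [Nat.succ_mul] at this
  omega

theorem mul_add_div_of_lt {a b D : ℕ} (hb : b < D) : (a * D + b) / D = a := by
  rw [Nat.mul_comm, Nat.mul_add_div (by omega), Nat.div_eq_of_lt hb, add_zero]

theorem mul_add_mod_of_lt' {a b D : ℕ} (hb : b < D) : (a * D + b) % D = b := by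
  rw [Nat.mul_comm, Nat.mul_add_mod, Nat.mod_eq_of_lt hb]

theorem frame_lt {D u v w s : ℕ} (hu : u < D) (hv : v < D) (hw : w < D) (hs : s < 2) :
    frame D u v w s < frameBase D :=
  mul_add_lt_mul (mul_add_lt_mul (mul_add_lt_mul hu hv) hw) hs

theorem frame_side {D u v w s : ℕ} (hs : s < 2) : frame D u v w s % 2 = s :=
  mul_add_mod_of_lt' hs

theorem frame_mid {D u v w s : ℕ} (hw : w < D) (hs : s < 2) : frame D u v w s / 2 % D = w := by
  rw [frame, mul_add_div_of_lt hs, mul_add_mod_of_lt' hw]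

theorem frame_right {D u v w s : ℕ} (hv : v < D) (hw : w < D) (hs : s < 2) :
    frame D u v w s / 2 / D % D = v := by
  rw [frame, mul_add_div_of_lt hs, mul_add_div_of_lt hw, mul_add_mod_of_lt' hv]

theorem frame_left {D u v w s : ℕ} (hu : u < D) (hv : v < D) (hw : w < D) (hs : s < 2) :
    frame D u v w s / 2 / D / D % D = u := by
  rw [frame, mul_add_div_of_lt hs, mul_add_div_of_lt hw, mul_add_div_of_lt hv,
    Nat.mod_eq_of_lt hu]

/-- States of the evaluation of `HalvingReach`: whether it is still running, the last truth value,
the mode (`0`: evaluate the current pair at the current level, `1`: return to the frame on top of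
the stack), the current pair, the level, the stack, and the parameters. -/
def hrState (s : Fin 11 → ℕ) (run res mode u v k st : ℕ) : Fin 11 → ℕ :=
  ![run, res, mode, u, v, k, st, s 7, s 8, s 9, s 10]

/-- One step of the evaluation of `HalvingReach`. -/
noncomputable def hrStep (e : ℕ → ℕ → ℕ → ℕ → Prop) (s : Fin 11 → ℕ) : Fin 11 → ℕ :=
  if s 2 = 0 then
    if s 5 = 0 then
      hrState s 1 (ind (s 3 = s 4 ∨ e (s 3) (s 4) (s 9) (s 10))) 1 0 0 0 (s 6)
    else hrState s 1 0 0 (s 3) 0 (s 5 - 1) (s 6 * frameBase (s 7) + frame (s 7) (s 3) (s 4) 0 0)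
  -- The stack has one frame for each level between the current one and the top. Returning at the
  -- top level means that no frame is left.
  else if s 5 = s 8 then hrState s 0 (s 1) 1 0 0 (s 5) (s 6)
  else if s 1 = 0 then
    if s 6 % frameBase (s 7) / 2 % s 7 + 1 < s 7 then
      hrState s 1 0 0 (s 6 % frameBase (s 7) / 2 / s 7 / s 7 % s 7)
        (s 6 % frameBase (s 7) / 2 % s 7 + 1) (s 5)
        (s 6 / frameBase (s 7) * frameBase (s 7) +
          frame (s 7) (s 6 % frameBase (s 7) / 2 / s 7 / s 7 % s 7)
            (s 6 % frameBase (s 7) / 2 / s 7 % s 7) (s 6 % frameBase (s 7) / 2 % s 7 + 1) 0)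
    else hrState s 1 0 1 0 0 (s 5 + 1) (s 6 / frameBase (s 7))
  else if s 6 % frameBase (s 7) % 2 = 0 then
    hrState s 1 0 0 (s 6 % frameBase (s 7) / 2 % s 7) (s 6 % frameBase (s 7) / 2 / s 7 % s 7) (s 5)
      (s 6 / frameBase (s 7) * frameBase (s 7) +
        frame (s 7) (s 6 % frameBase (s 7) / 2 / s 7 / s 7 % s 7)
          (s 6 % frameBase (s 7) / 2 / s 7 % s 7) (s 6 % frameBase (s 7) / 2 % s 7) 1)
  else hrState s 1 1 1 0 0 (s 5 + 1) (s 6 / frameBase (s 7))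

/-! ### Correctness of the evaluation of `HalvingReach` -/

section Correct

variable (e : ℕ → ℕ → ℕ → ℕ → Prop) (D K x y : ℕ)

/-- The states in the evaluation with given parameters. -/
def hrMk (run res mode u v k st : ℕ) : Fin 11 → ℕ := ![run, res, mode, u, v, k, st, D, K, x, y]

/-- Transitions from running states. -/
def HRTrans (a b : Fin 11 → ℕ) : Prop := a 0 ≠ 0 ∧ b = hrStep e a

variable {e D K x y}

theorem hrTrans_leaf (u v st : ℕ) :
    HRTrans e (hrMk D K x y 1 0 0 u v 0 st)
      (hrMk D K x y 1 (ind (u = v ∨ e u v x y)) 1 0 0 0 st) := by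
  constructor <;> simp [hrMk, hrStep, hrState]

theorem hrTrans_call (u v k st : ℕ) :
    HRTrans e (hrMk D K x y 1 0 0 u v (k + 1) st)
      (hrMk D K x y 1 0 0 u 0 k (st * frameBase D + frame D u v 0 0)) := by
  constructor <;> simp [hrMk, hrStep, hrState]

theorem hrTrans_halt (b st : ℕ) :
    HRTrans e (hrMk D K x y 1 b 1 0 0 K st) (hrMk D K x y 0 b 1 0 0 K st) := by
  constructor <;> simp [hrMk, hrStep, hrState]

theorem hrTrans_second {u v w k : ℕ} (st : ℕ) (hu : u < D) (hv : v < D) (hw : w < D)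
    (hk : k < K) :
    HRTrans e (hrMk D K x y 1 1 1 0 0 k (st * frameBase D + frame D u v w 0))
      (hrMk D K x y 1 0 0 w v k (st * frameBase D + frame D u v w 1)) := by
  have hF := frame_lt hu hv hw (s := 0) (by omega)
  constructor
  · simp [hrMk]
  · simp [hrMk, hrStep, hrState, hk.ne, mul_add_div_of_lt hF, mul_add_mod_of_lt' hF,
      frame_side (show 0 < 2 by omega), frame_mid hw, frame_right hv hw, frame_left hu hv hw]

theorem hrTrans_success {u v w k : ℕ} (st : ℕ) (hu : u < D) (hv : v < D) (hw : w < D)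
    (hk : k < K) :
    HRTrans e (hrMk D K x y 1 1 1 0 0 k (st * frameBase D + frame D u v w 1))
      (hrMk D K x y 1 1 1 0 0 (k + 1) st) := by
  have hF := frame_lt hu hv hw (s := 1) (by omega)
  constructor
  · simp [hrMk]
  · simp [hrMk, hrStep, hrState, hk.ne, mul_add_div_of_lt hF, mul_add_mod_of_lt' hF,
      frame_side (show 1 < 2 by omega)]

/-- The half `s` is arbitrary, since a failure in either half discards the midpoint. -/
theorem hrTrans_next {u v w k s : ℕ} (st : ℕ) (hu : u < D) (hv : v < D) (hw : w + 1 < D)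
    (hk : k < K) (hs : s < 2) :
    HRTrans e (hrMk D K x y 1 0 1 0 0 k (st * frameBase D + frame D u v w s))
      (hrMk D K x y 1 0 0 u (w + 1) k (st * frameBase D + frame D u v (w + 1) 0)) := by
  have hw' : w < D := by omega
  have hF := frame_lt hu hv hw' hs
  constructor
  · simp [hrMk]
  · simp [hrMk, hrStep, hrState, hk.ne, mul_add_div_of_lt hF, mul_add_mod_of_lt' hF,
      frame_mid hw' hs, frame_right hv hw' hs, frame_left hu hv hw' hs, hw]

theorem hrTrans_fail {u v w k s : ℕ} (st : ℕ) (hu : u < D) (hv : v < D) (hw : w < D)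
    (hw' : ¬ w + 1 < D) (hk : k < K) (hs : s < 2) :
    HRTrans e (hrMk D K x y 1 0 1 0 0 k (st * frameBase D + frame D u v w s))
      (hrMk D K x y 1 0 1 0 0 (k + 1) st) := by
  have hF := frame_lt hu hv hw hs
  constructor
  · simp [hrMk]
  · simp [hrMk, hrStep, hrState, hk.ne, mul_add_div_of_lt hF, mul_add_mod_of_lt' hF,
      frame_mid hw hs, hw']

open Relation in
-- Induction on the level, for arbitrary stack contents `st` below: the evaluation at a level only
-- pushes frames on top of `st` and removes them again.
theorem hrStep_correct {k : ℕ} (hk : k ≤ K) {u v : ℕ} (st : ℕ) (hu : u < D) (hv : v < D) :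
    ReflTransGen (HRTrans e) (hrMk D K x y 1 0 0 u v k st)
      (hrMk D K x y 1 (ind (HalvingReach (fun u v => e u v x y) D k u v)) 1 0 0 k st) := by
  induction k generalizing u v st with
  | zero => exact .single (hrTrans_leaf u v st)
  | succ k ih =>
    refine .head (hrTrans_call u v k st) ?_
    -- Inner induction on the number of midpoints after `w` that are still to be tried; the state
    -- with midpoint `w` computes whether some midpoint from `w` on succeeds.
    have key : ∀ d w, w + (d + 1) = D → ReflTransGen (HRTrans e)
        (hrMk D K x y 1 0 0 u w k (st * frameBase D + frame D u v w 0))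
        (hrMk D K x y 1 (ind (∃ w' < D, w ≤ w' ∧ HalvingReach (fun u v => e u v x y) D k u w' ∧
          HalvingReach (fun u v => e u v x y) D k w' v)) 1 0 0 (k + 1) st) := by
      intro d
      induction d with
      | zero =>
        intro w hw
        have hw' : ¬ w + 1 < D := by omega
        refine (ih (by omega) _ hu (by omega)).trans ?_
        have iff : (∃ w' < D, w ≤ w' ∧ HalvingReach (fun u v => e u v x y) D k u w' ∧
          HalvingReach (fun u v => e u v x y) D k w' v) ↔
          HalvingReach (fun u v => e u v x y) D k u w ∧
          HalvingReach (fun u v => e u v x y) D k w v :=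
          ⟨fun ⟨w', h1, h2, h3⟩ => by obtain rfl : w' = w := by omega
                                      exact h3,
            fun h => ⟨w, by omega, le_rfl, h⟩⟩
        rw [iff]
        by_cases h1 : HalvingReach (fun u v => e u v x y) D k u w
        · rw [ind_true h1]
          refine .head (hrTrans_second st hu hv (by omega) hk) ?_
          refine (ih (by omega) _ (by omega) hv).trans ?_
          by_cases h2 : HalvingReach (fun u v => e u v x y) D k w v
          · rw [ind_true h2, ind_true ⟨h1, h2⟩]
            exact .single (hrTrans_success st hu hv (by omega) hk)
          · rw [ind_false h2, ind_false fun h => h2 h.2]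
            exact .single (hrTrans_fail st hu hv (by omega) hw' hk (by omega))
        · rw [ind_false h1, ind_false fun h => h1 h.1]
          exact .single (hrTrans_fail st hu hv (by omega) hw' hk (by omega))
      | succ d ihd =>
        intro w hw
        refine (ih (by omega) _ hu (by omega)).trans ?_
        have iff : ¬ (HalvingReach (fun u v => e u v x y) D k u w ∧
          HalvingReach (fun u v => e u v x y) D k w v) →
          ((∃ w' < D, w ≤ w' ∧ HalvingReach (fun u v => e u v x y) D k u w' ∧
          HalvingReach (fun u v => e u v x y) D k w' v) ↔
          (∃ w' < D, w + 1 ≤ w' ∧ HalvingReach (fun u v => e u v x y) D k u w' ∧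
          HalvingReach (fun u v => e u v x y) D k w' v)) := by
          intro h
          constructor
          · rintro ⟨w', h1, h2, h3⟩
            refine ⟨w', h1, ?_, h3⟩
            rcases h2.eq_or_lt with rfl | h2
            · exact absurd h3 h
            · exact h2
          · rintro ⟨w', h1, h2, h3⟩
            exact ⟨w', h1, by omega, h3⟩
        by_cases h1 : HalvingReach (fun u v => e u v x y) D k u w
        · rw [ind_true h1]
          refine .head (hrTrans_second st hu hv (by omega) hk) ?_
          refine (ih (by omega) _ (by omega) hv).trans ?_
          by_cases h2 : HalvingReach (fun u v => e u v x y) D k w v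
          · rw [ind_true h2, ind_true ⟨w, by omega, le_rfl, h1, h2⟩]
            exact .single (hrTrans_success st hu hv (by omega) hk)
          · rw [ind_false h2, iff fun h => h2 h.2]
            exact .head (hrTrans_next st hu hv (by omega) hk (by omega)) (ihd (w + 1) (by omega))
        · rw [ind_false h1, iff fun h => h1 h.1]
          exact .head (hrTrans_next st hu hv (by omega) hk (by omega)) (ihd (w + 1) (by omega))
    have := key (D - 1) 0 (by omega)
    simpa [HalvingReach] using this

theorem HRTrans.iterate {a b : Fin 11 → ℕ} (h : Relation.ReflTransGen (HRTrans e) a b) :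
    ∃ t, (hrStep e)^[t] a = b ∧ ∀ t' < t, (hrStep e)^[t'] a 0 ≠ 0 := by
  induction h using Relation.ReflTransGen.head_induction_on with
  | refl => exact ⟨0, rfl, by simp⟩
  | head h1 h2 ih =>
    obtain ⟨t, ht, ht'⟩ := ih
    refine ⟨t + 1, ?_, ?_⟩
    · rw [Function.iterate_succ_apply, ← h1.2, ht]
    · intro t' h
      cases t' with
      | zero => exact h1.1
      | succ t' =>
        rw [Function.iterate_succ_apply, ← h1.2]
        exact ht' t' (by omega)

/-- The invariant that bounds the states of the evaluation. -/
structure HRInv (D K x y : ℕ) (s : Fin 11 → ℕ) : Prop where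
  run : s 0 ≤ 1
  res : s 1 ≤ 1
  mode : s 2 ≤ 1
  left : s 3 < D
  right : s 4 < D
  level : s 5 ≤ K
  stack : s 6 < frameBase D ^ (K - s 5)
  base : s 7 = D
  top : s 8 = K
  fst : s 9 = x
  snd : s 10 = y

/-- The stack is a number in base `frameBase D` with one digit per frame. A push lowers the level
and a pop raises it, so the number of digits stays at most `K - s 5`. Since the components of a
frame are reduced modulo `D`, the bounds hold without knowing that the digits are genuine frames. -/
theorem HRInv.step {s : Fin 11 → ℕ} (h : HRInv D K x y s) : HRInv D K x y (hrStep e s) := by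
  have h3 := h.left
  have hD : 0 < D := by omega
  have hC : 0 < frameBase D := by simp [frameBase, hD]
  have h5 := h.level
  have h6 := h.stack
  have mk : ∀ run res mode u v k st, run ≤ 1 → res ≤ 1 → mode ≤ 1 → u < D → v < D → k ≤ K →
      st < frameBase D ^ (K - k) → HRInv D K x y (hrState s run res mode u v k st) :=
    fun run res mode u v k st a1 a2 a3 a4 a5 a6 a7 =>
      ⟨a1, a2, a3, a4, a5, a6, a7, h.base, h.top, h.fst, h.snd⟩
  have push : ∀ {st k F}, st < frameBase D ^ (K - (k + 1)) → k < K → F < frameBase D →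
      st * frameBase D + F < frameBase D ^ (K - k) := by
    intro st k F h1 h2 h3
    rw [show K - k = K - (k + 1) + 1 by omega, pow_succ]
    exact mul_add_lt_mul h1 h3
  have pop : s 5 < K → s 6 / frameBase D < frameBase D ^ (K - (s 5 + 1)) := by
    intro h7
    rw [show K - s 5 = K - (s 5 + 1) + 1 by omega, pow_succ'] at h6
    exact Nat.div_lt_of_lt_mul h6
  have hres := h.res
  have hm : ∀ a, a % D < D := fun a => Nat.mod_lt _ hD
  unfold hrStep
  rw [h.base, h.top]
  split_ifs with c1 c2 c3 c4 c5 c6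
  · refine mk _ _ _ _ _ _ _ le_rfl (ind_le_one _) le_rfl hD hD (Nat.zero_le _) ?_
    rwa [c2] at h6
  · refine mk _ _ _ _ _ _ _ le_rfl (by omega) (by omega) h3 hD (by omega)
      (push (by rwa [show s 5 - 1 + 1 = s 5 by omega]) (by omega)
        (frame_lt h3 h.right hD (by omega)))
  · exact mk _ _ _ _ _ _ _ (by omega) hres le_rfl hD hD h5 h6
  · exact mk _ _ _ _ _ _ _ le_rfl (by omega) (by omega) (hm _) c5 h5
      (push (pop (by omega)) (by omega) (frame_lt (hm _) (hm _) c5 (by omega)))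
  · exact mk _ _ _ _ _ _ _ le_rfl (by omega) le_rfl hD hD (by omega) (pop (by omega))
  · exact mk _ _ _ _ _ _ _ le_rfl (by omega) (by omega) (hm _) (hm _) h5
      (push (pop (by omega)) (by omega) (frame_lt (hm _) (hm _) (hm _) (by omega)))
  · exact mk _ _ _ _ _ _ _ le_rfl le_rfl le_rfl hD hD (by omega) (pop (by omega))

end Correct

/-! ### Space needed for the evaluation of `HalvingReach` -/

section Complexity

variable {n : ℕ}

theorem LS.frameBase {f : (Fin n → ℕ) → ℕ} (hf : LS f) : LS fun v => frameBase (f v) :=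
  ((hf.mul hf).mul hf).mul (LS.const 2)

theorem LS.frame {D u v w s : (Fin n → ℕ) → ℕ} (hD : LS D) (hu : LS u) (hv : LS v) (hw : LS w)
    (hs : LS s) : LS fun x => frame (D x) (u x) (v x) (w x) (s x) :=
  ((((((hu.mul hD).add hv).mul hD).add hw).mul (LS.const 2)).add hs)

theorem LS.hrState {run res mode u v k st : (Fin 11 → ℕ) → ℕ} (h1 : LS run) (h2 : LS res)
    (h3 : LS mode) (h4 : LS u) (h5 : LS v) (h6 : LS k) (h7 : LS st) (j : Fin 11) :
    LS fun s => hrState s (run s) (res s) (mode s) (u s) (v s) (k s) (st s) j := by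
  fin_cases j
  exacts [h1, h2, h3, h4, h5, h6, h7, LS.var 7, LS.var 8, LS.var 9, LS.var 10]

theorem LS.ite_apply {m : ℕ} {p : (Fin n → ℕ) → Prop} [∀ v, Decidable (p v)] (hp : LSP p)
    {A B : (Fin n → ℕ) → Fin m → ℕ} (hA : ∀ j, LS fun s => A s j) (hB : ∀ j, LS fun s => B s j)
    (j : Fin m) : LS fun s => (if p s then A s else B s) j :=
  LS.congr (LS.ite hp (hA j) (hB j)) fun v => by split_ifs <;> rfl

theorem LS.hrStep {e : ℕ → ℕ → ℕ → ℕ → Prop}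
    (he : LSP fun w : Fin 4 → ℕ => e (w 0) (w 1) (w 2) (w 3)) (j : Fin 11) :
    LS fun s => hrStep e s j := by
  have vr : ∀ i : Fin 11, LS fun s : Fin 11 → ℕ => s i := LS.var
  have k0 : LS fun _ : Fin 11 → ℕ => 0 := LS.const 0
  have k1 : LS fun _ : Fin 11 → ℕ => 1 := LS.const 1
  have k2 : LS fun _ : Fin 11 → ℕ => 2 := LS.const 2
  have hC := LS.frameBase (vr 7)
  have hF := LS.mod (vr 6) hC
  have hst := LS.div (vr 6) hC
  have hside := LS.mod hF k2
  have hw := LS.mod (LS.div hF k2) (vr 7)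
  have hv := LS.mod (LS.div (LS.div hF k2) (vr 7)) (vr 7)
  have hu := LS.mod (LS.div (LS.div (LS.div hF k2) (vr 7)) (vr 7)) (vr 7)
  have he' : LSP fun s : Fin 11 → ℕ => e (s 3) (s 4) (s 9) (s 10) :=
    he.comp (G := ![fun s => s 3, fun s => s 4, fun s => s 9, fun s => s 10])
      fun j => by fin_cases j <;> exact LS.var _
  unfold AutDecomp.hrStep
  refine LS.ite_apply (LSP.eq (vr 2) k0) (LS.ite_apply (LSP.eq (vr 5) k0) ?_ ?_)
    (LS.ite_apply (LSP.eq (vr 5) (vr 8)) ?_ (LS.ite_apply (LSP.eq (vr 1) k0)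
      (LS.ite_apply (LSP.lt hw.succ (vr 7)) ?_ ?_)
      (LS.ite_apply (LSP.eq hside k0) ?_ ?_))) j
  · exact LS.hrState k1 (LSP.or (LSP.eq (vr 3) (vr 4)) he') k1 k0 k0 k0 (vr 6)
  · exact LS.hrState k1 k0 k0 (vr 3) k0 (vr 5).pred
      (((vr 6).mul hC).add (LS.frame (vr 7) (vr 3) (vr 4) k0 k0))
  · exact LS.hrState k0 (vr 1) k1 k0 k0 (vr 5) (vr 6)
  · exact LS.hrState k1 k0 k0 hu hw.succ (vr 5)
      ((hst.mul hC).add (LS.frame (vr 7) hu hv hw.succ k0))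
  · exact LS.hrState k1 k0 k1 k0 k0 (vr 5).succ hst
  · exact LS.hrState k1 k0 k0 hw hv (vr 5) ((hst.mul hC).add (LS.frame (vr 7) hu hv hw k1))
  · exact LS.hrState k1 k1 k1 k0 k0 (vr 5).succ hst

/-- Reachability is decided in linear space, if a number is given that is as large as the stack
of the recursion. -/
theorem LSP.halvingReach {e : ℕ → ℕ → ℕ → ℕ → Prop}
    (he : LSP fun w : Fin 4 → ℕ => e (w 0) (w 1) (w 2) (w 3)) :
    LSP fun w : Fin 7 → ℕ => (w 0 < w 2 ∧ w 1 < w 2 ∧ AutDecomp.frameBase (w 2) ^ w 3 ≤ w 4) ∧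
      HalvingReach (fun u v => e u v (w 5) (w 6)) (w 2) (w 3) (w 0) (w 1) := by
  have hg : LSP fun w : Fin 7 → ℕ =>
      w 0 < w 2 ∧ w 1 < w 2 ∧ AutDecomp.frameBase (w 2) ^ w 3 ≤ w 4 := by
    refine (LSP.lt (LS.var 0) (LS.var 2)).and ((LSP.lt (LS.var 1) (LS.var 2)).and ?_)
    -- The power itself may be too large, but comparing it with `w 4` only requires its value cut
    -- off at `w 4 + 1`.
    refine (LSP.le (LS.min_pow (LS.frameBase (LS.var 2)) (LS.var 3) (LS.succ (LS.var 4)))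
      (LS.var 4)).congr fun w => ?_
    omega
  -- The guard is the initial value of the running flag. If it fails, then the loop ends after zero
  -- rounds with result `0`, and no bound on the stack is needed.
  let I : Fin 11 → (Fin 7 → ℕ) → ℕ := ![fun w => ind
    (w 0 < w 2 ∧ w 1 < w 2 ∧ AutDecomp.frameBase (w 2) ^ w 3 ≤ w 4), fun _ => 0, fun _ => 0,
    fun w => w 0, fun w => w 1, fun w => w 3, fun _ => 0, fun w => w 2, fun w => w 3,
    fun w => w 5, fun w => w 6]
  have hI : ∀ j, LS (I j) := by
    intro j
    fin_cases j
    exacts [hg, LS.const 0, LS.const 0, LS.var 0, LS.var 1, LS.var 3, LS.const 0, LS.var 2,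
      LS.var 3, LS.var 5, LS.var 6]
  refine LS.loop hI (G := fun j s => AutDecomp.hrStep e s j) (LS.hrStep he) 0 1 1 fun w => ?_
  have hiter : (fun (u : Fin 11 → ℕ) j => AutDecomp.hrStep e u j) = AutDecomp.hrStep e := rfl
  rw [hiter]
  by_cases h : w 0 < w 2 ∧ w 1 < w 2 ∧ AutDecomp.frameBase (w 2) ^ w 3 ≤ w 4
  · have hinit : (fun j => I j w) = hrMk (w 2) (w 3) (w 5) (w 6) 1 0 0 (w 0) (w 1) (w 3) 0 := by
      funext j
      fin_cases j <;> simp [I, hrMk, h]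
    have h1 := (hrStep_correct (e := e) (K := w 3) (x := w 5) (y := w 6) (le_refl (w 3)) 0
      h.1 h.2.1).tail (hrTrans_halt _ 0)
    obtain ⟨t, ht, ht'⟩ := HRTrans.iterate h1
    rw [hinit]
    refine ⟨t, ?_, ?_, fun t' htt => ⟨fun hlt => ht' t' hlt, fun N hN j => ?_⟩⟩
    · rw [ht]; rfl
    · rw [ht]
      simp only [h, true_and]
      rfl
    · have inv : ∀ t, HRInv (w 2) (w 3) (w 5) (w 6)
          ((AutDecomp.hrStep e)^[t] (hrMk (w 2) (w 3) (w 5) (w 6) 1 0 0 (w 0) (w 1) (w 3) 0)) := by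
        intro t
        induction t with
        | zero => exact ⟨le_rfl, by simp [hrMk], by simp [hrMk], h.1, h.2.1, le_rfl,
            by simp [hrMk], rfl, rfl, rfl, rfl⟩
        | succ t ih =>
          rw [Function.iterate_succ_apply']
          exact ih.step
      have hinv := inv t'
      generalize (AutDecomp.hrStep e)^[t']
        (hrMk (w 2) (w 3) (w 5) (w 6) 1 0 0 (w 0) (w 1) (w 3) 0) = s at hinv
      have hC : 0 < AutDecomp.frameBase (w 2) := by
        simp [AutDecomp.frameBase]
        omega
      have hs : s 6 ≤ w 4 := (hinv.stack.le.trans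
        (Nat.pow_le_pow_right hC (by omega))).trans h.2.2
      have e0 := hN 2
      have e1 := hN 3
      have e2 := hN 4
      have e3 := hN 5
      have e4 := hN 6
      have := hinv.run
      have := hinv.res
      have := hinv.mode
      have := hinv.left
      have := hinv.right
      have := hinv.level
      have := hinv.base
      have := hinv.top
      have := hinv.fst
      have := hinv.snd
      rw [pow_one]
      fin_cases j <;> simp only [Fin.zero_eta, Fin.mk_one, Fin.reduceFinMk] <;> omega
  · refine ⟨0, ?_, ?_, fun t' htt => ⟨by omega, fun N hN j => ?_⟩⟩
    · simp [I, h]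
    · rw [ind_false fun h' => h h'.1]; rfl
    · obtain rfl : t' = 0 := by omega
      have e5 := hN 0
      have e6 := hN 1
      have e0 := hN 2
      have e1 := hN 3
      have e3 := hN 5
      have e4 := hN 6
      have e7 : I 0 w ≤ 1 := ind_le_one _
      rw [pow_one, Function.iterate_zero, id]
      fin_cases j <;> first | exact e7.trans (by omega) | exact Nat.zero_le _ | skip
      all_goals simp [I]; omega

end Complexity

end AutDecomp

namespace AutDecomp

/-! ## Paths and repeated halving -/

/-- Paths with `l` edges. -/
def PathLen (e : ℕ → ℕ → Prop) (l u v : ℕ) : Prop :=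
  ∃ f : ℕ → ℕ, f 0 = u ∧ f l = v ∧ ∀ i < l, e (f i) (f (i + 1))

theorem PathLen.append {e : ℕ → ℕ → Prop} {a b u v w : ℕ} (h : PathLen e a u v)
    (h' : PathLen e b v w) : PathLen e (a + b) u w := by
  obtain ⟨f, hf0, hfa, hf⟩ := h
  obtain ⟨g, hg0, hgb, hg⟩ := h'
  refine ⟨fun i => if i ≤ a then f i else g (i - a), by simpa using hf0, ?_, fun i hi => ?_⟩
  · by_cases hb : b = 0
    · subst hb
      simp [hfa, ← hgb, hg0]
    · simp [show ¬ a + b ≤ a by omega, hgb]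
  · by_cases h1 : i + 1 ≤ a
    · simp only [h1, show i ≤ a by omega, if_true]
      exact hf i (by omega)
    · by_cases h2 : i = a
      · subst h2
        have := hg 0 (by omega)
        rw [hg0] at this
        simpa [hfa] using this
      · simp only [h1, show ¬ i ≤ a by omega, if_false]
        rw [show i + 1 - a = i - a + 1 by omega]
        exact hg _ (by omega)

theorem PathLen.split {e : ℕ → ℕ → Prop} {a b u w : ℕ} (h : PathLen e (a + b) u w) :
    ∃ v, PathLen e a u v ∧ PathLen e b v w := by
  obtain ⟨f, hf0, hfa, hf⟩ := h
  exact ⟨f a, ⟨f, hf0, rfl, fun i hi => hf i (by omega)⟩,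
    ⟨fun i => f (a + i), rfl, hfa, fun i hi => hf (a + i) (by omega)⟩⟩

theorem PathLen.lt {e : ℕ → ℕ → Prop} {D : ℕ} (he : ∀ u v, e u v → v < D) {l u v : ℕ}
    (h : PathLen e l u v) (hu : u < D) : v < D := by
  obtain ⟨f, rfl, rfl, hf⟩ := h
  cases l with
  | zero => exact hu
  | succ l => exact he _ _ (hf l (by omega))

/-- Pigeonhole principle: a path with `D` or more edges has more than `D` vertices, all of them
below `D`, so it repeats one, and the part in between can be cut out. -/
theorem PathLen.exists_short {e : ℕ → ℕ → Prop} {D : ℕ} (he : ∀ u v, e u v → v < D) {l u v : ℕ}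
    (h : PathLen e l u v) (hu : u < D) : ∃ l' < D, PathLen e l' u v := by
  induction l using Nat.strong_induction_on with
  | _ l ih =>
    by_cases hl : l < D
    · exact ⟨l, hl, h⟩
    · obtain ⟨f, hf0, hfl, hf⟩ := h
      have hlt : ∀ i : Fin (l + 1), f i < D := fun i =>
        PathLen.lt he ⟨f, hf0, rfl, fun j hj => hf j (by omega)⟩ hu
      obtain ⟨i, j, hij, hfij⟩ := Fintype.exists_ne_map_eq_of_card_lt
        (fun i : Fin (l + 1) => (⟨f i, hlt i⟩ : Fin D)) (by simp; omega)
      have cut : ∀ i j : Fin (l + 1), i < j → f i = f j → ∃ l' < l, PathLen e l' u v := by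
        intro i j hij hfij
        have h1 : (i : ℕ) < j := hij
        have h2 := j.isLt
        refine ⟨i + (l - j), by omega, PathLen.append (v := f i)
          ⟨f, hf0, rfl, fun k hk => hf k (by omega)⟩
          ⟨fun k => f (j + k), by simp [hfij], ?_, fun k hk => hf (j + k) (by omega)⟩⟩
        simp only
        rw [show (j : ℕ) + (l - j) = l by omega, hfl]
      have hfij' : f i = f j := by simpa using hfij
      obtain ⟨l', hl', hp⟩ : ∃ l' < l, PathLen e l' u v := by
        rcases lt_or_gt_of_ne hij with h | h
        · exact cut i j h hfij'
        · exact cut j i h hfij'.symm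
      exact ih l' hl' hp

/-- A path is split after `min l (2 ^ k)` edges, so that both parts have at most `2 ^ k` edges.
Midpoints are below `D` because targets of edges are. -/
theorem PathLen.halvingReach {e : ℕ → ℕ → Prop} {D : ℕ} (he : ∀ u v, e u v → v < D) {k l u v : ℕ}
    (h : PathLen e l u v) (hu : u < D) (hl : l ≤ 2 ^ k) : HalvingReach e D k u v := by
  induction k generalizing l u v with
  | zero =>
    obtain ⟨f, rfl, rfl, hf⟩ := h
    obtain rfl | rfl : l = 0 ∨ l = 1 := by simp at hl; omega
    · exact Or.inl rfl
    · exact Or.inr (hf 0 (by omega))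
  | succ k ih =>
    rw [pow_succ] at hl
    obtain ⟨b, hb⟩ := Nat.exists_eq_add_of_le (min_le_left l (2 ^ k))
    rw [hb] at h
    obtain ⟨w, h1, h2⟩ := h.split
    have hw := h1.lt he hu
    exact ⟨w, hw, ih h1 hu (min_le_right _ _), ih h2 hw (by omega)⟩

theorem HalvingReach.reflTransGen {e : ℕ → ℕ → Prop} {D k u v : ℕ} (h : HalvingReach e D k u v) :
    Relation.ReflTransGen e u v := by
  induction k generalizing u v with
  | zero =>
    rcases h with rfl | h
    · exact .refl
    · exact .single h
  | succ k ih =>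
    obtain ⟨w, -, h1, h2⟩ := h
    exact (ih h1).trans (ih h2)

/-- A path can be shortened to fewer than `D` edges, and `k` halvings resolve paths with up to `2 ^
k` edges. -/
theorem halvingReach_iff {e : ℕ → ℕ → Prop} {D k u v : ℕ} (he : ∀ u v, e u v → v < D) (hu : u < D)
    (hD : D ≤ 2 ^ k) : HalvingReach e D k u v ↔ Relation.ReflTransGen e u v := by
  refine ⟨HalvingReach.reflTransGen, fun h => ?_⟩
  have : ∃ l, PathLen e l u v := by
    induction h with
    | refl => exact ⟨0, fun _ => u, rfl, rfl, by simp⟩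
    | @tail b c _ h2 ih =>
      obtain ⟨l, hl⟩ := ih
      refine ⟨l + 1, hl.append ⟨fun i => if i = 0 then b else c, by simp, by simp, ?_⟩⟩
      intro i hi
      obtain rfl : i = 0 := by omega
      simpa using h2
  obtain ⟨l, hl⟩ := this
  obtain ⟨l', hl', hp⟩ := hl.exists_short he hu
  exact hp.halvingReach he hu (by omega)

/-! ## The powerset construction on bit masks -/

open Classical in
/-- The set of `d`-successors of a set of numbers below `m`, as bit masks. -/
noncomputable def pstep (m : ℕ) (d : ℕ → ℕ → Prop) (t : ℕ) : ℕ :=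
  Nat.ofBits fun y : Fin m => decide (∃ x < m, t.testBit x = true ∧ d x y)

theorem pstep_lt (m : ℕ) (d : ℕ → ℕ → Prop) (t : ℕ) : pstep m d t < 2 ^ m :=
  Nat.ofBits_lt_two_pow _

theorem testBit_pstep {m : ℕ} {d : ℕ → ℕ → Prop} {t y : ℕ} :
    (pstep m d t).testBit y = true ↔ y < m ∧ ∃ x < m, t.testBit x = true ∧ d x y := by
  by_cases hy : y < m
  · simp [pstep, Nat.testBit_ofBits_lt, hy]
  · simp [pstep, Nat.testBit_ofBits_ge _ _ (Nat.le_of_not_lt hy), hy]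

theorem eq_of_testBit_iff {m s t : ℕ} (hs : s < 2 ^ m) (ht : t < 2 ^ m)
    (h : ∀ y < m, s.testBit y = true ↔ t.testBit y = true) : s = t := by
  refine Nat.eq_of_testBit_eq fun y => ?_
  by_cases hy : y < m
  · exact Bool.eq_iff_iff.2 (h y hy)
  · have hle : 2 ^ m ≤ 2 ^ y := Nat.pow_le_pow_right (by omega) (by omega)
    rw [Nat.testBit_lt_two_pow (hs.trans_le hle), Nat.testBit_lt_two_pow (ht.trans_le hle)]

/-- Successor sets need not be computed: whether a given mask is the successor set is tested bit by
bit with bounded quantifiers. -/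
theorem eq_pstep_iff {m : ℕ} {d : ℕ → ℕ → Prop} {t t' : ℕ} (ht' : t' < 2 ^ m) :
    t' = pstep m d t ↔
      ∀ y < m, t'.testBit y = true ↔ ∃ x < m, t.testBit x = true ∧ d x y := by
  constructor
  · rintro rfl y hy
    rw [testBit_pstep]
    simp [hy]
  · intro h
    refine eq_of_testBit_iff ht' (pstep_lt _ _ _) fun y hy => ?_
    rw [h y hy, testBit_pstep]
    simp [hy]

end AutDecomp

namespace AutDecomp

/-! ## Words of pairs and triples -/

theorem zip_fst_snd {A B : Type} {l : List (A × B)} :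
    (l.map Prod.fst).zip (l.map Prod.snd) = l := by
  induction l with
  | nil => rfl
  | cons a l ih => simp [ih]

/-- Passing from pairs of words to words of pairs builds the equality of lengths into the words, so
that the conditions can be treated by means of words of triples. -/
theorem PDFA.mem_rel {A B : Type} (M : PDFA (A × B)) (u : List A) (v : List B) :
    (u, v) ∈ M.rel ↔ ∃ w ∈ M.lang, w.map Prod.fst = u ∧ w.map Prod.snd = v := by
  constructor
  · rintro ⟨h1, h2⟩
    exact ⟨_, h2, List.map_fst_zip (by simp [h1]), List.map_snd_zip (by simp [h1])⟩
  · rintro ⟨w, hw, rfl, rfl⟩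
    refine ⟨by simp, ?_⟩
    simpa only [zip_fst_snd] using hw

section Triples

variable {I B O : Type}

/-- Forget the middle component. -/
def dropMid (a : I × B × O) : I × O := (a.1, a.2.2)

/-- Forget the last component. -/
def dropLast' (a : I × B × O) : I × B := (a.1, a.2.1)

/-- Two words are glued along their common intermediate word; this is the form in which compositions
of length-preserving relations appear below. -/
theorem exists_triples (w : List (I × B)) (w' : List (B × O))
    (h : w.map Prod.snd = w'.map Prod.fst) :
    ∃ z : List (I × B × O), z.map dropLast' = w ∧ z.map Prod.snd = w' := by
  induction w generalizing w' with
  | nil =>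
    cases w' with
    | nil => exact ⟨[], rfl, rfl⟩
    | cons => simp at h
  | cons a w ih =>
    cases w' with
    | nil => simp at h
    | cons a' w' =>
      simp only [List.map_cons, List.cons.injEq] at h
      obtain ⟨z, h1, h2⟩ := ih w' h.2
      refine ⟨(a.1, a'.1, a'.2) :: z, ?_, ?_⟩
      · simp [h1, dropLast', ← h.1]
      · simp [h2]

variable (LR : Set (List (I × O))) (L₂ : Set (List (B × O)))

/-- The words of pairs in the largest admissible first factor. -/
def Good (w : List (I × B)) : Prop :=
  (∃ z : List (I × B × O), z.map dropLast' = w ∧ z.map Prod.snd ∈ L₂) ∧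
    ∀ z : List (I × B × O), z.map dropLast' = w → z.map Prod.snd ∈ L₂ → z.map dropMid ∈ LR

end Triples

/-! ### The largest admissible first factor -/

section Conditions

variable {I B O : Type} {MR : PDFA (I × O)} {M₂ : PDFA (B × O)} {M₁ : PDFA (I × B)}

/-- Maximality: the image condition provides an `R₂`-partner of the intermediate word, and the
inclusion in `R` forces every such partner to be a correct output. -/
theorem good_of_conditions (h1 : M₁.rel.cod ⊆ M₂.rel.dom) (h2 : M₁.rel.comp M₂.rel ⊆ MR.rel)
    {w : List (I × B)} (hw : w ∈ M₁.lang) : Good MR.lang M₂.lang w := by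
  have hmem : (w.map Prod.fst, w.map Prod.snd) ∈ M₁.rel := (M₁.mem_rel _ _).2 ⟨w, hw, rfl, rfl⟩
  constructor
  · obtain ⟨o, ho⟩ := h1 ⟨_, hmem⟩
    obtain ⟨w', hw', h3, -⟩ := (M₂.mem_rel _ _).1 ho
    obtain ⟨z, hz1, hz2⟩ := exists_triples w w' h3.symm
    exact ⟨z, hz1, hz2 ▸ hw'⟩
  · rintro z rfl hz
    have h3 : ((z.map dropLast').map Prod.fst, (z.map Prod.snd).map Prod.snd) ∈ MR.rel := by
      refine h2 ⟨_, hmem, (M₂.mem_rel _ _).2 ⟨_, hz, ?_, rfl⟩⟩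
      simp [dropLast', Function.comp_def]
    obtain ⟨w', hw', h4, h5⟩ := (MR.mem_rel _ _).1 h3
    have : w' = z.map dropMid := by
      rw [← zip_fst_snd (l := w'), h4, h5, ← zip_fst_snd (l := z.map dropMid)]
      simp [dropMid, dropLast', Function.comp_def]
    exact this ▸ hw'

/-- Conversely, the two clauses of `Good` are the image condition and the inclusion in `R`, read
word by word. Hence the largest factor is itself admissible. -/
theorem conditions_of_good (h : ∀ w ∈ M₁.lang, Good MR.lang M₂.lang w) :
    M₁.rel.cod ⊆ M₂.rel.dom ∧ M₁.rel.comp M₂.rel ⊆ MR.rel := by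
  constructor
  · rintro b ⟨i, hi⟩
    obtain ⟨w, hw, rfl, rfl⟩ := (M₁.mem_rel _ _).1 hi
    obtain ⟨⟨z, rfl, hz⟩, -⟩ := h w hw
    refine ⟨_, (M₂.mem_rel _ _).2 ⟨_, hz, ?_, rfl⟩⟩
    simp [dropLast', Function.comp_def]
  · rintro ⟨i, o⟩ ⟨b, hib, hbo⟩
    obtain ⟨w, hw, rfl, rfl⟩ := (M₁.mem_rel _ _).1 hib
    obtain ⟨w', hw', h1, rfl⟩ := (M₂.mem_rel _ _).1 hbo
    obtain ⟨z, rfl, rfl⟩ := exists_triples w w' h1.symm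
    refine (MR.mem_rel _ _).2 ⟨_, (h _ hw).2 z rfl hw', ?_, ?_⟩ <;>
      simp [dropMid, dropLast', Function.comp_def]

/-- The words accepted through the largest admissible first factor. -/
def Covered (LR : Set (List (I × O))) (L₂ : Set (List (B × O))) (w : List (I × O)) : Prop :=
  ∃ z : List (I × B × O), z.map dropMid = w ∧ Good LR L₂ (z.map dropLast') ∧ z.map Prod.snd ∈ L₂

/-- The words of a composition. -/
theorem mem_comp_iff {u : List I} {v : List O} : (u, v) ∈ M₁.rel.comp M₂.rel ↔
    ∃ z : List (I × B × O), z.map Prod.fst = u ∧ (z.map dropMid).map Prod.snd = v ∧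
      z.map dropLast' ∈ M₁.lang ∧ z.map Prod.snd ∈ M₂.lang := by
  constructor
  · rintro ⟨b, hib, hbo⟩
    obtain ⟨w, hw, rfl, rfl⟩ := (M₁.mem_rel _ _).1 hib
    obtain ⟨w', hw', h1, rfl⟩ := (M₂.mem_rel _ _).1 hbo
    obtain ⟨z, rfl, rfl⟩ := exists_triples w w' h1.symm
    exact ⟨z, by simp [dropLast', Function.comp_def], by simp [dropMid, Function.comp_def], hw, hw'⟩
  · rintro ⟨z, rfl, rfl, h1, h2⟩
    refine ⟨(z.map dropLast').map Prod.snd, (M₁.mem_rel _ _).2 ⟨_, h1, ?_, rfl⟩,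
      (M₂.mem_rel _ _).2 ⟨_, h2, ?_, ?_⟩⟩ <;> simp [dropMid, dropLast', Function.comp_def]

/-- The words of any solution are good, so whatever its composition with `R₂` covers is covered
through the largest factor. If the latter covers all of `R`, then the automaton `M₁` is a solution.
-/
theorem tdCondition_iff (hM : ∀ w, w ∈ M₁.lang ↔ Good MR.lang M₂.lang w) :
    (∃ M : PDFA (I × B), TDCondition MR.rel M.rel M₂.rel) ↔
      ∀ w ∈ MR.lang, Covered MR.lang M₂.lang w := by
  constructor
  · rintro ⟨M, h1, h2⟩ w hw
    have h3 : (w.map Prod.fst, w.map Prod.snd) ∈ M.rel.comp M₂.rel := by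
      rw [h2]
      exact (MR.mem_rel _ _).2 ⟨w, hw, rfl, rfl⟩
    obtain ⟨z, hz1, hz2, hz3, hz4⟩ := mem_comp_iff.1 h3
    refine ⟨z, ?_, good_of_conditions h1 h2.le hz3, hz4⟩
    rw [← zip_fst_snd (l := w), ← hz1, ← hz2]
    conv_lhs => rw [← zip_fst_snd (l := z.map dropMid)]
    simp [dropMid, Function.comp_def]
  · intro h
    obtain ⟨h1, h2⟩ := conditions_of_good fun w hw => (hM w).1 hw
    refine ⟨M₁, h1, h2.antisymm ?_⟩
    rintro ⟨u, v⟩ huv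
    obtain ⟨w, hw, rfl, rfl⟩ := (MR.mem_rel _ _).1 huv
    obtain ⟨z, rfl, hz1, hz2⟩ := h w hw
    exact mem_comp_iff.2 ⟨z, by simp [dropMid, Function.comp_def], rfl, (hM _).2 hz1, hz2⟩

/-- As for the TD condition, except that a word of `R` may be replaced by a covered word with the
same input. The remaining inclusion of domains follows from the inclusion in `R`. -/
theorem pdCondition_iff (hM : ∀ w, w ∈ M₁.lang ↔ Good MR.lang M₂.lang w) :
    (∃ M : PDFA (I × B), PDCondition MR.rel M.rel M₂.rel) ↔
      ∀ w ∈ MR.lang, ∃ w' : List (I × O), w'.map Prod.fst = w.map Prod.fst ∧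
        Covered MR.lang M₂.lang w' := by
  constructor
  · rintro ⟨M, h1, h2, h3⟩ w hw
    have h4 : w.map Prod.fst ∈ (M.rel.comp M₂.rel).dom := by
      rw [h2]
      exact ⟨_, (MR.mem_rel _ _).2 ⟨w, hw, rfl, rfl⟩⟩
    obtain ⟨o, ho⟩ := h4
    obtain ⟨z, hz1, hz2, hz3, hz4⟩ := mem_comp_iff.1 ho
    refine ⟨z.map dropMid, ?_, z, rfl, good_of_conditions h1 h3 hz3, hz4⟩
    rw [← hz1]
    simp [dropMid, Function.comp_def]
  · intro h
    obtain ⟨h1, h2⟩ := conditions_of_good fun w hw => (hM w).1 hw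
    refine ⟨M₁, h1, Set.Subset.antisymm ?_ ?_, h2⟩
    · rintro u ⟨v, hv⟩
      exact ⟨v, h2 hv⟩
    · rintro u ⟨v, hv⟩
      obtain ⟨w, hw, rfl, rfl⟩ := (MR.mem_rel _ _).1 hv
      obtain ⟨w', h3, z, rfl, hz1, hz2⟩ := h w hw
      refine ⟨_, mem_comp_iff.2 ⟨z, ?_, rfl, (hM _).2 hz1, hz2⟩⟩
      rw [← h3]
      simp [dropMid, Function.comp_def]

end Conditions

/-! ## Instances given by numbers -/

/-- A pair of automata given by functions on numbers. State `0` stands for an undefined run, and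
state `p` of an automaton has number `p + 1`. -/
structure CodedInstance where
  nI : ℕ
  nB : ℕ
  nO : ℕ
  sR : ℕ
  s₂ : ℕ
  stR : ℕ
  st₂ : ℕ
  accR : ℕ → Prop
  acc₂ : ℕ → Prop
  dR : ℕ → ℕ → ℕ → ℕ
  d₂ : ℕ → ℕ → ℕ → ℕ

/-- The functions on numbers describe the automaton. -/
structure CodesPDFA {a b : ℕ} (s st : ℕ) (acc : ℕ → Prop) (d : ℕ → ℕ → ℕ → ℕ)
    (M : PDFA (Fin a × Fin b)) : Prop where
  states : s = M.states
  start : st = M.start + 1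
  acc_iff : ∀ p : Option (Fin M.states), acc (codeTarget p) ↔ ∃ q, p = some q ∧ q ∈ M.accept
  step : ∀ (p : Option (Fin M.states)) (x : Fin a) (y : Fin b),
    d (codeTarget p) x y = codeTarget (p.bind fun q => M.step q (x, y))

/-- The numbers describe the instance. -/
structure Codes (c : CodedInstance) (x : HintInstance) : Prop where
  nI : c.nI = x.nI
  nB : c.nB = x.nB
  nO : c.nO = x.nO
  autR : CodesPDFA c.sR c.stR c.accR c.dR x.autR
  aut₂ : CodesPDFA c.s₂ c.st₂ c.acc₂ c.d₂ x.autR₂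

namespace PDFA

variable {a b : ℕ} (M : PDFA (Fin a × Fin b))

/-- The number of the state after a word. -/
def run (w : List (Fin a × Fin b)) : ℕ := codeTarget (w.foldlM M.step M.start)

theorem run_le (w : List (Fin a × Fin b)) : M.run w ≤ M.states := by
  unfold run
  cases w.foldlM M.step M.start with
  | none => simp [codeTarget]
  | some q => simp [codeTarget]

variable {M}

theorem run_nil {s st : ℕ} {acc d} (h : CodesPDFA s st acc d M) : M.run [] = st := by
  rw [h.start]
  rfl

theorem run_append {s st : ℕ} {acc d} (h : CodesPDFA s st acc d M) (w : List (Fin a × Fin b))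
    (l : Fin a × Fin b) : M.run (w ++ [l]) = d (M.run w) l.1 l.2 := by
  unfold run
  rw [h.step, List.foldlM_append]
  simp

theorem acc_run {s st : ℕ} {acc d} (h : CodesPDFA s st acc d M) (w : List (Fin a × Fin b)) :
    acc (M.run w) ↔ w ∈ M.lang := h.acc_iff _

end PDFA

end AutDecomp

namespace AutDecomp

namespace CodedInstance

variable (c : CodedInstance)

/-! ### The automaton of the largest admissible first factor -/

/-- The number of pairs of states. -/
def pairs : ℕ := (c.sR + 1) * (c.s₂ + 1)

/-- The number of a pair of states. -/
def pair (p q : ℕ) : ℕ := p * (c.s₂ + 1) + q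

/-- Transitions between pairs of states with guessed output. -/
def pairStep (i b x y : ℕ) : Prop :=
  ∃ o < c.nO, y = c.pair (c.dR (x / (c.s₂ + 1)) i o) (c.d₂ (x % (c.s₂ + 1)) b o)

/-- Acceptance of a set of pairs. -/
def SetAcc (t : ℕ) : Prop :=
  (∃ x < c.pairs, t.testBit x = true ∧ c.acc₂ (x % (c.s₂ + 1))) ∧
    ∀ x < c.pairs, t.testBit x = true → c.acc₂ (x % (c.s₂ + 1)) → c.accR (x / (c.s₂ + 1))

/-- The set of pairs after a word. -/
noncomputable def setRun {a b : ℕ} (w : List (Fin a × Fin b)) : ℕ :=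
  w.foldl (fun t l => pstep c.pairs (c.pairStep l.1 l.2) t) (2 ^ c.pair c.stR c.st₂)

/-! ### The automaton on sets of states -/

/-- The first number of a copy of the states of the first automaton; smaller numbers stand for
pairs of a set of pairs and a state of the second automaton. `M` is the number of sets. -/
def offset (M : ℕ) : ℕ := M * (c.s₂ + 1)

/-- The number of states. -/
def total (M : ℕ) : ℕ := c.offset M + (c.sR + 1)

/-- Transitions. If `f` holds, then the output letter is guessed as well. -/
def bigStep (M : ℕ) (f : Prop) (i o x y : ℕ) : Prop :=
  ∃ o' < c.nO, (f ∨ o' = o) ∧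
    ((x < c.offset M ∧ ∃ b < c.nB, ∃ t < M,
        (∀ z < c.pairs, t.testBit z = true ↔
          ∃ z' < c.pairs, (x / (c.s₂ + 1)).testBit z' = true ∧ c.pairStep i b z' z) ∧
        y = c.pair t (c.d₂ (x % (c.s₂ + 1)) b o')) ∨
      (c.offset M ≤ x ∧ y = c.offset M + c.dR (x - c.offset M) i o'))

/-- The set of states after a word. -/
noncomputable def bigRun (M : ℕ) (f : Prop) (u : ℕ) {a b : ℕ} (w : List (Fin a × Fin b)) : ℕ :=
  w.foldl (fun t l => pstep (c.total M) (c.bigStep M f l.1 l.2) t) u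

/-- Edges between sets of states. -/
def Edge (M : ℕ) (f : Prop) (u v : ℕ) : Prop :=
  ∃ i < c.nI, ∃ o < c.nO, ∀ y < c.total M, v.testBit y = true ↔
    ∃ x < c.total M, u.testBit x = true ∧ c.bigStep M f i o x y

/-- Initial sets. -/
def Init (M : ℕ) (u : ℕ) : Prop :=
  ∀ y < c.total M, u.testBit y = true ↔ (y = c.offset M + c.stR ∨
    ∃ t < M, (∀ z < c.pairs, t.testBit z = true ↔ z = c.pair c.stR c.st₂) ∧ y = c.pair t c.st₂)

/-- Sets that witness that a word of the relation is not covered. -/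
def Bad (M : ℕ) (v : ℕ) : Prop :=
  (∃ x < c.total M, v.testBit x = true ∧ c.offset M ≤ x ∧ c.accR (x - c.offset M)) ∧
    ∀ x < c.offset M, v.testBit x = true →
      ¬ (c.SetAcc (x / (c.s₂ + 1)) ∧ c.acc₂ (x % (c.s₂ + 1)))

/-- No bad set is reachable; `M` and `D` are the numbers of sets on the two levels, and `S` bounds
the stack of the recursion. -/
def Decision (f : Prop) (M D S : ℕ) : Prop :=
  ∀ u < D, ∀ v < D, c.Init M u → c.Bad M v →
    ¬ ((u < D ∧ v < D ∧ frameBase D ^ c.total M ≤ S) ∧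
      HalvingReach (fun u v => v < D ∧ c.Edge M f u v) D (c.total M) u v)

theorem pair_div {p q : ℕ} (h : q ≤ c.s₂) : c.pair p q / (c.s₂ + 1) = p :=
  mul_add_div_of_lt (by omega)

theorem pair_mod {p q : ℕ} (h : q ≤ c.s₂) : c.pair p q % (c.s₂ + 1) = q :=
  mul_add_mod_of_lt' (by omega)

theorem pair_lt {p q M : ℕ} (hp : p < M) (h : q ≤ c.s₂) : c.pair p q < M * (c.s₂ + 1) :=
  mul_add_lt_mul hp (by omega)

end CodedInstance

/-- Words with the same first components, and the same word unless `f` holds. -/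
def Sim {I O : Type} (f : Prop) (w' w : List (I × O)) : Prop :=
  w'.map Prod.fst = w.map Prod.fst ∧ (f ∨ w' = w)

theorem sim_append_iff {I O : Type} {f : Prop} {w'' w : List (I × O)} {l : I × O} :
    Sim f w'' (w ++ [l]) ↔ ∃ w' o, Sim f w' w ∧ (f ∨ o = l.2) ∧ w'' = w' ++ [(l.1, o)] := by
  constructor
  · rintro ⟨h1, h2⟩
    rw [List.map_append, List.map_eq_append_iff] at h1
    obtain ⟨w', r, rfl, h3, h4⟩ := h1
    obtain ⟨⟨i, o⟩, rfl, h5⟩ := List.map_eq_singleton_iff.1 h4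
    simp only at h5
    subst h5
    refine ⟨w', o, ⟨h3, ?_⟩, ?_, rfl⟩
    · rcases h2 with h2 | h2
      · exact Or.inl h2
      · exact Or.inr (List.append_inj' h2 rfl).1
    · rcases h2 with h2 | h2
      · exact Or.inl h2
      · have := (List.append_inj' h2 rfl).2
        simp only [List.cons.injEq, and_true] at this
        exact Or.inr (by rw [← this])
  · rintro ⟨w', o, ⟨h1, h2⟩, h3, rfl⟩
    refine ⟨by simp [h1], ?_⟩
    by_cases hf : f
    · exact Or.inl hf
    · right
      rw [h2.resolve_left hf, h3.resolve_left hf]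

theorem map_eq_append_singleton {α β : Type} {g : α → β} {z : List α} {w : List β} {l : β}
    (h : z.map g = w ++ [l]) : ∃ z' a, z = z' ++ [a] ∧ z'.map g = w ∧ g a = l := by
  obtain ⟨z', r, rfl, h3, h4⟩ := List.map_eq_append_iff.1 h
  obtain ⟨a, rfl, h5⟩ := List.map_eq_singleton_iff.1 h4
  exact ⟨z', a, rfl, h3, h5⟩

/-! ### Correctness of the two powerset constructions -/

namespace Codes

variable {c : CodedInstance} {x : HintInstance} (h : Codes c x)

include h

theorem runR_lt (w) : x.autR.run w < c.sR + 1 := by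
  rw [h.autR.states]
  exact Nat.lt_succ_of_le (x.autR.run_le w)

theorem run₂_le (w) : x.autR₂.run w ≤ c.s₂ := by
  rw [h.aut₂.states]
  exact x.autR₂.run_le w

theorem stR_lt : c.stR < c.sR + 1 := by
  rw [← x.autR.run_nil h.autR]
  exact h.runR_lt _

theorem st₂_le : c.st₂ ≤ c.s₂ := by
  rw [← x.autR₂.run_nil h.aut₂]
  exact h.run₂_le _

theorem setRun_lt (w : List (Fin x.nI × Fin x.nB)) : c.setRun w < 2 ^ c.pairs := by
  induction w using List.reverseRecOn with
  | nil => exact (Nat.pow_lt_pow_iff_right (by norm_num)).2 (c.pair_lt h.stR_lt h.st₂_le)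
  | append_singleton w l ih =>
    rw [CodedInstance.setRun, List.foldl_append]
    exact pstep_lt _ _ _

/-- The outputs are guessed: the set after `w` collects the pairs of states of all runs on words of
triples above `w`. Both automata read the same guessed output, which is why pairs of states are
needed. -/
theorem testBit_setRun (w : List (Fin x.nI × Fin x.nB)) (y : ℕ) :
    (c.setRun w).testBit y = true ↔ ∃ z : List (Fin x.nI × Fin x.nB × Fin x.nO),
      z.map dropLast' = w ∧
        y = c.pair (x.autR.run (z.map dropMid)) (x.autR₂.run (z.map Prod.snd)) := by
  induction w using List.reverseRecOn generalizing y with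
  | nil =>
    simp only [CodedInstance.setRun, List.foldl_nil, Nat.testBit_two_pow, decide_eq_true_iff,
      List.map_eq_nil_iff, exists_eq_left, List.map_nil, x.autR.run_nil h.autR,
      x.autR₂.run_nil h.aut₂]
    exact eq_comm
  | append_singleton w l ih =>
    have e : c.setRun (w ++ [l]) = pstep c.pairs (c.pairStep l.1 l.2) (c.setRun w) := by
      simp [CodedInstance.setRun]
    rw [e, testBit_pstep]
    constructor
    · rintro ⟨-, x', -, hx', o, ho, rfl⟩
      obtain ⟨z, rfl, rfl⟩ := (ih x').1 hx'
      rw [h.nO] at ho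
      refine ⟨z ++ [(l.1, l.2, ⟨o, ho⟩)], by simp [dropLast'], ?_⟩
      rw [c.pair_div (h.run₂_le _), c.pair_mod (h.run₂_le _), List.map_append, List.map_append]
      simp only [List.map_cons, List.map_nil]
      rw [x.autR.run_append h.autR, x.autR₂.run_append h.aut₂]
      rfl
    · rintro ⟨z, hz, rfl⟩
      obtain ⟨z, a, rfl, rfl, rfl⟩ := map_eq_append_singleton hz
      refine ⟨c.pair_lt (h.runR_lt _) (h.run₂_le _), _, c.pair_lt (h.runR_lt _) (h.run₂_le _),
        (ih _).2 ⟨z, rfl, rfl⟩, a.2.2, by rw [h.nO]; exact a.2.2.isLt, ?_⟩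
      rw [c.pair_div (h.run₂_le _), c.pair_mod (h.run₂_le _), List.map_append, List.map_append]
      simp only [List.map_cons, List.map_nil]
      rw [x.autR.run_append h.autR, x.autR₂.run_append h.aut₂]
      rfl

theorem setAcc_setRun (w : List (Fin x.nI × Fin x.nB)) :
    c.SetAcc (c.setRun w) ↔ Good x.autR.lang x.autR₂.lang w := by
  unfold CodedInstance.SetAcc Good
  apply and_congr
  · constructor
    · rintro ⟨y, -, hy, hacc⟩
      obtain ⟨z, hz, rfl⟩ := (h.testBit_setRun w y).1 hy
      rw [c.pair_mod (h.run₂_le _), x.autR₂.acc_run h.aut₂] at hacc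
      exact ⟨z, hz, hacc⟩
    · rintro ⟨z, hz, hacc⟩
      refine ⟨_, c.pair_lt (h.runR_lt _) (h.run₂_le _), (h.testBit_setRun w _).2 ⟨z, hz, rfl⟩, ?_⟩
      rwa [c.pair_mod (h.run₂_le _), x.autR₂.acc_run h.aut₂]
  · constructor
    · intro hy z hz hacc
      have := hy _ (c.pair_lt (h.runR_lt _) (h.run₂_le _)) ((h.testBit_setRun w _).2 ⟨z, hz, rfl⟩)
      rw [c.pair_mod (h.run₂_le _), c.pair_div (h.run₂_le _), x.autR₂.acc_run h.aut₂,
        x.autR.acc_run h.autR] at this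
      exact this hacc
    · intro hz y _ hy hacc
      obtain ⟨z, hz', rfl⟩ := (h.testBit_setRun w y).1 hy
      rw [c.pair_mod (h.run₂_le _), x.autR₂.acc_run h.aut₂] at hacc
      rw [c.pair_div (h.run₂_le _), x.autR.acc_run h.autR]
      exact hz z hz' hacc

/-- The largest admissible first factor is automatic. -/
theorem exists_good_automaton : ∃ M₁ : PDFA (Fin x.nI × Fin x.nB),
    ∀ w, w ∈ M₁.lang ↔ Good x.autR.lang x.autR₂.lang w := by
  classical
  let M₁ : PDFA (Fin x.nI × Fin x.nB) :=
    { states := 2 ^ c.pairs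
      start := ⟨c.setRun ([] : List (Fin x.nI × Fin x.nB)), h.setRun_lt _⟩
      step := fun t l => some ⟨pstep c.pairs (c.pairStep l.1 l.2) t, pstep_lt _ _ _⟩
      accept := Finset.univ.filter fun t => c.SetAcc t }
  have hrun : ∀ w : List (Fin x.nI × Fin x.nB), w.foldlM M₁.step M₁.start = some ⟨c.setRun w, h.setRun_lt w⟩ := by
    intro w
    induction w using List.reverseRecOn with
    | nil => rfl
    | append_singleton w l ih =>
      rw [List.foldlM_append, ih]
      simp [M₁, CodedInstance.setRun]
  refine ⟨M₁, fun w => ?_⟩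
  rw [← h.setAcc_setRun]
  constructor
  · rintro ⟨q, hq, hacc⟩
    rw [hrun, Option.some.injEq] at hq
    subst hq
    exact (Finset.mem_filter.1 hacc).2
  · intro hacc
    exact ⟨_, hrun w, Finset.mem_filter.2 ⟨Finset.mem_univ _, hacc⟩⟩

theorem pair_setRun_lt (w : List (Fin x.nI × Fin x.nB)) (w') :
    c.pair (c.setRun w) (x.autR₂.run w') < c.offset (2 ^ c.pairs) :=
  c.pair_lt (h.setRun_lt w) (h.run₂_le w')

/-- In `bigStep` the next set `t` is searched for and checked bit by bit, so that the definition
consists of bounded quantifiers. The bits determine `t`, so the search finds nothing but the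
powerset step. -/
theorem bigStep_pair (f : Prop) (i o y : ℕ) (w : List (Fin x.nI × Fin x.nB)) (w') :
    c.bigStep (2 ^ c.pairs) f i o (c.pair (c.setRun w) (x.autR₂.run w')) y ↔
      ∃ o' < c.nO, (f ∨ o' = o) ∧ ∃ b < c.nB,
        y = c.pair (pstep c.pairs (c.pairStep i b) (c.setRun w))
          (c.d₂ (x.autR₂.run w') b o') := by
  unfold CodedInstance.bigStep
  refine exists_congr fun o' => and_congr_right fun _ => and_congr_right fun _ => ?_
  have hlt := h.pair_setRun_lt w w'
  rw [c.pair_div (h.run₂_le _), c.pair_mod (h.run₂_le _)]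
  constructor
  · rintro (⟨-, b, hb, t, ht, h1, rfl⟩ | ⟨h1, -⟩)
    · exact ⟨b, hb, by rw [(eq_pstep_iff ht).2 h1]⟩
    · omega
  · rintro ⟨b, hb, rfl⟩
    exact Or.inl ⟨hlt, b, hb, _, pstep_lt _ _ _, (eq_pstep_iff (pstep_lt _ _ _)).1 rfl, rfl⟩

omit h in
theorem bigStep_offset {M : ℕ} (f : Prop) (i o r y : ℕ) :
    c.bigStep M f i o (c.offset M + r) y ↔
      ∃ o' < c.nO, (f ∨ o' = o) ∧ y = c.offset M + c.dR r i o' := by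
  unfold CodedInstance.bigStep
  refine exists_congr fun o' => and_congr_right fun _ => and_congr_right fun _ => ?_
  constructor
  · rintro (⟨h1, -⟩ | ⟨-, rfl⟩)
    · omega
    · rw [Nat.add_sub_cancel_left]
  · rintro rfl
    exact Or.inr ⟨by omega, by rw [Nat.add_sub_cancel_left]⟩

/-- For each word similar to `w`, the set contains the state of the automaton of `R` in the copy
above the offset and, for each choice of an intermediate word, the set reached by the first factor
together with the state of the second automaton. The first factor is deterministic, so one set per
choice suffices. -/
theorem testBit_bigRun (f : Prop) {u : ℕ} (hu : c.Init (2 ^ c.pairs) u)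
    (w : List (Fin x.nI × Fin x.nO)) (y : ℕ) (hy : y < c.total (2 ^ c.pairs)) :
    (c.bigRun (2 ^ c.pairs) f u w).testBit y = true ↔ ∃ w', Sim f w' w ∧
      (y = c.offset (2 ^ c.pairs) + x.autR.run w' ∨
        ∃ z : List (Fin x.nI × Fin x.nB × Fin x.nO), z.map dropMid = w' ∧
          y = c.pair (c.setRun (z.map dropLast')) (x.autR₂.run (z.map Prod.snd))) := by
  set M := 2 ^ c.pairs with hM
  induction w using List.reverseRecOn generalizing y with
  | nil =>
    have hsim : ∀ w' : List (Fin x.nI × Fin x.nO), Sim f w' [] ↔ w' = [] := fun w' =>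
      ⟨fun h' => by simpa using h'.1, fun h' => by subst h'; exact ⟨rfl, Or.inr rfl⟩⟩
    simp only [hsim, exists_eq_left, x.autR.run_nil h.autR, List.map_eq_nil_iff, List.map_nil,
      x.autR₂.run_nil h.aut₂]
    rw [CodedInstance.bigRun, List.foldl_nil, hu y hy]
    refine or_congr_right ⟨?_, ?_⟩
    · rintro ⟨t, ht, h1, rfl⟩
      congr 1
      refine eq_of_testBit_iff ht (h.setRun_lt _) fun z hz => ?_
      rw [h1 z hz]
      simp only [CodedInstance.setRun, List.foldl_nil, Nat.testBit_two_pow, decide_eq_true_iff]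
      exact eq_comm
    · rintro rfl
      refine ⟨_, h.setRun_lt _, fun z _ => ?_, rfl⟩
      simp only [CodedInstance.setRun, List.foldl_nil, Nat.testBit_two_pow, decide_eq_true_iff]
      exact eq_comm
  | append_singleton w l ih =>
    have e : c.bigRun M f u (w ++ [l]) =
        pstep (c.total M) (c.bigStep M f l.1 l.2) (c.bigRun M f u w) := by
      simp [CodedInstance.bigRun]
    rw [e, testBit_pstep]
    constructor
    · rintro ⟨-, x', hx', hbit, hstep⟩
      obtain ⟨w', hw', rfl | ⟨z, rfl, rfl⟩⟩ := (ih x' hx').1 hbit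
      · obtain ⟨o, ho, hf, rfl⟩ := (bigStep_offset f _ _ _ _).1 hstep
        rw [h.nO] at ho
        refine ⟨w' ++ [(l.1, ⟨o, ho⟩)], sim_append_iff.2 ⟨w', _, hw', ?_, rfl⟩, Or.inl ?_⟩
        · exact hf.imp_right fun hf => Fin.ext hf
        · rw [x.autR.run_append h.autR]
      · obtain ⟨o, ho, hf, b, hb, rfl⟩ := (h.bigStep_pair f _ _ _ _ _).1 hstep
        rw [h.nO] at ho
        rw [h.nB] at hb
        refine ⟨_, sim_append_iff.2 ⟨_, ⟨o, ho⟩, hw', hf.imp_right fun hf => Fin.ext hf, rfl⟩,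
          Or.inr ⟨z ++ [(l.1, ⟨b, hb⟩, ⟨o, ho⟩)], by simp [dropMid], ?_⟩⟩
        rw [List.map_append, List.map_append]
        simp only [List.map_cons, List.map_nil]
        rw [x.autR₂.run_append h.aut₂]
        simp [CodedInstance.setRun, dropLast']
    · rintro ⟨w'', hw'', hy'⟩
      refine ⟨hy, ?_⟩
      obtain ⟨w', o, hw', hf, rfl⟩ := sim_append_iff.1 hw''
      have hf' : f ∨ (o : ℕ) = l.2 := hf.imp_right fun hf => by rw [hf]
      rcases hy' with rfl | ⟨z, hz, rfl⟩
      · have hlt : c.offset M + x.autR.run w' < c.total M := Nat.add_lt_add_left (h.runR_lt _) _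
        refine ⟨_, hlt, (ih _ hlt).2 ⟨w', hw', Or.inl rfl⟩, (bigStep_offset f _ _ _ _).2
          ⟨o, by rw [h.nO]; exact o.isLt, hf', ?_⟩⟩
        rw [x.autR.run_append h.autR]
      · obtain ⟨z, a, rfl, rfl, ha⟩ := map_eq_append_singleton hz
        have hlt := h.pair_setRun_lt (z.map dropLast') (z.map Prod.snd)
        have hlt' : c.pair (c.setRun (z.map dropLast')) (x.autR₂.run (z.map Prod.snd)) <
          c.total M := hlt.trans_le (Nat.le_add_right _ _)
        refine ⟨_, hlt', (ih _ hlt').2 ⟨_, hw', Or.inr ⟨z, rfl, rfl⟩⟩,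
          (h.bigStep_pair f _ _ _ _ _).2 ⟨o, by rw [h.nO]; exact o.isLt, hf', a.2.1,
            by rw [h.nB]; exact a.2.1.isLt, ?_⟩⟩
        rw [List.map_append, List.map_append]
        simp only [List.map_cons, List.map_nil]
        rw [x.autR₂.run_append h.aut₂]
        simp only [dropMid, Prod.mk.injEq] at ha
        simp [CodedInstance.setRun, dropLast', ha.1, ha.2]

/-- The two clauses of `Bad` concern the two parts of the state space: some similar word is accepted
in the copy of the automaton of `R`, while no state of the composition is accepting. -/
theorem bad_bigRun (f : Prop) {u : ℕ} (hu : c.Init (2 ^ c.pairs) u)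
    (w : List (Fin x.nI × Fin x.nO)) :
    c.Bad (2 ^ c.pairs) (c.bigRun (2 ^ c.pairs) f u w) ↔
      (∃ w', Sim f w' w ∧ w' ∈ x.autR.lang) ∧
        ¬ ∃ w', Sim f w' w ∧ Covered x.autR.lang x.autR₂.lang w' := by
  unfold CodedInstance.Bad
  apply and_congr
  · constructor
    · rintro ⟨y, hy, hbit, hge, hacc⟩
      obtain ⟨w', hw', rfl | ⟨z, rfl, rfl⟩⟩ := (h.testBit_bigRun f hu w y hy).1 hbit
      · rw [Nat.add_sub_cancel_left, x.autR.acc_run h.autR] at hacc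
        exact ⟨w', hw', hacc⟩
      · have := h.pair_setRun_lt (z.map dropLast') (z.map Prod.snd)
        omega
    · rintro ⟨w', hw', hacc⟩
      have hlt : c.offset (2 ^ c.pairs) + x.autR.run w' < c.total (2 ^ c.pairs) :=
        Nat.add_lt_add_left (h.runR_lt _) _
      refine ⟨_, hlt, (h.testBit_bigRun f hu w _ hlt).2 ⟨w', hw', Or.inl rfl⟩, by omega, ?_⟩
      rwa [Nat.add_sub_cancel_left, x.autR.acc_run h.autR]
  · constructor
    · rintro hno ⟨_, hw', z, rfl, hgood, hz⟩
      have hlt := h.pair_setRun_lt (z.map dropLast') (z.map Prod.snd)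
      refine hno _ hlt ((h.testBit_bigRun f hu w _ (hlt.trans_le (Nat.le_add_right _ _))).2
        ⟨_, hw', Or.inr ⟨z, rfl, rfl⟩⟩) ?_
      rw [c.pair_div (h.run₂_le _), c.pair_mod (h.run₂_le _), h.setAcc_setRun,
        x.autR₂.acc_run h.aut₂]
      exact ⟨hgood, hz⟩
    · rintro hno y hy hbit ⟨h1, h2⟩
      obtain ⟨w', hw', rfl | ⟨z, rfl, rfl⟩⟩ :=
        (h.testBit_bigRun f hu w y (hy.trans_le (Nat.le_add_right _ _))).1 hbit
      · omega
      · rw [c.pair_div (h.run₂_le _), h.setAcc_setRun] at h1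
        rw [c.pair_mod (h.run₂_le _), x.autR₂.acc_run h.aut₂] at h2
        exact hno ⟨_, hw', z, rfl, h1, h2⟩

theorem edge_iff (f : Prop) {M u v : ℕ} (hv : v < 2 ^ c.total M) :
    c.Edge M f u v ↔ ∃ l : Fin x.nI × Fin x.nO,
      v = pstep (c.total M) (c.bigStep M f l.1 l.2) u := by
  unfold CodedInstance.Edge
  constructor
  · rintro ⟨i, hi, o, ho, h1⟩
    rw [h.nI] at hi
    rw [h.nO] at ho
    exact ⟨(⟨i, hi⟩, ⟨o, ho⟩), (eq_pstep_iff hv).2 h1⟩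
  · rintro ⟨l, hl⟩
    exact ⟨l.1, by rw [h.nI]; exact l.1.isLt, l.2, by rw [h.nO]; exact l.2.isLt,
      (eq_pstep_iff hv).1 hl⟩

/-- Each edge reads one letter, and the bound on its target makes that target the successor set
exactly; paths are thus the runs on words. -/
theorem reflTransGen_edge_iff (f : Prop) {M u v : ℕ} :
    Relation.ReflTransGen (fun u v => v < 2 ^ c.total M ∧ c.Edge M f u v) u v ↔
      ∃ w : List (Fin x.nI × Fin x.nO), v = c.bigRun M f u w := by
  constructor
  · intro hp
    induction hp with
    | refl => exact ⟨[], rfl⟩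
    | tail _ h2 ih =>
      obtain ⟨w, rfl⟩ := ih
      obtain ⟨l, rfl⟩ := (h.edge_iff f h2.1).1 h2.2
      exact ⟨w ++ [l], by simp [CodedInstance.bigRun]⟩
  · rintro ⟨w, rfl⟩
    induction w using List.reverseRecOn with
    | nil => exact .refl
    | append_singleton w l ih =>
      refine ih.tail ?_
      have e : c.bigRun M f u (w ++ [l]) =
          pstep (c.total M) (c.bigStep M f l.1 l.2) (c.bigRun M f u w) := by
        simp [CodedInstance.bigRun]
      rw [e]
      exact ⟨pstep_lt _ _ _, (h.edge_iff f (pstep_lt _ _ _)).2 ⟨l, rfl⟩⟩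

omit h in
theorem bigRun_lt {M u : ℕ} (f : Prop) (hu : u < 2 ^ c.total M) {a b : ℕ}
    (w : List (Fin a × Fin b)) : c.bigRun M f u w < 2 ^ c.total M := by
  induction w using List.reverseRecOn with
  | nil => exact hu
  | append_singleton w l ih =>
    rw [CodedInstance.bigRun, List.foldl_append]
    exact pstep_lt _ _ _

omit h in
theorem exists_init (c : CodedInstance) (M : ℕ) : ∃ u < 2 ^ c.total M, c.Init M u := by
  -- `pstep` serves to form the set of all `y` with a given property: the relation ignores its
  -- source, and the mask `1` supplies the source `0`.
  refine ⟨pstep (c.total M) (fun _ y => y = c.offset M + c.stR ∨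
    ∃ t < M, (∀ z < c.pairs, t.testBit z = true ↔ z = c.pair c.stR c.st₂) ∧ y = c.pair t c.st₂) 1,
    pstep_lt _ _ _, fun y hy => ?_⟩
  rw [testBit_pstep]
  constructor
  · rintro ⟨-, _, -, -, h⟩
    exact h
  · intro h
    exact ⟨hy, 0, by omega, by simp, h⟩

/-- All sets are masks below `2 ^ T` with `T` states, so `T` halvings decide reachability, and the
hypothesis on `S` makes the guard of the recursion true. It does not matter which initial mask is
considered, and one exists. -/
theorem decision_iff (f : Prop) {S : ℕ}
    (hS : frameBase (2 ^ c.total (2 ^ c.pairs)) ^ c.total (2 ^ c.pairs) ≤ S) :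
    c.Decision f (2 ^ c.pairs) (2 ^ c.total (2 ^ c.pairs)) S ↔
      ∀ w, (∃ w', Sim f w' w ∧ w' ∈ x.autR.lang) →
        ∃ w', Sim f w' w ∧ Covered x.autR.lang x.autR₂.lang w' := by
  have key : ∀ u < 2 ^ c.total (2 ^ c.pairs), ∀ v,
      HalvingReach (fun u v => v < 2 ^ c.total (2 ^ c.pairs) ∧ c.Edge (2 ^ c.pairs) f u v)
        (2 ^ c.total (2 ^ c.pairs)) (c.total (2 ^ c.pairs)) u v ↔
      ∃ w : List (Fin x.nI × Fin x.nO), v = c.bigRun (2 ^ c.pairs) f u w := fun u hu v => by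
    rw [halvingReach_iff (fun u v h => h.1) hu le_rfl, h.reflTransGen_edge_iff]
  unfold CodedInstance.Decision
  constructor
  · intro hd w hw
    by_contra hno
    obtain ⟨u, hu, hinit⟩ := exists_init c (2 ^ c.pairs)
    have hv := bigRun_lt f hu w
    exact hd u hu _ hv hinit ((h.bad_bigRun f hinit w).2 ⟨hw, hno⟩)
      ⟨⟨hu, hv, hS⟩, (key u hu _).2 ⟨w, rfl⟩⟩
  · rintro hall u hu v hv hinit hbad ⟨-, hreach⟩
    obtain ⟨w, rfl⟩ := (key u hu v).1 hreach
    obtain ⟨h1, h2⟩ := (h.bad_bigRun f hinit w).1 hbad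
    exact h2 (hall w h1)

theorem decision_tdp {S : ℕ}
    (hS : frameBase (2 ^ c.total (2 ^ c.pairs)) ^ c.total (2 ^ c.pairs) ≤ S) :
    c.Decision False (2 ^ c.pairs) (2 ^ c.total (2 ^ c.pairs)) S ↔ x.TDP := by
  obtain ⟨M₁, hM⟩ := h.exists_good_automaton
  rw [h.decision_iff False hS]
  refine Iff.trans ?_ (tdCondition_iff hM).symm
  have hsim : ∀ w' w : List (Fin x.nI × Fin x.nO), Sim False w' w ↔ w' = w := fun w' w =>
    ⟨fun h' => h'.2.resolve_left id, fun h' => by subst h'; exact ⟨rfl, Or.inr rfl⟩⟩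
  simp only [hsim, exists_eq_left]

theorem decision_pdp {S : ℕ}
    (hS : frameBase (2 ^ c.total (2 ^ c.pairs)) ^ c.total (2 ^ c.pairs) ≤ S) :
    c.Decision True (2 ^ c.pairs) (2 ^ c.total (2 ^ c.pairs)) S ↔ x.PDP := by
  obtain ⟨M₁, hM⟩ := h.exists_good_automaton
  rw [h.decision_iff True hS]
  refine Iff.trans ?_ (pdCondition_iff hM).symm
  simp only [Sim, true_or, and_true]
  constructor
  · intro hall w hw
    exact hall w ⟨w, rfl, hw⟩
  · rintro hall w ⟨w', h1, hw'⟩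
    obtain ⟨w'', h2, h3⟩ := hall w' hw'
    exact ⟨w'', h2.trans h1, h3⟩

end Codes

end AutDecomp

namespace AutDecomp

/-! ## Reading instances off numbers -/

theorem bval_div_two_pow (l : List Bool) (i : ℕ) : bval l / 2 ^ i = bval (l.drop i) := by
  induction i generalizing l with
  | zero => simp
  | succ i ih =>
    cases l with
    | nil => simp [bval]
    | cons b l =>
      rw [List.drop_succ_cons, ← ih, pow_succ', ← Nat.div_div_eq_div_mul]
      congr 1
      cases b <;> simp [bval]; omega

theorem testBit_bval (l : List Bool) (i : ℕ) : (bval l).testBit i = true ↔ l[i]? = some true := by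
  rw [Nat.testBit_eq_decide_div_mod_eq, decide_eq_true_iff, bval_div_two_pow, ← List.head?_drop]
  cases l.drop i with
  | nil => simp [bval]
  | cons b l => cases b <;> simp [bval]

theorem wcode_eq (w : List Bool) : wcode w = bval (w.reverse ++ [true]) := by
  rw [bval_reverse_append]
  rfl

theorem bval_append_true_pos (l : List Bool) : 0 < bval (l ++ [true]) := by
  induction l with
  | nil => simp [bval]
  | cons b l ih => simp [bval]; omega

theorem bval_append_true_lt (l : List Bool) : l.length < bval (l ++ [true]) := by
  induction l with
  | nil => simp [bval]
  | cons b l ih => simp [bval]; omega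

/-- The length of the word with code `W`. -/
def wlen (W : ℕ) : ℕ := Nat.count (fun j => 0 < W / 2 ^ (j + 1)) W

/-- The word with code `W` has the letter `true` at position `j`. -/
def Letter (W j : ℕ) : Prop := W.testBit (wlen W - 1 - j) = true

instance (W : ℕ) : DecidablePred (Letter W) := fun _ => inferInstanceAs (Decidable (_ = _))

/-- The number of letters `false` before position `j`. -/
def zeros (W j : ℕ) : ℕ := Nat.count (fun i => ¬ Letter W i) j

/-- Entry `k` of the list of numbers with unary code `W`. -/
def item (W k : ℕ) : ℕ := Nat.count (fun j => Letter W j ∧ zeros W j = k) (wlen W)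

theorem count_eq_of_iff {p : ℕ → Prop} [DecidablePred p] {n m : ℕ} (h : n ≤ m)
    (hp : ∀ j, p j ↔ j < n) : Nat.count p m = n := by
  obtain ⟨d, rfl⟩ := Nat.exists_eq_add_of_le h
  rw [Nat.count_add, Nat.count_iff_forall.2 fun j hj => (hp j).2 hj,
    Nat.count_iff_forall_not.2 fun j _ hj => by have := (hp _).1 hj; omega]
  rfl

theorem count_congr {p q : ℕ → Prop} [DecidablePred p] [DecidablePred q] {n : ℕ}
    (h : ∀ j < n, p j ↔ q j) : Nat.count p n = Nat.count q n := by
  refine le_antisymm ?_ ?_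
  · exact Nat.count_mono_left fun k hk => (h k hk).1
  · exact Nat.count_mono_left fun k hk => (h k hk).2

theorem wlen_wcode (w : List Bool) : wlen (wcode w) = w.length := by
  refine count_eq_of_iff ?_ fun j => ?_
  · rw [wcode_eq]
    have := bval_append_true_lt w.reverse
    simp at this
    omega
  · rw [wcode_eq, bval_div_two_pow]
    by_cases hj : j < w.length
    · rw [List.drop_append_of_le_length (by simp; omega)]
      simp [hj, bval_append_true_pos]
    · rw [List.drop_eq_nil_of_le (by simp; omega)]
      simp [bval, hj]

theorem letter_wcode (w : List Bool) {j : ℕ} (hj : j < w.length) :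
    Letter (wcode w) j ↔ w[j]? = some true := by
  rw [Letter, wlen_wcode, wcode_eq, testBit_bval, List.getElem?_append_left (by simp; omega),
    List.getElem?_reverse (by omega), show w.length - 1 - (w.length - 1 - j) = j by omega]

theorem zeros_wcode (w : List Bool) {j : ℕ} (hj : j ≤ w.length) :
    zeros (wcode w) j = Nat.count (fun i => w[i]? = some false) j := by
  refine count_congr fun i hi => ?_
  rw [letter_wcode w (by omega), List.getElem?_eq_getElem (by omega)]
  simp

theorem item_wcode (w : List Bool) (k : ℕ) : item (wcode w) k =
    Nat.count (fun j => w[j]? = some true ∧ Nat.count (fun i => w[i]? = some false) j = k)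
      w.length := by
  rw [item, wlen_wcode]
  refine count_congr fun i hi => ?_
  rw [letter_wcode w hi, zeros_wcode w hi.le]

theorem count_false_replicate (x : ℕ) (w : List Bool) {j : ℕ} (hj : j ≤ x) :
    Nat.count (fun i => (List.replicate x true ++ false :: w)[i]? = some false) j = 0 := by
  refine Nat.count_iff_forall_not.2 fun i hi => ?_
  rw [List.getElem?_append_left (by simp; omega), List.getElem?_replicate]
  simp [show i < x by omega]

theorem count_false_shift (x : ℕ) (w : List Bool) (j : ℕ) :
    Nat.count (fun i => (List.replicate x true ++ false :: w)[i]? = some false) (x + 1 + j) =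
      Nat.count (fun i => w[i]? = some false) j + 1 := by
  rw [Nat.count_add, Nat.count_succ, count_false_replicate x w le_rfl]
  simp only [List.getElem?_append_right, List.length_replicate, le_refl, Nat.sub_self,
    List.getElem?_cons_zero, if_true, zero_add]
  rw [add_comm]
  congr 1
  refine count_congr fun i _ => ?_
  rw [List.getElem?_append_right (by simp; omega), List.length_replicate,
    show x + 1 + i - x = i + 1 by omega, List.getElem?_cons_succ]

/-- Every entry ends with exactly one zero. The zeros therefore give the number of entries, which
`ValidCode` compares with the expected length. -/
theorem zeros_unary (l : List ℕ) : zeros (wcode (unary l)) (unary l).length = l.length := by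
  rw [zeros_wcode _ le_rfl]
  induction l with
  | nil => rfl
  | cons x l ih =>
    rw [unary_cons]
    have e : (List.replicate x true ++ false :: unary l).length = x + 1 + (unary l).length := by
      simp; omega
    rw [e, count_false_shift, ih]
    rfl

/-- Entry `k` consists of the ones that are preceded by exactly `k` zeros. In the induction the
first block adds one zero to all later counts and contributes ones to entry `0` only. Positions
after the end of the list give `0`. -/
theorem item_unary (l : List ℕ) (k : ℕ) : item (wcode (unary l)) k = l.getD k 0 := by
  rw [item_wcode]
  induction l generalizing k with
  | nil => simp [unary]
  | cons x l ih =>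
    rw [unary_cons]
    have e : (List.replicate x true ++ false :: unary l).length = x + 1 + (unary l).length := by
      simp; omega
    rw [e, Nat.count_add]
    have e2 : ∀ j, (List.replicate x true ++ false :: unary l)[x + 1 + j]? = (unary l)[j]? := by
      intro j
      rw [List.getElem?_append_right (by simp; omega), List.length_replicate,
        show x + 1 + j - x = j + 1 by omega, List.getElem?_cons_succ]
    simp only [e2, count_false_shift]
    rw [Nat.count_succ]
    have e3 : (List.replicate x true ++ false :: unary l)[x]? = some false := by
      rw [List.getElem?_append_right (by simp)]
      simp
    rw [e3]
    have e4 : ∀ j < x, (List.replicate x true ++ false :: unary l)[j]? = some true := by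
      intro j hj
      rw [List.getElem?_append_left (by simp; omega), List.getElem?_replicate]
      simp [hj]
    cases k with
    | zero =>
      rw [Nat.count_iff_forall.2 fun j hj => ⟨e4 j hj, count_false_replicate x _ hj.le⟩]
      simp
    | succ k =>
      rw [Nat.count_iff_forall_not.2 fun j hj h => by
        rw [count_false_replicate x _ hj.le] at h; omega]
      simp only [Nat.add_right_cancel_iff, List.getD_cons_succ]
      rw [← ih]
      simp

/-- Every word is a unary code followed by some ones. Bit `0` of the code is the last letter, so the
hypothesis excludes trailing ones. It excludes the empty word too, where this bit is the leading
one, but codes of instances are not empty. -/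
theorem exists_unary (w : List Bool) (h : (wcode w).testBit 0 = false) : ∃ l, unary l = w := by
  have key : ∀ w : List Bool, ∃ l x, w = unary l ++ List.replicate x true := by
    intro w
    induction w using List.reverseRecOn with
    | nil => exact ⟨[], 0, rfl⟩
    | append_singleton w b ih =>
      obtain ⟨l, x, rfl⟩ := ih
      cases b
      · exact ⟨l ++ [x], 0, by simp [unary]⟩
      · exact ⟨l, x + 1, by simp [List.replicate_succ']⟩
  obtain ⟨l, x, rfl⟩ := key w
  cases x with
  | zero => exact ⟨l, by simp⟩
  | succ x =>
    exfalso
    have h2 : ¬ (wcode (unary l ++ List.replicate (x + 1) true)).testBit 0 = true := by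
      rw [h]; simp
    rw [wcode_eq, testBit_bval] at h2
    rw [List.reverse_append, List.reverse_replicate, List.replicate_succ] at h2
    exact h2 rfl

theorem testBit_zero_unary (x : ℕ) (l : List ℕ) :
    (wcode (unary (x :: l))).testBit 0 = false := by
  obtain ⟨l', y, h⟩ : ∃ l' y, x :: l = l' ++ [y] :=
    ⟨(x :: l).dropLast, (x :: l).getLast (by simp), (List.dropLast_append_getLast _).symm⟩
  rw [← Bool.not_eq_true, h, wcode_eq, testBit_bval]
  simp [unary]

/-! ### Codes of automata inside a sequence of numbers -/

theorem getElem?_flatMap_finRange {β : Type} {n c : ℕ} (f : Fin n → List β)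
    (hf : ∀ q, (f q).length = c) (q : Fin n) {j : ℕ} (hj : j < c) :
    ((List.finRange n).flatMap f)[(q : ℕ) * c + j]? = (f q)[j]? := by
  induction n with
  | zero => exact q.elim0
  | succ n ih =>
    rw [List.finRange_succ, List.flatMap_cons]
    refine Fin.cases ?_ (fun q => ?_) q
    · rw [List.getElem?_append_left (by simp [hf, hj])]
      simp
    · rw [List.getElem?_append_right (by rw [hf]; simp [Nat.succ_mul]; omega), List.flatMap_map, hf,
        ← ih (fun q => f q.succ) (fun q => hf _) q]
      congr 1
      simp [Nat.succ_mul]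
      omega

namespace PDFA

variable {a b : ℕ} (M : PDFA (Fin a × Fin b))

theorem code_zero : M.code[0]? = some M.states := rfl

theorem code_one : M.code[1]? = some (M.start : ℕ) := rfl

theorem code_accept (q : Fin M.states) :
    M.code[2 + (q : ℕ)]? = some (if q ∈ M.accept then 1 else 0) := by
  rw [code, List.append_assoc, List.getElem?_append_right (by simp),
    List.getElem?_append_left (by simp)]
  simp

theorem code_step (q : Fin M.states) (x : Fin a) (y : Fin b) :
    M.code[2 + M.states + ((q : ℕ) * (a * b) + ((x : ℕ) * b + y))]? =
      some (codeTarget (M.step q (x, y))) := by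
  have h1 : (x : ℕ) * b + y < a * b := mul_add_lt_mul x.isLt y.isLt
  rw [code, List.getElem?_append_right (by simp; omega)]
  have e : 2 + M.states + ((q : ℕ) * (a * b) + ((x : ℕ) * b + y)) -
      ([M.states, (M.start : ℕ)] ++
        List.map (fun q => if q ∈ M.accept then 1 else 0) (List.finRange M.states)).length =
      (q : ℕ) * (a * b) + ((x : ℕ) * b + y) := by
    simp; omega
  rw [e, getElem?_flatMap_finRange _ (c := a * b) (by simp) q h1,
    getElem?_flatMap_finRange _ (c := b) (by simp) x y.isLt]
  simp

end PDFA

/-- The length of the code of an automaton. -/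
def codeLen (s na nb : ℕ) : ℕ := 2 + s + s * (na * nb)

/-- The sequence `g` contains the code of an automaton from position `base` on. -/
def ValidAt (g : ℕ → ℕ) (base na nb : ℕ) : Prop :=
  g (base + 1) < g base ∧ (∀ q < g base, g (base + 2 + q) < 2) ∧
    ∀ j < g base * (na * nb), g (base + 2 + g base + j) < g base + 1

/-- Acceptance, read off the code of an automaton. -/
def accAt (g : ℕ → ℕ) (base p : ℕ) : Prop := p ≠ 0 ∧ g (base + 2 + (p - 1)) = 1

/-- Transitions, read off the code of an automaton. -/
def stepAt (g : ℕ → ℕ) (base na nb p x y : ℕ) : ℕ :=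
  if p = 0 then 0 else g (base + 2 + g base + ((p - 1) * (na * nb) + (x * nb + y)))

/-! ### Automata read off a sequence of numbers -/

section At

variable {g : ℕ → ℕ} {base a b : ℕ}

theorem exists_eq_table_index {s j : ℕ} (hj : j < s * (a * b)) :
    ∃ (q : Fin s) (x : Fin a) (y : Fin b), j = (q : ℕ) * (a * b) + ((x : ℕ) * b + y) := by
  have hab : 0 < a * b := Nat.pos_of_ne_zero fun h => by simp [h] at hj
  have hb : 0 < b := Nat.pos_of_mul_pos_left hab
  refine ⟨⟨j / (a * b), Nat.div_lt_of_lt_mul (by rwa [mul_comm])⟩,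
    ⟨j % (a * b) / b, Nat.div_lt_of_lt_mul (by rw [mul_comm b a]; exact Nat.mod_lt _ hab)⟩,
    ⟨j % (a * b) % b, Nat.mod_lt _ hb⟩, ?_⟩
  rw [Nat.div_add_mod', Nat.div_add_mod']

theorem valid_of_code {M : PDFA (Fin a × Fin b)}
    (h : ∀ j y, M.code[j]? = some y → g (base + j) = y) :
    g base = M.states ∧ ValidAt g base a b ∧
      CodesPDFA (g base) (g (base + 1) + 1) (accAt g base) (stepAt g base a b) M := by
  have h0 : g base = M.states := h 0 _ M.code_zero
  have h1 : g (base + 1) = M.start := h 1 _ M.code_one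
  have h2 : ∀ q : Fin M.states, g (base + 2 + q) = if q ∈ M.accept then 1 else 0 := fun q => by
    rw [add_assoc]; exact h _ _ (M.code_accept q)
  have h3 : ∀ (q : Fin M.states) (x : Fin a) (y : Fin b),
      g (base + 2 + M.states + ((q : ℕ) * (a * b) + ((x : ℕ) * b + y))) =
        codeTarget (M.step q (x, y)) := fun q x y => by
    rw [add_assoc base, add_assoc base]; exact h _ _ (M.code_step q x y)
  refine ⟨h0, ⟨?_, ?_, ?_⟩, h0, by rw [h1], ?_, ?_⟩
  · rw [h0, h1]; exact M.start.isLt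
  · intro q hq
    rw [h0] at hq
    have := h2 ⟨q, hq⟩
    simp only at this
    rw [this]
    split_ifs <;> omega
  · intro j hj
    rw [h0] at hj ⊢
    obtain ⟨q, x, y, rfl⟩ := exists_eq_table_index hj
    rw [h3]
    cases M.step q (x, y) with
    | none => simp [codeTarget]
    | some p => simp [codeTarget]
  · intro p
    cases p with
    | none => simp [accAt, codeTarget]
    | some q =>
      simp only [accAt, codeTarget, Nat.add_sub_cancel, h2]
      simp
  · intro p x y
    cases p with
    | none => simp [stepAt, codeTarget]
    | some q =>
      simp only [stepAt, codeTarget, Nat.add_sub_cancel, h0, h3]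
      simp

/-- The conditions in `ValidAt` put the initial state and the targets into range and make the
acceptance entries bits. This suffices to build an automaton whose code is the given stretch of the
sequence. -/
theorem exists_of_validAt (h : ValidAt g base a b) : ∃ M : PDFA (Fin a × Fin b),
    M.states = g base ∧ ∀ j < codeLen (g base) a b, M.code[j]? = some (g (base + j)) := by
  obtain ⟨h1, h2, h3⟩ := h
  have hidx : ∀ (q : Fin (g base)) (l : Fin a × Fin b),
      (q : ℕ) * (a * b) + ((l.1 : ℕ) * b + l.2) < g base * (a * b) := fun q l =>
    mul_add_lt_mul q.isLt (mul_add_lt_mul l.1.isLt l.2.isLt)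
  let M : PDFA (Fin a × Fin b) :=
    { states := g base
      start := ⟨g (base + 1), h1⟩
      step := fun q l =>
        if h : g (base + 2 + g base + ((q : ℕ) * (a * b) + ((l.1 : ℕ) * b + l.2))) = 0 then none
        else some ⟨g (base + 2 + g base + ((q : ℕ) * (a * b) + ((l.1 : ℕ) * b + l.2))) - 1, by
          have := h3 _ (hidx q l)
          omega⟩
      accept := Finset.univ.filter fun q => g (base + 2 + q) = 1 }
  refine ⟨M, rfl, fun j hj => ?_⟩
  obtain rfl | rfl | ⟨q, hq, rfl⟩ | ⟨j, hj', rfl⟩ : j = 0 ∨ j = 1 ∨ (∃ q < g base, j = 2 + q) ∨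
      ∃ j' < g base * (a * b), j = 2 + g base + j' := by
    unfold codeLen at hj
    rcases Nat.lt_or_ge j 2 with h | h
    · omega
    · right; right
      rcases Nat.lt_or_ge j (2 + g base) with h' | h'
      · exact Or.inl ⟨j - 2, by omega, by omega⟩
      · exact Or.inr ⟨j - (2 + g base), by omega, by omega⟩
  · exact M.code_zero
  · exact M.code_one
  · have := M.code_accept ⟨q, hq⟩
    simp only at this
    rw [this, Option.some.injEq, ← add_assoc]
    have h4 := h2 q hq
    simp only [M, Finset.mem_filter, Finset.mem_univ, true_and]
    split_ifs <;> omega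
  · obtain ⟨q, x, y, rfl⟩ := exists_eq_table_index hj'
    refine (M.code_step q x y).trans ?_
    rw [Option.some.injEq, ← add_assoc base, ← add_assoc base]
    simp only [M]
    split_ifs with h0
    · rw [h0]; rfl
    · simp only [codeTarget]
      omega

end At

/-! ### Codes of instances -/

/-- The position of the second automaton. -/
def base₂ (g : ℕ → ℕ) : ℕ := 3 + codeLen (g 3) (g 0) (g 2)

/-- The instance given by a sequence of numbers. -/
def instOf (g : ℕ → ℕ) : CodedInstance where
  nI := g 0
  nB := g 1
  nO := g 2
  sR := g 3
  s₂ := g (base₂ g)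
  stR := g 4 + 1
  st₂ := g (base₂ g + 1) + 1
  accR := accAt g 3
  acc₂ := accAt g (base₂ g)
  dR := stepAt g 3 (g 0) (g 2)
  d₂ := stepAt g (base₂ g) (g 1) (g 2)

/-- The number `W` is the code of an instance. -/
def ValidCode (W : ℕ) : Prop :=
  ¬ W.testBit 0 = true ∧ ValidAt (item W) 3 (item W 0) (item W 2) ∧
    ValidAt (item W) (base₂ (item W)) (item W 1) (item W 2) ∧
    zeros W (wlen W) = base₂ (item W) +
      codeLen (item W (base₂ (item W))) (item W 1) (item W 2)

theorem validCode_encode (x : HintInstance) : ValidCode (wcode x.encode) ∧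
    Codes (instOf (item (wcode x.encode))) x := by
  set l := [x.nI, x.nB, x.nO] ++ x.autR.code ++ x.autR₂.code with hl
  have he : x.encode = unary l := rfl
  have hg : ∀ k, item (wcode x.encode) k = l.getD k 0 := fun k => by rw [he, item_unary]
  set g := item (wcode x.encode) with hgdef
  have g0 : g 0 = x.nI := hg 0
  have g1 : g 1 = x.nB := hg 1
  have g2 : g 2 = x.nO := hg 2
  have hR : ∀ j y, x.autR.code[j]? = some y → g (3 + j) = y := by
    intro j y hy
    have hj : j < x.autR.code.length := (List.getElem?_eq_some_iff.1 hy).1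
    rw [hg, List.getD_eq_getElem?_getD, hl, List.append_assoc,
      List.getElem?_append_right (by simp), List.getElem?_append_left (by simpa using hj)]
    simp [hy]
  obtain ⟨r1, r2, r3⟩ := valid_of_code hR
  have hb : base₂ g = 3 + x.autR.code.length := by
    rw [base₂, r1, g0, g2, x.autR.code_length]
    rfl
  have h₂ : ∀ j y, x.autR₂.code[j]? = some y → g (base₂ g + j) = y := by
    intro j y hy
    rw [hg, List.getD_eq_getElem?_getD, hl, List.getElem?_append_right (by simp [hb]; omega), hb]
    simp only [List.length_append, List.length_cons, List.length_nil, zero_add, Nat.reduceAdd,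
      Nat.add_sub_cancel_left, hy, Option.getD_some]
  obtain ⟨s1, s2, s3⟩ := valid_of_code h₂
  refine ⟨⟨?_, ?_, ?_, ?_⟩, g0, g1, g2, ?_, ?_⟩
  · rw [he, hl, List.append_assoc, List.cons_append, testBit_zero_unary]
    simp
  · rw [← hgdef, g0, g2]; exact r2
  · rw [← hgdef, g1, g2]; exact s2
  · rw [← hgdef, wlen_wcode]
    have : zeros (wcode x.encode) x.encode.length = l.length := zeros_unary l
    rw [this, s1, hb, g1, g2, hl]
    simp only [List.length_append, x.autR₂.code_length, codeLen]
    rfl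
  · have : (instOf g).dR = stepAt g 3 x.nI x.nO := by rw [← g0, ← g2]; rfl
    rw [this]
    exact r3
  · have : (instOf g).d₂ = stepAt g (base₂ g) x.nB x.nO := by rw [← g1, ← g2]; rfl
    rw [this]
    exact s3

/-- Entries after the end of the list read as `0`, so agreement of entries alone does not exclude
truncated codes or codes with a remainder. The condition on the number of zeros fixes the length of
the list. -/
theorem exists_encode_of_validCode {w : List Bool} (h : ValidCode (wcode w)) :
    ∃ x : HintInstance, x.encode = w := by
  obtain ⟨h0, hR, h₂, hlen⟩ := h
  obtain ⟨l, rfl⟩ := exists_unary w (by simpa using h0)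
  rw [wlen_wcode, zeros_unary] at hlen
  have hg : ∀ k, item (wcode (unary l)) k = l.getD k 0 := item_unary l
  set g := item (wcode (unary l)) with hgdef
  obtain ⟨MR, r1, r2⟩ := exists_of_validAt hR
  obtain ⟨M₂, s1, s2⟩ := exists_of_validAt h₂
  have hcR : MR.code.length = codeLen (g 3) (g 0) (g 2) := by rw [MR.code_length, r1]; rfl
  have hc₂ : M₂.code.length = codeLen (g (base₂ g)) (g 1) (g 2) := by rw [M₂.code_length, s1]; rfl
  refine ⟨⟨g 0, g 1, g 2, MR, M₂⟩, ?_⟩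
  unfold HintInstance.encode
  congr 1
  refine List.ext_getElem? fun j => ?_
  have hL : ∀ j < l.length, l[j]? = some (g j) := fun j hj => by
    rw [hg, List.getD_eq_getElem?_getD, List.getElem?_eq_getElem hj]
    rfl
  simp only
  by_cases hj : j < l.length
  · rw [hL j hj]
    rcases Nat.lt_or_ge j 3 with h3 | h3
    · rw [List.append_assoc, List.getElem?_append_left (by simpa using h3)]
      interval_cases j <;> rfl
    · rcases Nat.lt_or_ge j (base₂ g) with h4 | h4
      · unfold base₂ at h4
        rw [List.getElem?_append_left (by simp [hcR]; omega),
          List.getElem?_append_right (by simpa using h3)]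
        have := r2 (j - 3) (by omega)
        rw [show 3 + (j - 3) = j by omega] at this
        exact this
      · have hb : ([g 0, g 1, g 2] ++ MR.code).length = base₂ g := by
          simp only [List.length_append, hcR]
          rfl
        rw [List.getElem?_append_right (by rw [hb]; exact h4), hb]
        have := s2 (j - base₂ g) (by omega)
        rw [show base₂ g + (j - base₂ g) = j by omega] at this
        exact this
  · refine (List.getElem?_eq_none ?_).trans (List.getElem?_eq_none (by omega)).symm
    simp only [List.length_append, hcR, hc₂, List.length_cons, List.length_nil]
    unfold base₂ at hlen ⊢
    omega

end AutDecomp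

namespace AutDecomp

/-! ## The decision is in linear space -/

section Lift

variable {n : ℕ}

/-- For use under a bounded quantifier, whose variable becomes variable `0` and shifts all others by
one. -/
theorem LS.lift {f : (Fin n → ℕ) → ℕ} (hf : LS f) :
    LS fun w : Fin (n + 1) → ℕ => f fun i => w i.succ :=
  LS.comp hf fun i => LS.var i.succ

end Lift

variable {n : ℕ} {W j k base na nb p x y i o b z t M u v B : (Fin n → ℕ) → ℕ}

theorem LS.wlen (hW : LS W) : LS fun v => wlen (W v) :=
  LSP.count (p := fun j v => 0 < W v / 2 ^ (j + 1))
    (LSP.lt (LS.const 0) (LS.div_two_pow hW.lift (LS.var 0).succ)) hW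

theorem LSP.letter (hW : LS W) (hj : LS j) : LSP fun v => Letter (W v) (j v) :=
  LSP.testBit hW (LS.sub (LS.wlen hW).pred hj)

theorem LS.zeros (hW : LS W) (hj : LS j) : LS fun v => zeros (W v) (j v) :=
  LSP.count (p := fun i v => ¬ Letter (W v) i) (LSP.letter hW.lift (LS.var 0)).not hj

theorem LS.item (hW : LS W) (hk : LS k) : LS fun v => item (W v) (k v) :=
  LSP.count (p := fun j v => Letter (W v) j ∧ AutDecomp.zeros (W v) j = k v)
    ((LSP.letter hW.lift (LS.var 0)).and (LSP.eq (LS.zeros hW.lift (LS.var 0)) hk.lift))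
    (LS.wlen hW)

theorem LS.codeLen (hk : LS k) (ha : LS na) (hb : LS nb) :
    LS fun v => codeLen (k v) (na v) (nb v) :=
  ((LS.const 2).add hk).add (hk.mul (ha.mul hb))

theorem LSP.validAt (hW : LS W) (hbase : LS base) (ha : LS na) (hb : LS nb) :
    LSP fun v => ValidAt (AutDecomp.item (W v)) (base v) (na v) (nb v) :=
  (LSP.lt (LS.item hW hbase.succ) (LS.item hW hbase)).and
    ((LSP.forall_lt (p := fun q v => AutDecomp.item (W v) (base v + 2 + q) < 2)
      (LS.item hW hbase)
      (LSP.lt (LS.item hW.lift ((hbase.lift.add (LS.const 2)).add (LS.var 0))) (LS.const 2))).and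
    (LSP.forall_lt (p := fun j v => AutDecomp.item (W v)
        (base v + 2 + AutDecomp.item (W v) (base v) + j) < AutDecomp.item (W v) (base v) + 1)
      ((LS.item hW hbase).mul (ha.mul hb))
      (LSP.lt (LS.item hW.lift (((hbase.lift.add (LS.const 2)).add
        (LS.item hW.lift hbase.lift)).add (LS.var 0))) (LS.item hW.lift hbase.lift).succ)))

theorem LSP.accAt (hW : LS W) (hbase : LS base) (hp : LS p) :
    LSP fun v => accAt (AutDecomp.item (W v)) (base v) (p v) :=
  (LSP.ne hp (LS.const 0)).and
    (LSP.eq (LS.item hW ((hbase.add (LS.const 2)).add hp.pred)) (LS.const 1))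

theorem LS.stepAt (hW : LS W) (hbase : LS base) (ha : LS na) (hb : LS nb) (hp : LS p) (hx : LS x)
    (hy : LS y) : LS fun v =>
      stepAt (AutDecomp.item (W v)) (base v) (na v) (nb v) (p v) (x v) (y v) :=
  LS.ite (LSP.eq hp (LS.const 0)) (LS.const 0)
    (LS.item hW (((hbase.add (LS.const 2)).add (LS.item hW hbase)).add
      ((hp.pred.mul (ha.mul hb)).add ((hx.mul hb).add hy))))

theorem LS.base₂ (hW : LS W) : LS fun v => base₂ (AutDecomp.item (W v)) :=
  (LS.const 3).add (LS.codeLen (LS.item hW (LS.const 3)) (LS.item hW (LS.const 0))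
    (LS.item hW (LS.const 2)))

/-- The instance with code `W`. -/
def inst (W : ℕ) : CodedInstance := instOf (AutDecomp.item W)

theorem LSP.validCode (hW : LS W) : LSP fun v => ValidCode (W v) :=
  (LSP.testBit hW (LS.const 0)).not.and
    ((LSP.validAt hW (LS.const 3) (LS.item hW (LS.const 0)) (LS.item hW (LS.const 2))).and
    ((LSP.validAt hW (LS.base₂ hW) (LS.item hW (LS.const 1)) (LS.item hW (LS.const 2))).and
    (LSP.eq (LS.zeros hW (LS.wlen hW)) ((LS.base₂ hW).add (LS.codeLen (LS.item hW (LS.base₂ hW))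
      (LS.item hW (LS.const 1)) (LS.item hW (LS.const 2)))))))

theorem LS.nI (hW : LS W) : LS fun v => (inst (W v)).nI := LS.item hW (LS.const 0)

theorem LS.nB (hW : LS W) : LS fun v => (inst (W v)).nB := LS.item hW (LS.const 1)

theorem LS.nO (hW : LS W) : LS fun v => (inst (W v)).nO := LS.item hW (LS.const 2)

theorem LS.sR (hW : LS W) : LS fun v => (inst (W v)).sR := LS.item hW (LS.const 3)

theorem LS.s₂ (hW : LS W) : LS fun v => (inst (W v)).s₂ := LS.item hW (LS.base₂ hW)

theorem LS.stR (hW : LS W) : LS fun v => (inst (W v)).stR := (LS.item hW (LS.const 4)).succ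

theorem LS.st₂ (hW : LS W) : LS fun v => (inst (W v)).st₂ := (LS.item hW (LS.base₂ hW).succ).succ

theorem LSP.accR (hW : LS W) (hp : LS p) : LSP fun v => (inst (W v)).accR (p v) :=
  LSP.accAt hW (LS.const 3) hp

theorem LSP.acc₂ (hW : LS W) (hp : LS p) : LSP fun v => (inst (W v)).acc₂ (p v) :=
  LSP.accAt hW (LS.base₂ hW) hp

theorem LS.dR (hW : LS W) (hp : LS p) (hx : LS x) (hy : LS y) :
    LS fun v => (inst (W v)).dR (p v) (x v) (y v) :=
  LS.stepAt hW (LS.const 3) (LS.item hW (LS.const 0)) (LS.item hW (LS.const 2)) hp hx hy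

theorem LS.d₂ (hW : LS W) (hp : LS p) (hx : LS x) (hy : LS y) :
    LS fun v => (inst (W v)).d₂ (p v) (x v) (y v) :=
  LS.stepAt hW (LS.base₂ hW) (LS.item hW (LS.const 1)) (LS.item hW (LS.const 2)) hp hx hy

theorem LS.pairs (hW : LS W) : LS fun v => (inst (W v)).pairs :=
  (LS.sR hW).succ.mul (LS.s₂ hW).succ

theorem LS.pair (hW : LS W) (hx : LS x) (hy : LS y) : LS fun v => (inst (W v)).pair (x v) (y v) :=
  (hx.mul (LS.s₂ hW).succ).add hy

theorem LSP.pairStep (hW : LS W) (hi : LS i) (hb : LS b) (hx : LS x) (hy : LS y) :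
    LSP fun v => (inst (W v)).pairStep (i v) (b v) (x v) (y v) :=
  LSP.exists_lt (p := fun o v => y v = (inst (W v)).pair
      ((inst (W v)).dR (x v / ((inst (W v)).s₂ + 1)) (i v) o)
      ((inst (W v)).d₂ (x v % ((inst (W v)).s₂ + 1)) (b v) o))
    (LS.nO hW)
    (LSP.eq hy.lift (LS.pair hW.lift
      (LS.dR hW.lift (hx.lift.div (LS.s₂ hW.lift).succ) hi.lift (LS.var 0))
      (LS.d₂ hW.lift (hx.lift.mod (LS.s₂ hW.lift).succ) hb.lift (LS.var 0))))

theorem LSP.setAcc (hW : LS W) (ht : LS t) : LSP fun v => (inst (W v)).SetAcc (t v) :=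
  LSP.and
    (LSP.exists_lt (p := fun x v => (t v).testBit x = true ∧
        (inst (W v)).acc₂ (x % ((inst (W v)).s₂ + 1))) (LS.pairs hW)
      ((LSP.testBit ht.lift (LS.var 0)).and
        (LSP.acc₂ hW.lift ((LS.var 0).mod (LS.s₂ hW.lift).succ))))
    (LSP.forall_lt (p := fun x v => (t v).testBit x = true →
        (inst (W v)).acc₂ (x % ((inst (W v)).s₂ + 1)) →
        (inst (W v)).accR (x / ((inst (W v)).s₂ + 1))) (LS.pairs hW)
      ((LSP.testBit ht.lift (LS.var 0)).imp
        ((LSP.acc₂ hW.lift ((LS.var 0).mod (LS.s₂ hW.lift).succ)).imp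
        (LSP.accR hW.lift ((LS.var 0).div (LS.s₂ hW.lift).succ)))))

theorem LS.offset (hW : LS W) (hM : LS M) : LS fun v => (inst (W v)).offset (M v) :=
  hM.mul (LS.s₂ hW).succ

theorem LS.total (hW : LS W) (hM : LS M) : LS fun v => (inst (W v)).total (M v) :=
  (LS.offset hW hM).add (LS.sR hW).succ

theorem LSP.setSucc (hW : LS W) (hi : LS i) (hb : LS b) (hx : LS x) (ht : LS t) :
    LSP fun v => ∀ z < (inst (W v)).pairs, (t v).testBit z = true ↔
      ∃ z' < (inst (W v)).pairs, (x v).testBit z' = true ∧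
        (inst (W v)).pairStep (i v) (b v) z' z :=
  LSP.forall_lt (p := fun z v => (t v).testBit z = true ↔
      ∃ z' < (inst (W v)).pairs, (x v).testBit z' = true ∧
        (inst (W v)).pairStep (i v) (b v) z' z) (LS.pairs hW)
    ((LSP.testBit ht.lift (LS.var 0)).iff
      (LSP.exists_lt (p := fun z' (w : Fin (n + 1) → ℕ) =>
          (x fun i => w i.succ).testBit z' = true ∧
          (inst (W fun i => w i.succ)).pairStep (i fun i => w i.succ) (b fun i => w i.succ) z'
            (w 0)) (LS.pairs hW.lift)
        ((LSP.testBit hx.lift.lift (LS.var 0)).and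
          (LSP.pairStep hW.lift.lift hi.lift.lift hb.lift.lift (LS.var 0) (LS.var 1)))))

theorem LSP.bigStep (f : Prop) (hW : LS W) (hM : LS M) (hi : LS i) (ho : LS o) (hx : LS x)
    (hy : LS y) : LSP fun v => (inst (W v)).bigStep (M v) f (i v) (o v) (x v) (y v) := by
  have hx' : LS fun v => x v / ((inst (W v)).s₂ + 1) := hx.div (LS.s₂ hW).succ
  have hx'' : LS fun v => x v % ((inst (W v)).s₂ + 1) := hx.mod (LS.s₂ hW).succ
  refine LSP.exists_lt (p := fun o' v => (f ∨ o' = o v) ∧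
    ((x v < (inst (W v)).offset (M v) ∧ ∃ b < (inst (W v)).nB, ∃ t < M v,
        (∀ z < (inst (W v)).pairs, t.testBit z = true ↔
          ∃ z' < (inst (W v)).pairs, (x v / ((inst (W v)).s₂ + 1)).testBit z' = true ∧
            (inst (W v)).pairStep (i v) b z' z) ∧
        y v = (inst (W v)).pair t ((inst (W v)).d₂ (x v % ((inst (W v)).s₂ + 1)) b o')) ∨
      ((inst (W v)).offset (M v) ≤ x v ∧
        y v = (inst (W v)).offset (M v) +
          (inst (W v)).dR (x v - (inst (W v)).offset (M v)) (i v) o'))) (LS.nO hW) ?_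
  refine ((LSP.const f).or (LSP.eq (LS.var 0) ho.lift)).and (LSP.or
    ((LSP.lt hx.lift (LS.offset hW.lift hM.lift)).and ?_)
    ((LSP.le (LS.offset hW.lift hM.lift) hx.lift).and (LSP.eq hy.lift
      ((LS.offset hW.lift hM.lift).add (LS.dR hW.lift (hx.lift.sub (LS.offset hW.lift hM.lift))
        hi.lift (LS.var 0))))))
  refine LSP.exists_lt (p := fun b (v : Fin (n + 1) → ℕ) => ∃ t < M fun i => v i.succ,
        (∀ z < (inst (W fun i => v i.succ)).pairs, t.testBit z = true ↔
          ∃ z' < (inst (W fun i => v i.succ)).pairs,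
            ((x fun i => v i.succ) / ((inst (W fun i => v i.succ)).s₂ + 1)).testBit z' = true ∧
            (inst (W fun i => v i.succ)).pairStep (i fun i => v i.succ) b z' z) ∧
        (y fun i => v i.succ) = (inst (W fun i => v i.succ)).pair t
          ((inst (W fun i => v i.succ)).d₂
            ((x fun i => v i.succ) % ((inst (W fun i => v i.succ)).s₂ + 1)) b (v 0)))
    (LS.nB hW.lift) ?_
  refine LSP.exists_lt (p := fun t (v : Fin (n + 1 + 1) → ℕ) =>
        (∀ z < (inst (W fun i => v i.succ.succ)).pairs, t.testBit z = true ↔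
          ∃ z' < (inst (W fun i => v i.succ.succ)).pairs,
            ((x fun i => v i.succ.succ) /
              ((inst (W fun i => v i.succ.succ)).s₂ + 1)).testBit z' = true ∧
            (inst (W fun i => v i.succ.succ)).pairStep (i fun i => v i.succ.succ) (v 0) z' z) ∧
        (y fun i => v i.succ.succ) = (inst (W fun i => v i.succ.succ)).pair t
          ((inst (W fun i => v i.succ.succ)).d₂
            ((x fun i => v i.succ.succ) % ((inst (W fun i => v i.succ.succ)).s₂ + 1)) (v 0) (v 1)))
    hM.lift.lift ?_
  -- Under the three quantifiers, variables `0`, `1` and `2` are `t`, `b` and `o'`.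
  exact (LSP.setSucc hW.lift.lift.lift hi.lift.lift.lift (LS.var 1) hx'.lift.lift.lift
    (LS.var 0)).and (LSP.eq hy.lift.lift.lift (LS.pair hW.lift.lift.lift (LS.var 0)
      (LS.d₂ hW.lift.lift.lift hx''.lift.lift.lift (LS.var 1) (LS.var 2))))

theorem LSP.edge (f : Prop) (hW : LS W) (hM : LS M) (hx : LS x) (hy : LS y) :
    LSP fun v => (inst (W v)).Edge (M v) f (x v) (y v) := by
  refine LSP.exists_lt (p := fun i w => ∃ o < (inst (W w)).nO, ∀ z < (inst (W w)).total (M w),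
      (y w).testBit z = true ↔ ∃ z' < (inst (W w)).total (M w), (x w).testBit z' = true ∧
        (inst (W w)).bigStep (M w) f i o z' z) (LS.nI hW) ?_
  refine LSP.exists_lt (p := fun o (w : Fin (n + 1) → ℕ) =>
      ∀ z < (inst (W fun i => w i.succ)).total (M fun i => w i.succ),
      (y fun i => w i.succ).testBit z = true ↔
        ∃ z' < (inst (W fun i => w i.succ)).total (M fun i => w i.succ),
          (x fun i => w i.succ).testBit z' = true ∧
          (inst (W fun i => w i.succ)).bigStep (M fun i => w i.succ) f (w 0) o z' z)
    (LS.nO hW.lift) ?_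
  refine LSP.forall_lt (p := fun z (w : Fin (n + 1 + 1) → ℕ) =>
      (y fun i => w i.succ.succ).testBit z = true ↔
        ∃ z' < (inst (W fun i => w i.succ.succ)).total (M fun i => w i.succ.succ),
          (x fun i => w i.succ.succ).testBit z' = true ∧
          (inst (W fun i => w i.succ.succ)).bigStep (M fun i => w i.succ.succ) f (w 1) (w 0) z' z)
    (LS.total hW.lift.lift hM.lift.lift) ?_
  refine (LSP.testBit hy.lift.lift.lift (LS.var 0)).iff
    (LSP.exists_lt (p := fun z' (w : Fin (n + 1 + 1 + 1) → ℕ) =>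
          (x fun i => w i.succ.succ.succ).testBit z' = true ∧
          (inst (W fun i => w i.succ.succ.succ)).bigStep (M fun i => w i.succ.succ.succ) f
            (w 2) (w 1) z' (w 0))
      (LS.total hW.lift.lift.lift hM.lift.lift.lift) ?_)
  -- Under the four quantifiers, variables `0` to `3` are `z'`, `z`, `o` and `i`.
  exact (LSP.testBit hx.lift.lift.lift.lift (LS.var 0)).and (LSP.bigStep f hW.lift.lift.lift.lift
    hM.lift.lift.lift.lift (LS.var 3) (LS.var 2) (LS.var 0) (LS.var 1))

theorem LSP.initial (hW : LS W) (hM : LS M) (hx : LS x) :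
    LSP fun v => (inst (W v)).Init (M v) (x v) := by
  refine LSP.forall_lt (p := fun y v => (x v).testBit y = true ↔
    (y = (inst (W v)).offset (M v) + (inst (W v)).stR ∨
    ∃ t < M v, (∀ z < (inst (W v)).pairs, t.testBit z = true ↔
      z = (inst (W v)).pair (inst (W v)).stR (inst (W v)).st₂) ∧
      y = (inst (W v)).pair t (inst (W v)).st₂)) (LS.total hW hM) ?_
  refine (LSP.testBit hx.lift (LS.var 0)).iff ((LSP.eq (LS.var 0)
    ((LS.offset hW.lift hM.lift).add (LS.stR hW.lift))).or
    (LSP.exists_lt (p := fun t (v : Fin (n + 1) → ℕ) =>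
      (∀ z < (inst (W fun i => v i.succ)).pairs, t.testBit z = true ↔
      z = (inst (W fun i => v i.succ)).pair (inst (W fun i => v i.succ)).stR
        (inst (W fun i => v i.succ)).st₂) ∧
      v 0 = (inst (W fun i => v i.succ)).pair t (inst (W fun i => v i.succ)).st₂) hM.lift
    (LSP.and ?_ (LSP.eq (LS.var 1) (LS.pair hW.lift.lift (LS.var 0) (LS.st₂ hW.lift.lift))))))
  refine LSP.forall_lt (p := fun z (v : Fin (n + 1 + 1) → ℕ) => (v 0).testBit z = true ↔
      z = (inst (W fun i => v i.succ.succ)).pair (inst (W fun i => v i.succ.succ)).stR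
        (inst (W fun i => v i.succ.succ)).st₂) (LS.pairs hW.lift.lift) ?_
  exact (LSP.testBit (LS.var 1) (LS.var 0)).iff (LSP.eq (LS.var 0) (LS.pair hW.lift.lift.lift
    (LS.stR hW.lift.lift.lift) (LS.st₂ hW.lift.lift.lift)))

theorem LSP.bad (hW : LS W) (hM : LS M) (hx : LS x) :
    LSP fun v => (inst (W v)).Bad (M v) (x v) := by
  refine LSP.and (LSP.exists_lt (p := fun y v => (x v).testBit y = true ∧
      (inst (W v)).offset (M v) ≤ y ∧ (inst (W v)).accR (y - (inst (W v)).offset (M v)))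
    (LS.total hW hM) ?_) (LSP.forall_lt (p := fun y v => (x v).testBit y = true →
      ¬ ((inst (W v)).SetAcc (y / ((inst (W v)).s₂ + 1)) ∧
        (inst (W v)).acc₂ (y % ((inst (W v)).s₂ + 1)))) (LS.offset hW hM) ?_)
  · exact (LSP.testBit hx.lift (LS.var 0)).and ((LSP.le (LS.offset hW.lift hM.lift)
      (LS.var 0)).and (LSP.accR hW.lift ((LS.var 0).sub (LS.offset hW.lift hM.lift))))
  · exact (LSP.testBit hx.lift (LS.var 0)).imp
      ((LSP.setAcc hW.lift ((LS.var 0).div (LS.s₂ hW.lift).succ)).and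
      (LSP.acc₂ hW.lift ((LS.var 0).mod (LS.s₂ hW.lift).succ))).not

/-- The number of sets of pairs of states, cut off at `B`. -/
def setBound (W B : ℕ) : ℕ := min (2 ^ (inst W).pairs) B

/-- The number of sets of states of the automaton on sets of pairs, cut off at `B`. -/
def bigSetBound (W B : ℕ) : ℕ := min (2 ^ (inst W).total (setBound W B)) B

theorem LS.setBound (hW : LS W) (hB : LS B) : LS fun v => setBound (W v) (B v) :=
  LS.min_pow (LS.const 2) (LS.pairs hW) hB

theorem LS.bigSetBound (hW : LS W) (hB : LS B) : LS fun v => bigSetBound (W v) (B v) :=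
  LS.min_pow (LS.const 2) (LS.total hW (LS.setBound hW hB)) hB

/-- `W` is the code of an instance that has the property decided by `f`. -/
def Accepts (f : Prop) (W B : ℕ) : Prop :=
  ValidCode W ∧ (inst W).Decision f (setBound W B) (bigSetBound W B) B

/-- The quantities `2 ^ pairs` and `2 ^ total` are not polynomial in the code `W`. Cut off at the
additional argument `B` they are, and so is the stack of the recursion, whose guard compares it with
`B`. -/
theorem LSP.accepts (f : Prop) : LSP fun w : Fin 2 → ℕ => Accepts f (w 0) (w 1) := by
  refine (LSP.validCode (LS.var 0)).and ?_
  have hW : ∀ {k} {i : Fin k}, LS fun w : Fin k → ℕ => w i := LS.var _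
  refine LSP.forall_lt (p := fun u (w : Fin 2 → ℕ) => ∀ v < AutDecomp.bigSetBound (w 0) (w 1),
    (inst (w 0)).Init (AutDecomp.setBound (w 0) (w 1)) u →
      (inst (w 0)).Bad (AutDecomp.setBound (w 0) (w 1)) v →
    ¬ ((u < AutDecomp.bigSetBound (w 0) (w 1) ∧ v < AutDecomp.bigSetBound (w 0) (w 1) ∧
        AutDecomp.frameBase (AutDecomp.bigSetBound (w 0) (w 1)) ^
          (inst (w 0)).total (AutDecomp.setBound (w 0) (w 1)) ≤ w 1) ∧
      HalvingReach (fun u v => v < AutDecomp.bigSetBound (w 0) (w 1) ∧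
        (inst (w 0)).Edge (AutDecomp.setBound (w 0) (w 1)) f u v)
        (AutDecomp.bigSetBound (w 0) (w 1))
        ((inst (w 0)).total (AutDecomp.setBound (w 0) (w 1))) u v))
    (LS.bigSetBound (LS.var 0) (LS.var 1)) ?_
  refine LSP.forall_lt (p := fun v (w : Fin 3 → ℕ) =>
    (inst (w 1)).Init (AutDecomp.setBound (w 1) (w 2)) (w 0) →
      (inst (w 1)).Bad (AutDecomp.setBound (w 1) (w 2)) v →
    ¬ ((w 0 < AutDecomp.bigSetBound (w 1) (w 2) ∧ v < AutDecomp.bigSetBound (w 1) (w 2) ∧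
        AutDecomp.frameBase (AutDecomp.bigSetBound (w 1) (w 2)) ^
          (inst (w 1)).total (AutDecomp.setBound (w 1) (w 2)) ≤ w 2) ∧
      HalvingReach (fun u v => v < AutDecomp.bigSetBound (w 1) (w 2) ∧
        (inst (w 1)).Edge (AutDecomp.setBound (w 1) (w 2)) f u v)
        (AutDecomp.bigSetBound (w 1) (w 2))
        ((inst (w 1)).total (AutDecomp.setBound (w 1) (w 2))) (w 0) v))
    (LS.bigSetBound (LS.var 1) (LS.var 2)) ?_
  have hM : LS fun w : Fin 4 → ℕ => AutDecomp.setBound (w 2) (w 3) :=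
    LS.setBound (LS.var 2) (LS.var 3)
  have he := LSP.halvingReach (e := fun u v W B => v < AutDecomp.bigSetBound W B ∧
    (inst W).Edge (AutDecomp.setBound W B) f u v)
    ((LSP.lt (LS.var 1) (LS.bigSetBound (LS.var 2) (LS.var 3))).and
      (LSP.edge f (LS.var 2) hM (LS.var 0) (LS.var 1)))
  -- Variables `0` to `3` are `v`, `u`, `W` and `B`. The number `B` is passed twice: as the bound
  -- for the stack and as a parameter of the edge relation.
  have hG := LSP.comp he (n := 4) (G := ![fun w => w 1, fun w => w 0,
      fun w => AutDecomp.bigSetBound (w 2) (w 3),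
      fun w => (inst (w 2)).total (AutDecomp.setBound (w 2) (w 3)),
      fun w => w 3, fun w => w 2, fun w => w 3]) (by
    intro j
    fin_cases j
    · exact LS.var 1
    · exact LS.var 0
    · exact LS.bigSetBound (LS.var 2) (LS.var 3)
    · exact LS.total (LS.var 2) hM
    · exact LS.var 3
    · exact LS.var 2
    · exact LS.var 3)
  exact (LSP.initial (LS.var 2) hM (LS.var 1)).imp ((LSP.bad (LS.var 2) hM (LS.var 0)).imp hG.not)

end AutDecomp

namespace AutDecomp

/-! ## Exponential space -/

/-- Exponentiation is not in `LS`, because its result is too large. Repeated doubling still keeps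
the registers polynomial in the result, which is all that is needed to produce `B` once. -/
theorem Comp.two_pow : ∃ c : ℕ, Comp (fun v : Fin 1 → ℕ => 2 ^ v 0) (fun v => (2 ^ v 0 + 2) ^ c) := by
  have hI : ∀ j : Fin 2, LS ((![fun v => v 0, fun _ => 1] : Fin 2 → (Fin 1 → ℕ) → ℕ) j) := by
    intro j
    fin_cases j
    · exact LS.var 0
    · exact LS.const 1
  have hG : ∀ j : Fin 2, LS ((![fun u => u 0 - 1, fun u => u 1 + u 1] :
      Fin 2 → (Fin 2 → ℕ) → ℕ) j) := by
    intro j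
    fin_cases j
    · exact (LS.var 0).pred
    · exact (LS.var 1).add (LS.var 1)
  choose bI cI hI hcI using hI
  choose bG cG hG hcG using hG
  have hiter : ∀ (v : Fin 1 → ℕ) (t : ℕ), (fun u j => (![fun u => u 0 - 1, fun u => u 1 + u 1] :
      Fin 2 → (Fin 2 → ℕ) → ℕ) j u)^[t] (fun j => (![fun v => v 0, fun _ => 1] :
      Fin 2 → (Fin 1 → ℕ) → ℕ) j v) = ![v 0 - t, 2 ^ t] := by
    intro v t
    induction t with
    | zero => funext j; fin_cases j <;> rfl
    | succ t ih =>
      rw [Function.iterate_succ_apply', ih]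
      funext j
      fin_cases j
      · simp; omega
      · simp [pow_succ]; omega
  refine ⟨Finset.univ.sup cI + Finset.univ.sup cG,
    Comp.while hI hG 0 1 (fun v j => ?_) fun v => ⟨v 0, ?_, ?_, fun t ht => ⟨?_, fun j => ?_⟩⟩⟩
  · refine (hcI j v (2 ^ v 0) fun i => ?_).2.trans (pow_le_pow_of_le ?_)
    · rw [Fin.fin_one_eq_zero i]; exact Nat.lt_two_pow_self.le
    · exact (Finset.le_sup (f := cI) (Finset.mem_univ j)).trans (Nat.le_add_right _ _)
  · rw [hiter]; simp
  · rw [hiter]; simp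
  · rw [hiter]; simp; omega
  · rw [hiter]
    refine (hcG j _ (2 ^ v 0) fun i => ?_).2.trans (pow_le_pow_of_le ?_)
    · have := Nat.lt_two_pow_self (n := v 0)
      fin_cases i
      · simp; omega
      · exact Nat.pow_le_pow_right (by norm_num) ht.le
    · exact (Finset.le_sup (f := cG) (Finset.mem_univ j)).trans (Nat.le_add_left _ _)

/-- A function in linear space, applied to a doubly exponential argument. -/
theorem LS.comp_two_pow_two_pow {F : ℕ → ℕ → ℕ} (hF : LS fun w : Fin 2 → ℕ => F (w 0) (w 1))
    {P : ℕ → ℕ} (hP : LS fun w : Fin 1 → ℕ => P (w 0)) :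
    ∃ c : ℕ, Comp (fun w : Fin 1 → ℕ => F (w 0) (2 ^ 2 ^ P (w 0)))
      (fun w => (2 ^ 2 ^ P (w 0) + w 0 + 2) ^ c) := by
  obtain ⟨c₁, h₁⟩ := Comp.two_pow
  obtain ⟨bF, cF, hF, hcF⟩ := hF
  obtain ⟨bP, cP, hP, hcP⟩ := hP
  have hlt : ∀ w : ℕ, 2 ^ P w ≤ 2 ^ 2 ^ P w := fun w => Nat.lt_two_pow_self.le
  have hbP : ∀ w : Fin 1 → ℕ, bP w ≤ (2 ^ 2 ^ P (w 0) + w 0 + 2) ^ cP := fun w => by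
    refine (hcP w (w 0) fun i => by rw [Fin.fin_one_eq_zero i]).2.trans
      (Nat.pow_le_pow_left (Nat.add_le_add_right (Nat.le_add_left _ _) 2) _)
  have t₁ : Comp (fun w : Fin 1 → ℕ => 2 ^ P (w 0))
      (fun w => (2 ^ 2 ^ P (w 0) + w 0 + 2) ^ max c₁ cP) := by
    refine Comp.comp h₁ (G := fun _ w => P (w 0)) (fun _ => hP) fun w => ⟨?_, fun _ => ?_⟩
    · refine (Nat.pow_le_pow_left ?_ _).trans (pow_le_pow_of_le (le_max_left _ _))
      exact Nat.add_le_add_right ((hlt (w 0)).trans (Nat.le_add_right _ _)) 2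
    · exact (hbP w).trans (pow_le_pow_of_le (le_max_right _ _))
  have t₂ : Comp (fun w : Fin 1 → ℕ => 2 ^ 2 ^ P (w 0))
      (fun w => (2 ^ 2 ^ P (w 0) + w 0 + 2) ^ max c₁ cP) := by
    refine Comp.comp h₁ (G := fun _ w => 2 ^ P (w 0)) (fun _ => t₁) fun w => ⟨?_, fun _ => le_rfl⟩
    exact (Nat.pow_le_pow_left (Nat.add_le_add_right (Nat.le_add_right _ _) 2) _).trans (pow_le_pow_of_le (le_max_left _ _))
  refine ⟨max cF (max c₁ cP), ?_⟩
  have := Comp.comp (n := 1) hF (G := ![fun w => w 0, fun w => 2 ^ 2 ^ P (w 0)])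
    (bG := ![fun _ => 0, fun w => (2 ^ 2 ^ P (w 0) + w 0 + 2) ^ max c₁ cP])
    (b := fun w => (2 ^ 2 ^ P (w 0) + w 0 + 2) ^ max cF (max c₁ cP)) (fun j => by
      fin_cases j
      · exact Comp.var 0
      · exact t₂) fun w => ⟨?_, fun j => ?_⟩
  · exact this
  · refine (hcF _ (2 ^ 2 ^ P (w 0) + w 0) fun i => ?_).2.trans (pow_le_pow_of_le (le_max_left _ _))
    fin_cases i
    · exact Nat.le_add_left _ _
    · exact Nat.le_add_right _ _
  · fin_cases j
    · exact Nat.zero_le _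
    · exact pow_le_pow_of_le (le_max_right _ _)

theorem wcode_lt (w : List Bool) : wcode w < 2 ^ (w.length + 1) := by
  induction w using List.reverseRecOn with
  | nil => simp [wcode]
  | append_singleton w b ih =>
    have e : wcode (w ++ [b]) = b.toNat + 2 * wcode w := by simp [wcode]
    rw [e, List.length_append, List.length_singleton, pow_succ]
    have := Bool.toNat_le b
    omega

/-- Because numbers are written in unary, all of them, in particular the numbers of states, are at
most the length of the word. -/
theorem item_le (W k : ℕ) : item W k ≤ wlen W := Nat.count_le _

/-- With `T` for the number of states of the nondeterministic automaton, one frame has base `2 ^ (3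
* T + 1)`, so the stack is bounded by `2 ^ ((3 * T + 1) * T)`. Here `T ≤ 2 ^ ((n + 1) ^ 2 + n + 2)`,
and squaring this and multiplying by `4` stays below `2 ^ (2 * (n + 4) ^ 2)`. -/
theorem CodedInstance.frameBase_pow_le (c : CodedInstance) {n : ℕ} (h1 : c.sR ≤ n) (h2 : c.s₂ ≤ n) :
    frameBase (2 ^ c.total (2 ^ c.pairs)) ^ c.total (2 ^ c.pairs) ≤ 2 ^ 2 ^ (2 * (n + 4) ^ 2) ∧
      2 ^ c.total (2 ^ c.pairs) ≤ 2 ^ 2 ^ (2 * (n + 4) ^ 2) ∧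
      2 ^ c.pairs ≤ 2 ^ 2 ^ (2 * (n + 4) ^ 2) := by
  set T := c.total (2 ^ c.pairs) with hT
  have hp : c.pairs ≤ (n + 1) ^ 2 := by
    rw [sq]; exact Nat.mul_le_mul (by omega) (by omega)
  have hp' : 2 ^ c.pairs ≤ 2 ^ (n + 1) ^ 2 := Nat.pow_le_pow_right (by norm_num) hp
  have hn : n + 1 ≤ 2 ^ (n + 1) := Nat.lt_two_pow_self.le
  have hT1 : T ≤ 2 ^ ((n + 1) ^ 2 + n + 2) := by
    calc T = 2 ^ c.pairs * (c.s₂ + 1) + (c.sR + 1) := rfl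
      _ ≤ 2 ^ (n + 1) ^ 2 * 2 ^ (n + 1) + 2 ^ (n + 1) ^ 2 * 2 ^ (n + 1) := by
          refine Nat.add_le_add (Nat.mul_le_mul hp' (by omega)) ?_
          have : 1 ≤ 2 ^ (n + 1) ^ 2 := Nat.one_le_two_pow
          nlinarith
      _ = _ := by ring
  have hT0 : 1 ≤ T := by rw [hT]; unfold CodedInstance.total; omega
  have hmain : (3 * T + 1) * T ≤ 2 ^ (2 * (n + 4) ^ 2) := by
    calc (3 * T + 1) * T ≤ 4 * (T * T) := by nlinarith
      _ ≤ 2 ^ 2 * (2 ^ ((n + 1) ^ 2 + n + 2) * 2 ^ ((n + 1) ^ 2 + n + 2)) :=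
          Nat.mul_le_mul (by norm_num) (Nat.mul_le_mul hT1 hT1)
      _ = 2 ^ (2 + (((n + 1) ^ 2 + n + 2) + ((n + 1) ^ 2 + n + 2))) := by simp only [pow_add]
      _ ≤ _ := Nat.pow_le_pow_right (by norm_num) (by nlinarith)
  refine ⟨?_, ?_, ?_⟩
  · have e : frameBase (2 ^ T) = 2 ^ (3 * T + 1) := by unfold frameBase; ring
    rw [e, ← pow_mul]
    exact Nat.pow_le_pow_right (by norm_num) hmain
  · refine Nat.pow_le_pow_right (by norm_num) (le_trans ?_ hmain)
    nlinarith
  · refine Nat.pow_le_pow_right (by norm_num) (le_trans ?_ hmain)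
    have : c.pairs ≤ T := by
      have h := Nat.lt_two_pow_self (n := c.pairs)
      calc c.pairs ≤ 2 ^ c.pairs * (c.s₂ + 1) + (c.sR + 1) := by nlinarith
        _ = T := rfl
    nlinarith

/-- For this value of `B` the cut-offs have no effect and the guard of the recursion holds, so that
acceptance is the decision about the true numbers of sets. -/
theorem exists_encode_iff_accepts {Q : HintInstance → Prop} {f : Prop}
    (hQ : ∀ {c x S}, Codes c x →
      frameBase (2 ^ c.total (2 ^ c.pairs)) ^ c.total (2 ^ c.pairs) ≤ S →
      (c.Decision f (2 ^ c.pairs) (2 ^ c.total (2 ^ c.pairs)) S ↔ Q x)) (w : List Bool) :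
    w ∈ problemLanguage Q ↔ Accepts f (wcode w) (2 ^ 2 ^ (2 * (wlen (wcode w) + 4) ^ 2)) := by
  set W := wcode w with hW
  obtain ⟨h1, h2, h3⟩ := (inst W).frameBase_pow_le (item_le W _) (item_le W _)
  unfold Accepts bigSetBound setBound
  -- The inner cut-off has to be removed first, since the outer one refers to the total computed
  -- from it.
  rw [min_eq_left h3, min_eq_left h2]
  have hdec : ∀ x : HintInstance, x.encode = w → (ValidCode W ∧ ((inst W).Decision f
      (2 ^ (inst W).pairs) (2 ^ (inst W).total (2 ^ (inst W).pairs))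
      (2 ^ 2 ^ (2 * (wlen W + 4) ^ 2)) ↔ Q x)) := by
    rintro x rfl
    obtain ⟨hv, hc⟩ := validCode_encode x
    exact ⟨hv, hQ hc h1⟩
  constructor
  · rintro ⟨x, hx, hxw⟩
    exact ⟨(hdec x hxw).1, (hdec x hxw).2.2 hx⟩
  · rintro ⟨hv, hd⟩
    obtain ⟨x, hxw⟩ := exists_encode_of_validCode hv
    exact ⟨x, (hdec x hxw).2.1 hd, hxw⟩

theorem problemLanguage_mem_EXPSPACE {Q : HintInstance → Prop} {f : Prop}
    (hQ : ∀ {c x S}, Codes c x →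
      frameBase (2 ^ c.total (2 ^ c.pairs)) ^ c.total (2 ^ c.pairs) ≤ S →
      (c.Decision f (2 ^ c.pairs) (2 ^ c.total (2 ^ c.pairs)) S ↔ Q x)) :
    problemLanguage Q ∈ EXPSPACE Bool := by
  classical
  have hP : LS fun v : Fin 1 → ℕ => 2 * (wlen (v 0) + 4) ^ 2 :=
    LS.congr ((LS.const 2).mul (((LS.wlen (LS.var 0)).add (LS.const 4)).mul
      ((LS.wlen (LS.var 0)).add (LS.const 4)))) fun v => by rw [sq]
  obtain ⟨C, p, hp⟩ := LS.comp_two_pow_two_pow (F := fun W B => ind (Accepts f W B))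
    (LSP.accepts f) (P := fun W => 2 * (wlen W + 4) ^ 2) hP
  obtain ⟨M, c, hM⟩ : ∃ (M : Turing.TM2ComputableAux Bool Bool) (c : ℕ),
      DecidesInSpace M (problemLanguage Q)
        fun n => c * (2 ^ (2 * (n + 4) ^ 2) * (3 * (C + 1)) + 1 + 1) := by
    refine exists_decidesInSpace (p (fun _ => 0) 1 2) 1 _
      (fun n => 2 ^ (2 * (n + 4) ^ 2) * (3 * (C + 1)) + 1) (fun n => ?_) fun w => ?_
    · have h1 : n < 2 ^ (2 * (n + 4) ^ 2) :=
        Nat.lt_two_pow_self.trans_le (Nat.pow_le_pow_right (by norm_num) (by nlinarith))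
      nlinarith
    · set n := w.length with hn
      set X := 2 ^ 2 ^ (2 * (n + 4) ^ 2) with hX
      have hXW : wcode w ≤ X := by
        refine (wcode_lt w).le.trans (Nat.pow_le_pow_right (by norm_num) ?_)
        refine le_trans ?_ (Nat.lt_two_pow_self (n := 2 * (n + 4) ^ 2)).le
        nlinarith
      have h4 : 4 ≤ X := by
        have : 2 ^ 2 ≤ X := Nat.pow_le_pow_right (by norm_num) (by
          have : 2 ^ 1 ≤ 2 ^ (2 * (n + 4) ^ 2) := Nat.pow_le_pow_right (by norm_num) (by nlinarith)
          simpa using this)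
        simpa using this
      -- Since `wcode w ≤ X` and `4 ≤ X`, the base is at most `X ^ 3`; this is the origin of the
      -- factor `3` in the number of digits. The exponent is `C + 1` instead of `C` so that the
      -- bound also covers the input register if `C = 0`.
      have hlt : (X + wcode w + 2) ^ (C + 1) < 2 ^ (2 ^ (2 * (n + 4) ^ 2) * (3 * (C + 1)) + 1) := by
        calc (X + wcode w + 2) ^ (C + 1) ≤ (X ^ 3) ^ (C + 1) :=
              Nat.pow_le_pow_left (by nlinarith [Nat.mul_le_mul h4 h4]) _
          _ = 2 ^ (2 ^ (2 * (n + 4) ^ 2) * (3 * (C + 1))) := by rw [hX, ← pow_mul, ← pow_mul]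
          _ < _ := Nat.pow_lt_pow_right (by norm_num) (Nat.lt_succ_self _)
      have hs : (Function.update (0 : ℕ → ℕ) 0 (wcode w)) ∘ (fun _ : Fin 1 => 0) =
          fun _ => wcode w := by funext i; simp
      have hrun := hp (fun _ => 0) 1 2 (Function.update 0 0 (wcode w)) ((X + wcode w + 2) ^ (C + 1))
        (fun _ => by norm_num) (by norm_num) (fun _ => by norm_num)
        (fun r hr => by rw [Function.update_of_ne (by omega)]; rfl) (by simp) (fun r => ?_) ?_
      · rw [hs] at hrun
        refine ⟨decide (Accepts f (wcode w) (2 ^ 2 ^ (2 * (wlen (wcode w) + 4) ^ 2))), _, _, hlt, hrun,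
          ?_, ?_⟩
        · simp only [Function.update_self]
          by_cases h : Accepts f (wcode w) (2 ^ 2 ^ (2 * (wlen (wcode w) + 4) ^ 2)) <;> simp [ind, h]
        · rw [exists_encode_iff_accepts hQ]
          simp
      · have : wcode w ≤ (X + wcode w + 2) ^ (C + 1) :=
          (show wcode w ≤ X + wcode w + 2 by omega).trans (Nat.le_self_pow (by omega) _)
        by_cases hr : r = 0
        · subst hr; simpa using this
        · simp [hr]
      · rw [hs]
        simp only [wlen_wcode]
        exact Nat.pow_le_pow_right (Nat.succ_pos _) (Nat.le_succ _)
  -- The exponent `7` comes from `2 * (n + 4) ^ 2 ≤ 2 ^ 5 * n ^ 2 ≤ n ^ 7` for `n ≥ 2`; the summand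
  -- `50`, and with it the factor `2 ^ 50`, takes care of `n = 0` and `n = 1`.
  refine ⟨M, 7, c * (3 * (C + 1) + 2) * 2 ^ 50, fun w => ⟨(hM w).1, (hM w).2.1, fun d hd =>
    ((hM w).2.2 d hd).trans ?_⟩⟩
  generalize w.length = n
  have hn : 2 * (n + 4) ^ 2 ≤ n ^ 7 + 50 := by
    rcases Nat.lt_or_ge n 2 with h | h
    · interval_cases n <;> norm_num
    · have h5 : 2 ^ 5 ≤ n ^ 5 := Nat.pow_le_pow_left h 5
      calc 2 * (n + 4) ^ 2 ≤ 2 ^ 5 * n ^ 2 := by nlinarith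
        _ ≤ n ^ 5 * n ^ 2 := Nat.mul_le_mul_right _ h5
        _ = n ^ 7 := by ring
        _ ≤ _ := Nat.le_add_right _ _
  have h2 : 2 ^ (2 * (n + 4) ^ 2) ≤ 2 ^ n ^ 7 * 2 ^ 50 := by
    rw [← pow_add]; exact Nat.pow_le_pow_right (by norm_num) hn
  have h1 : 1 ≤ 2 ^ (2 * (n + 4) ^ 2) := Nat.one_le_two_pow
  calc c * (2 ^ (2 * (n + 4) ^ 2) * (3 * (C + 1)) + 1 + 1)
      ≤ c * (2 ^ (2 * (n + 4) ^ 2) * (3 * (C + 1) + 2)) := Nat.mul_le_mul_left _ (by nlinarith)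
    _ ≤ c * ((2 ^ n ^ 7 * 2 ^ 50) * (3 * (C + 1) + 2)) :=
        Nat.mul_le_mul_left _ (Nat.mul_le_mul_right _ h2)
    _ = _ := by ring

end AutDecomp

theorem theorem6p7 :
    AutDecomp.problemLanguage AutDecomp.HintInstance.TDP ∈ AutDecomp.EXPSPACE Bool ∧
      AutDecomp.problemLanguage AutDecomp.HintInstance.PDP ∈ AutDecomp.EXPSPACE Bool :=
  ⟨AutDecomp.problemLanguage_mem_EXPSPACE fun h hS => h.decision_tdp hS,
    AutDecomp.problemLanguage_mem_EXPSPACE fun h hS => h.decision_pdp hS⟩
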